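/- Let $\omega$ be a positive integer whose binary representation $B$ has exactly $n$ digits. Let $B^*$ be the word of length $2n+1$ consisting of $n$ ones, the one's complement of $B$, and a final $0$. Let $P_b=(b_1,\dots,b_{2n+1})$ be the sequence of the indices (from $1$) of the zeros of $B^*$ in ascending order, followed by the indices of the ones in descending order, and let $P_s$ be the permutation of $\{1,\dots,2n+1\}$ whose element at index $b_i$ is $b_{2n+2-i}$, for $1\le i\le 2n+1$. The watermark of the key $\omega$ is the digraph on $\{0,1,\dots,2n+2\}$ with the edges $u\to u-1$ for $1\le u\le 2n+2$ and $u\to q(u)$ for $1\le u\le 2n+1$, where $q(u)$ is the rightmost element of $P_s$ among those that are to the left of $u$ and greater than $u$, if there is one, and $q(u)=2n+2$ otherwise. A *canonical reducible permutation graph of size $n$* is a digraph on a given set of $2n+3$ vertices that is isomorphic to the watermark of some key with $n$ binary digits. (So the names of the vertices carry no information.) An edge modification is the insertion or the deletion of an edge. 1. Let $n>2$. Any two distinct canonical reducible permutation graphs $G_1\neq G_2$ of size $n$ on the same vertex set satisfy $|E(G_1)\setminus E(G_2)|=|E(G_2)\setminus E(G_1)|\ge 3$. 2. Attacks of at most $5$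 modifications can be detected in polynomial time: there is a polynomial-time algorithm that, given any digraph $H$ obtained by at most $5$ edge modifications from an unknown canonical reducible permutation graph $G$ of unknown size $n>2$, decides whether $H\neq G$. 3. Attacks of at most $2$ modifications can be recovered from in polynomial time: there is a polynomial-time algorithm that, given any digraph $H$ obtained by at most $2$ edge modifications from an unknown canonical reducible permutation graph $G$ of unknown size $n>2$, outputs $G$. 4. These bounds are tight. The watermarks $G_1,G_2$ of the keys $8$ and $9$ (both of size $n=4$) are not isomorphic and satisfy $|E(G_1)\setminus E(G_2)|=|E(G_2)\setminus E(G_1)|=3$. No procedure whatsoever detects all attacks of at most $6$ modifications in the sense of 2, and none recovers from all attacks of at most $3$ modifications in the sense of 3. -/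

import Mathlib

namespace Watermark

/-! ### The codec -/

/-- The digits `B_1, …, B_n` (most significant first) of the `n`-digit binary
representation of `ω`. -/
def keyDigits (n ω : ℕ) : List Bool :=
  (List.range n).map fun i => ω.testBit (n - 1 - i)

/-- The extended binary `B*`: `n` ones, the one's complement of `B`, and a final zero. -/
def extendedDigits (n ω : ℕ) : List Bool :=
  List.replicate n true ++ (keyDigits n ω).map not ++ [false]

/-- The ascending sequence of the (1-based) indices in `B*` of the digit `d`. -/
def indicesOf (n ω : ℕ) (d : Bool) : List ℕ :=
  (List.range' 1 (2 * n + 1)).filter fun i => (extendedDigits n ω)[i - 1]? == some d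

/-- The bitonic permutation `P_b`: the indices of zeros in ascending order, followed by the
indices of ones in descending order. -/
def bitonicPerm (n ω : ℕ) : List ℕ :=
  indicesOf n ω false ++ (indicesOf n ω true).reverse

/-- The self-inverting permutation `P_s`: at index `j = b_i` it has the element of `P_b` at
index `2n + 2 - i`, that is, the `i`-th element of `P_b` read backward. -/
def selfInvPerm (n ω : ℕ) : List ℕ :=
  (List.range' 1 (2 * n + 1)).map fun j =>
    (bitonicPerm n ω).reverse.getD ((bitonicPerm n ω).idxOf j) 0

/-- The head `q(u)` of the tree edge leaving `u`: the element greater than `u` that is to the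
left of `u` in `P_s` and rightmost among those, if there is one, and `2n + 2` otherwise. -/
def treeParent (n ω u : ℕ) : ℕ :=
  (((selfInvPerm n ω).take ((selfInvPerm n ω).idxOf u)).reverse.find?
    fun v => decide (u < v)).getD (2 * n + 2)

/-- The watermark of the key `ω` of size `n`, on the vertices `0, 1, …, 2n + 2`: the path edges
`u → u - 1` for `1 ≤ u ≤ 2n + 2`, and the tree edges `u → q(u)` for `1 ≤ u ≤ 2n + 1`. It is
meant for keys `ω` whose binary representation has exactly `n` digits. -/
def watermark (n ω : ℕ) : Digraph (Fin (2 * n + 3)) where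
  Adj u v := (u : ℕ) = v + 1 ∨
    (1 ≤ (u : ℕ) ∧ (u : ℕ) ≤ 2 * n + 1 ∧ (v : ℕ) = treeParent n ω u)

/-- A canonical reducible permutation graph on `2n + 3` vertices: a digraph which is, up to the
names of its vertices, the watermark of a positive key of size `n` (`Nat.size` is the number of
binary digits). -/
def IsCanonicalRPG (n : ℕ) (G : Digraph (Fin (2 * n + 3))) : Prop :=
  ∃ ω : ℕ, 0 < ω ∧ ω.size = n ∧ Nonempty (G.Adj ≃r (watermark n ω).Adj)

/-! ### Attacks -/

/-- The edge set of a digraph. -/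
def edgeSet {V : Type*} (G : Digraph V) : Set (V × V) := {e | G.Adj e.1 e.2}

/-- The number of edge modifications (insertions and deletions) that turn `G` into `H`. -/
noncomputable def numModifications {V : Type*} (G H : Digraph V) : ℕ :=
  (symmDiff (edgeSet G) (edgeSet H)).ncard

/-- The test `A` detects all attacks of at most `k` edge modifications: given any digraph `H`
obtained by at most `k` modifications from a canonical reducible permutation graph `G` with
`n > 2`, it raises the alarm exactly when `G` has been modified at all. -/
def DetectsUpTo (k : ℕ) (A : ∀ m : ℕ, Digraph (Fin m) → Prop) : Prop :=
  ∀ n : ℕ, 2 < n → ∀ G H : Digraph (Fin (2 * n + 3)), IsCanonicalRPG n G →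
    numModifications G H ≤ k → (A (2 * n + 3) H ↔ H ≠ G)

/-- The map `R` recovers from all attacks of at most `k` edge modifications: given any digraph
`H` obtained by at most `k` modifications from a canonical reducible permutation graph `G` with
`n > 2`, it returns `G`. -/
def RecoversUpTo (k : ℕ) (R : ∀ m : ℕ, Digraph (Fin m) → Digraph (Fin m)) : Prop :=
  ∀ n : ℕ, 2 < n → ∀ G H : Digraph (Fin (2 * n + 3)), IsCanonicalRPG n G →
    numModifications G H ≤ k → R (2 * n + 3) H = G

/-! ### Running time: while-programs on a random access machine -/

/-- A machine configuration: registers and a random access memory, holding natural numbers. -/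
structure Config where
  reg : ℕ → ℕ
  mem : ℕ → ℕ

/-- Programs for a random access machine with addition and truncated subtraction. (There is
no multiplication instruction, so that unit costs are polynomially equivalent to bit costs.) -/
inductive Program where
  /-- `r_x := c` -/
  | const (x c : ℕ)
  /-- `r_x := r_y + r_z` -/
  | add (x y z : ℕ)
  /-- `r_x := max (r_y - r_z) 0` -/
  | sub (x y z : ℕ)
  /-- `r_x := mem[r_y]` -/
  | load (x y : ℕ)
  /-- `mem[r_x] := r_y` -/
  | store (x y : ℕ)
  /-- first `p`, then `q` -/
  | seq (p q : Program)
  /-- `if r_x ≠ 0 then p else q` -/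
  | cond (x : ℕ) (p q : Program)
  /-- `while r_x ≠ 0 do p` -/
  | loop (x : ℕ) (p : Program)

/-- `Runs p s t s'`: started in the configuration `s`, the program `p` halts after exactly `t`
steps in the configuration `s'`. Every elementary instruction and every test of a register is
one step. -/
inductive Runs : Program → Config → ℕ → Config → Prop where
  | const (x c : ℕ) (s : Config) :
      Runs (.const x c) s 1 { s with reg := Function.update s.reg x c }
  | add (x y z : ℕ) (s : Config) :
      Runs (.add x y z) s 1 { s with reg := Function.update s.reg x (s.reg y + s.reg z) }
  | sub (x y z : ℕ) (s : Config) :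
      Runs (.sub x y z) s 1 { s with reg := Function.update s.reg x (s.reg y - s.reg z) }
  | load (x y : ℕ) (s : Config) :
      Runs (.load x y) s 1 { s with reg := Function.update s.reg x (s.mem (s.reg y)) }
  | store (x y : ℕ) (s : Config) :
      Runs (.store x y) s 1 { s with mem := Function.update s.mem (s.reg x) (s.reg y) }
  | seq {p q : Program} {s s₁ s₂ : Config} {t₁ t₂ : ℕ} :
      Runs p s t₁ s₁ → Runs q s₁ t₂ s₂ → Runs (.seq p q) s (t₁ + t₂) s₂
  | cond_true {x : ℕ} {p q : Program} {s s' : Config} {t : ℕ} :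
      s.reg x ≠ 0 → Runs p s t s' → Runs (.cond x p q) s (t + 1) s'
  | cond_false {x : ℕ} {p q : Program} {s s' : Config} {t : ℕ} :
      s.reg x = 0 → Runs q s t s' → Runs (.cond x p q) s (t + 1) s'
  | loop_done {x : ℕ} {p : Program} {s : Config} :
      s.reg x = 0 → Runs (.loop x p) s 1 s
  | loop_step {x : ℕ} {p : Program} {s s₁ s₂ : Config} {t₁ t₂ : ℕ} :
      s.reg x ≠ 0 → Runs p s t₁ s₁ → Runs (.loop x p) s₁ t₂ s₂ →
        Runs (.loop x p) s (t₁ + t₂ + 1) s₂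

open Classical in
/-- An entry of the adjacency matrix of a digraph. -/
noncomputable def adjBit {m : ℕ} (G : Digraph (Fin m)) (u v : Fin m) : ℕ :=
  if G.Adj u v then 1 else 0

/-- The memory contains the adjacency matrix of `G`, row by row, in the cells
`0, …, m ^ 2 - 1`. -/
def Holds {m : ℕ} (s : Config) (G : Digraph (Fin m)) : Prop :=
  ∀ u v : Fin m, s.mem ((u : ℕ) * m + v) = adjBit G u v

/-- The initial configuration on input `G`: register `0` holds the number `m` of vertices, the
memory holds the adjacency matrix of `G`, and everything else is `0`. -/
def IsInput {m : ℕ} (s : Config) (G : Digraph (Fin m)) : Prop :=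
  s.reg 0 = m ∧ (∀ x, x ≠ 0 → s.reg x = 0) ∧ Holds s G ∧ ∀ a, m ^ 2 ≤ a → s.mem a = 0

/-- A property of digraphs is decidable in polynomial time: some program halts on every input
within a number of steps polynomial in the number of vertices, and leaves in register `0`
the answer (`1` for yes and `0` for no). -/
def PolyTimeDecidable (A : ∀ m : ℕ, Digraph (Fin m) → Prop) : Prop :=
  ∃ (P : Program) (p : Polynomial ℕ), ∀ (m : ℕ) (G : Digraph (Fin m)) (s : Config),
    IsInput s G → ∃ (t : ℕ) (s' : Config), Runs P s t s' ∧ t ≤ p.eval m ∧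
      (A m G → s'.reg 0 = 1) ∧ (¬ A m G → s'.reg 0 = 0)

/-- A map from digraphs to digraphs is computable in polynomial time: some program halts on
every input within a number of steps polynomial in the number of vertices, and leaves the
adjacency matrix of the result in the memory. -/
def PolyTimeComputable (R : ∀ m : ℕ, Digraph (Fin m) → Digraph (Fin m)) : Prop :=
  ∃ (P : Program) (p : Polynomial ℕ), ∀ (m : ℕ) (G : Digraph (Fin m)) (s : Config),
    IsInput s G → ∃ (t : ℕ) (s' : Config), Runs P s t s' ∧ t ≤ p.eval m ∧ Holds s' (R m G)

end Watermark

namespace Watermark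

/-! ### The order of the bitonic permutation -/

/-- The position `i` of the extended binary `B*` holds a zero. -/
def IsZero (n ω i : ℕ) : Prop :=
  i = 2 * n + 1 ∨ (n + 1 ≤ i ∧ i ≤ 2 * n ∧ ω.testBit (2 * n - i) = true)

/-- The order in which a bitonic permutation lists the indices: those in `Z` ascending, then
the others descending. -/
def Precedes (Z : ℕ → Prop) (x y : ℕ) : Prop :=
  (Z x ∧ Z y ∧ x < y) ∨ (Z x ∧ ¬ Z y) ∨ (¬ Z x ∧ ¬ Z y ∧ y < x)

open Classical in
/-- The number of elements of `{1, …, m - 2}` that precede `x` in the bitonic order. -/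
noncomputable def rank (m : ℕ) (Z : ℕ → Prop) (x : ℕ) : ℕ :=
  ∑ y ∈ Finset.range m, if 1 ≤ y ∧ y + 2 ≤ m ∧ Precedes Z y x then 1 else 0

open Classical in
/-- The element of `{1, …, m - 2}` whose rank is opposite to that of `x`. -/
noncomputable def mirror (m : ℕ) (Z : ℕ → Prop) (x : ℕ) : ℕ :=
  ∑ y ∈ Finset.range m, if 1 ≤ y ∧ y + 2 ≤ m ∧ rank m Z y + rank m Z x + 3 = m then y else 0

/-- `v` is the rightmost element greater than `u` to the left of `u` in the permutation
`mirror m Z`, or it is `m - 1` and there is no such element. -/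
def IsParent (m : ℕ) (Z : ℕ → Prop) (u v : ℕ) : Prop :=
  (v + 2 ≤ m ∧ u < v ∧ mirror m Z v < mirror m Z u ∧
    ∀ x < m, 1 ≤ x → x + 2 ≤ m → mirror m Z v < mirror m Z x → mirror m Z x < mirror m Z u →
      x ≤ u) ∨
  (v + 1 = m ∧ ∀ x < m, 1 ≤ x → x + 2 ≤ m → mirror m Z x < mirror m Z u → x ≤ u)

theorem Precedes.irrefl (Z : ℕ → Prop) (x : ℕ) : ¬ Precedes Z x x := by
  unfold Precedes; grind

theorem Precedes.asymm {Z : ℕ → Prop} {x y : ℕ} (h : Precedes Z x y) : ¬ Precedes Z y x := by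
  unfold Precedes at *; grind

theorem extendedDigits_getElem? (n ω x : ℕ) (h1 : 1 ≤ x) (h2 : x ≤ 2 * n + 1) :
    ((extendedDigits n ω)[x - 1]? = some false ↔ IsZero n ω x) ∧
    ((extendedDigits n ω)[x - 1]? = some true ↔ ¬ IsZero n ω x) := by
  have key : ∃ d, (extendedDigits n ω)[x - 1]? = some d ∧ (d = false ↔ IsZero n ω x) := by
    unfold extendedDigits keyDigits IsZero
    by_cases ha : x ≤ n
    · refine ⟨true, ?_, ?_⟩
      · rw [List.append_assoc, List.getElem?_append_left (by simp; omega)]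
        rw [List.getElem?_replicate]; simp; omega
      · simp; omega
    · by_cases hb : x ≤ 2 * n
      · refine ⟨!(ω.testBit (2 * n - x)), ?_, ?_⟩
        · rw [List.getElem?_append_left (by simp; omega),
            List.getElem?_append_right (by simp; omega)]
          have h3 : x - 1 - n < n := by omega
          have h4 : n - 1 - (x - 1 - n) = 2 * n - x := by omega
          simp [h3, h4]
        · simp only [Bool.not_eq_false']
          constructor
          · intro h; exact Or.inr ⟨by omega, hb, h⟩
          · rintro (h | h)
            · omega
            · exact h.2.2
      · have : x = 2 * n + 1 := by omega
        subst this
        refine ⟨false, ?_, by simp⟩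
        rw [List.getElem?_append_right (by simp; omega)]
        simp [show 2 * n - (n + n) = 0 by omega]
  obtain ⟨d, hd, hz⟩ := key
  rw [hd, ← hz]
  cases d <;> simp

theorem mem_indicesOf {n ω x : ℕ} {d : Bool} : x ∈ indicesOf n ω d ↔
    1 ≤ x ∧ x ≤ 2 * n + 1 ∧ (IsZero n ω x ↔ d = false) := by
  unfold indicesOf
  simp only [List.mem_filter, List.mem_range'_1, beq_iff_eq]
  constructor
  · rintro ⟨⟨h1, h2⟩, h3⟩
    have h2' : x ≤ 2 * n + 1 := by omega
    have := extendedDigits_getElem? n ω x h1 h2'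
    refine ⟨h1, h2', ?_⟩
    cases d <;> grind
  · rintro ⟨h1, h2, h3⟩
    have := extendedDigits_getElem? n ω x h1 h2
    refine ⟨⟨h1, by omega⟩, ?_⟩
    cases d <;> grind

theorem pairwise_indicesOf (n ω : ℕ) (d : Bool) : (indicesOf n ω d).Pairwise (· < ·) :=
  (List.pairwise_lt_range' (s := 1) (n := 2 * n + 1)).filter _

theorem mem_bitonicPerm {n ω x : ℕ} : x ∈ bitonicPerm n ω ↔ 1 ≤ x ∧ x ≤ 2 * n + 1 := by
  unfold bitonicPerm
  simp only [List.mem_append, List.mem_reverse, mem_indicesOf]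
  grind

theorem pairwise_bitonicPerm (n ω : ℕ) :
    (bitonicPerm n ω).Pairwise (Precedes (IsZero n ω)) := by
  unfold bitonicPerm
  rw [List.pairwise_append]
  refine ⟨?_, ?_, ?_⟩
  · refine (pairwise_indicesOf n ω false).imp_of_mem ?_
    intro a b ha hb hab
    rw [mem_indicesOf] at ha hb
    unfold Precedes; grind
  · rw [List.pairwise_reverse]
    refine (pairwise_indicesOf n ω true).imp_of_mem ?_
    intro a b ha hb hab
    rw [mem_indicesOf] at ha hb
    unfold Precedes; grind
  · intro a ha b hb
    rw [List.mem_reverse] at hb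
    rw [mem_indicesOf] at ha hb
    unfold Precedes; grind

theorem nodup_bitonicPerm (n ω : ℕ) : (bitonicPerm n ω).Nodup :=
  (pairwise_bitonicPerm n ω).imp fun {_ b} h => fun hab => Precedes.irrefl _ b (hab ▸ h)

theorem length_bitonicPerm (n ω : ℕ) : (bitonicPerm n ω).length = 2 * n + 1 := by
  have h := List.toFinset_card_of_nodup (nodup_bitonicPerm n ω)
  have h2 : (bitonicPerm n ω).toFinset = Finset.Icc 1 (2 * n + 1) := by
    ext x; simp [mem_bitonicPerm]
  rw [← h, h2]; simp

theorem rank_getElem (n ω i : ℕ) (hi : i < (bitonicPerm n ω).length) :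
    rank (2 * n + 3) (IsZero n ω) (bitonicPerm n ω)[i] = i := by
  classical
  have hp := pairwise_bitonicPerm n ω
  rw [List.pairwise_iff_getElem] at hp
  unfold rank
  rw [Finset.sum_boole]
  have : (Finset.range (2 * n + 3)).filter (fun y => 1 ≤ y ∧ y + 2 ≤ 2 * n + 3 ∧
      Precedes (IsZero n ω) y (bitonicPerm n ω)[i]) =
      (Finset.range i).image (fun j => (bitonicPerm n ω).getD j 0) := by
    ext y
    simp only [Finset.mem_filter, Finset.mem_range, Finset.mem_image]
    constructor
    · rintro ⟨_, h1, h2, h3⟩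
      have hy : y ∈ bitonicPerm n ω := mem_bitonicPerm.2 ⟨h1, by omega⟩
      obtain ⟨j, hj, rfl⟩ := List.getElem_of_mem hy
      refine ⟨j, ?_, by simp [hj]⟩
      by_contra hij
      rcases Nat.lt_or_ge i j with h | h
      · exact (hp i j hi hj h).asymm h3
      · obtain rfl : i = j := by omega
        exact Precedes.irrefl _ _ h3
    · rintro ⟨j, hj, rfl⟩
      have hj' : j < (bitonicPerm n ω).length := by omega
      have e : (bitonicPerm n ω).getD j 0 = (bitonicPerm n ω)[j] := by simp [hj']
      rw [e]
      have hm := mem_bitonicPerm.1 (List.getElem_mem hj')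
      exact ⟨by omega, hm.1, by omega, hp j i hj' hi hj⟩
  rw [this, Finset.card_image_of_injOn, Finset.card_range]
  · simp
  · intro a ha b hb hab
    simp only [Finset.coe_range, Set.mem_Iio] at ha hb
    have ha' : a < (bitonicPerm n ω).length := by omega
    have hb' : b < (bitonicPerm n ω).length := by omega
    have : (bitonicPerm n ω)[a] = (bitonicPerm n ω)[b] := by simpa [ha', hb'] using hab
    exact (List.Nodup.getElem_inj_iff (nodup_bitonicPerm n ω)).1 this

theorem rank_eq_idxOf {n ω x : ℕ} (h1 : 1 ≤ x) (h2 : x ≤ 2 * n + 1) :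
    rank (2 * n + 3) (IsZero n ω) x = (bitonicPerm n ω).idxOf x := by
  have hx := mem_bitonicPerm (ω := ω).2 ⟨h1, h2⟩
  have hi := List.idxOf_lt_length_of_mem hx
  conv_lhs => rw [← List.getElem_idxOf hi]
  exact rank_getElem n ω _ hi

theorem rank_le {n ω x : ℕ} (h1 : 1 ≤ x) (h2 : x ≤ 2 * n + 1) :
    rank (2 * n + 3) (IsZero n ω) x ≤ 2 * n := by
  have hx := mem_bitonicPerm (ω := ω).2 ⟨h1, h2⟩
  have hi := List.idxOf_lt_length_of_mem hx
  rw [rank_eq_idxOf h1 h2]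
  rw [length_bitonicPerm] at hi
  omega

theorem exists_rank {n ω i : ℕ} (hi : i ≤ 2 * n) :
    ∃ x, 1 ≤ x ∧ x ≤ 2 * n + 1 ∧ rank (2 * n + 3) (IsZero n ω) x = i := by
  have hi' : i < (bitonicPerm n ω).length := by rw [length_bitonicPerm]; omega
  have hm := mem_bitonicPerm.1 (List.getElem_mem hi')
  exact ⟨_, hm.1, hm.2, rank_getElem n ω i hi'⟩

theorem rank_inj {n ω x y : ℕ} (h1 : 1 ≤ x) (h2 : x ≤ 2 * n + 1) (h3 : 1 ≤ y) (h4 : y ≤ 2 * n + 1)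
    (h : rank (2 * n + 3) (IsZero n ω) x = rank (2 * n + 3) (IsZero n ω) y) : x = y := by
  rw [rank_eq_idxOf h1 h2, rank_eq_idxOf h3 h4] at h
  exact (List.idxOf_inj (mem_bitonicPerm.2 ⟨h1, h2⟩)).1 h

theorem rank_lt_rank {n ω x y : ℕ} (h1 : 1 ≤ x) (h2 : x ≤ 2 * n + 1) (h3 : 1 ≤ y)
    (h4 : y ≤ 2 * n + 1) :
    rank (2 * n + 3) (IsZero n ω) x < rank (2 * n + 3) (IsZero n ω) y ↔
      Precedes (IsZero n ω) x y := by
  have hlt : ∀ {x y}, 1 ≤ x → x ≤ 2 * n + 1 → 1 ≤ y → y ≤ 2 * n + 1 →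
      rank (2 * n + 3) (IsZero n ω) x < rank (2 * n + 3) (IsZero n ω) y →
      Precedes (IsZero n ω) x y := by
    intro x y h1 h2 h3 h4 h
    rw [rank_eq_idxOf h1 h2, rank_eq_idxOf h3 h4] at h
    have hx := List.idxOf_lt_length_of_mem (mem_bitonicPerm (ω := ω).2 ⟨h1, h2⟩)
    have hy := List.idxOf_lt_length_of_mem (mem_bitonicPerm (ω := ω).2 ⟨h3, h4⟩)
    have := (List.pairwise_iff_getElem.1 (pairwise_bitonicPerm n ω)) _ _ hx hy h
    simpa only [List.getElem_idxOf] using this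
  refine ⟨hlt h1 h2 h3 h4, fun h => ?_⟩
  by_contra hc
  rcases Nat.lt_or_ge (rank (2 * n + 3) (IsZero n ω) y) (rank (2 * n + 3) (IsZero n ω) x) with
    h' | h'
  · exact (hlt h3 h4 h1 h2 h').asymm h
  · exact Precedes.irrefl _ _ (rank_inj (ω := ω) h1 h2 h3 h4 (by omega) ▸ h)

theorem mirror_eq {n ω x y : ℕ} (h1 : 1 ≤ y) (h2 : y ≤ 2 * n + 1)
    (h : rank (2 * n + 3) (IsZero n ω) y + rank (2 * n + 3) (IsZero n ω) x = 2 * n) :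
    mirror (2 * n + 3) (IsZero n ω) x = y := by
  unfold mirror
  rw [Finset.sum_eq_single y]
  · rw [if_pos ⟨h1, by omega, by omega⟩]
  · intro z _ hz
    rw [if_neg]
    rintro ⟨h3, h4, h5⟩
    exact hz (rank_inj (ω := ω) h3 (by omega) h1 h2 (by omega))
  · intro hy
    simp at hy; omega

theorem mirror_spec {n ω x : ℕ} (h1 : 1 ≤ x) (h2 : x ≤ 2 * n + 1) :
    1 ≤ mirror (2 * n + 3) (IsZero n ω) x ∧ mirror (2 * n + 3) (IsZero n ω) x ≤ 2 * n + 1 ∧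
    rank (2 * n + 3) (IsZero n ω) (mirror (2 * n + 3) (IsZero n ω) x) +
      rank (2 * n + 3) (IsZero n ω) x = 2 * n := by
  have hr := rank_le (ω := ω) h1 h2
  obtain ⟨y, hy1, hy2, hy⟩ := exists_rank (n := n) (ω := ω)
    (i := 2 * n - rank (2 * n + 3) (IsZero n ω) x) (by omega)
  rw [mirror_eq (x := x) hy1 hy2 (by omega)]
  exact ⟨hy1, hy2, by omega⟩

theorem mirror_mirror {n ω x : ℕ} (h1 : 1 ≤ x) (h2 : x ≤ 2 * n + 1) :
    mirror (2 * n + 3) (IsZero n ω) (mirror (2 * n + 3) (IsZero n ω) x) = x := by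
  have h := mirror_spec (ω := ω) h1 h2
  exact mirror_eq h1 h2 (by omega)

theorem selfInvPerm_eq (n ω : ℕ) : selfInvPerm n ω =
    (List.range' 1 (2 * n + 1)).map (mirror (2 * n + 3) (IsZero n ω)) := by
  unfold selfInvPerm
  refine List.map_congr_left fun x hx => ?_
  rw [List.mem_range'_1] at hx
  have h1 := hx.1
  have h2 : x ≤ 2 * n + 1 := by omega
  symm
  have hr := rank_le (ω := ω) h1 h2
  have hl := length_bitonicPerm n ω
  rw [← rank_eq_idxOf h1 h2]
  have hi : rank (2 * n + 3) (IsZero n ω) x < (bitonicPerm n ω).reverse.length := by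
    rw [List.length_reverse]; omega
  rw [List.getD_eq_getElem _ _ hi, List.getElem_reverse]
  have hi2 : (bitonicPerm n ω).length - 1 - rank (2 * n + 3) (IsZero n ω) x <
    (bitonicPerm n ω).length := by omega
  have hm := mem_bitonicPerm.1 (List.getElem_mem hi2)
  refine mirror_eq hm.1 hm.2 ?_
  rw [rank_getElem n ω _ hi2]
  omega

theorem reverse_find?_map_range' (g : ℕ → ℕ) (p : ℕ → Bool) (w i : ℕ) :
    ((List.range' 1 i).map g).reverse.find? p = some w ↔
      ∃ j, 1 ≤ j ∧ j ≤ i ∧ g j = w ∧ p w = true ∧ ∀ j', j < j' → j' ≤ i → p (g j') = false := by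
  induction i with
  | zero => simp
  | succ i ih =>
    rw [List.range'_concat, List.map_append, List.reverse_append]
    simp only [List.map_cons, List.map_nil, List.reverse_cons, List.reverse_nil, List.nil_append,
      List.singleton_append, List.find?_cons, one_mul]
    rw [Nat.add_comm 1 i]
    cases hp : p (g (i + 1)) with
    | true =>
      simp only [Option.some.injEq]
      constructor
      · rintro rfl
        exact ⟨i + 1, by omega, le_refl _, rfl, hp, fun j' h1 h2 => by omega⟩
      · rintro ⟨j, h1, h2, h3, h4, h5⟩
        rcases Nat.lt_or_ge j (i + 1) with h | h
        · rw [h5 (i + 1) h le_rfl] at hp; cases hp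
        · obtain rfl : j = i + 1 := by omega
          exact h3
    | false =>
      simp only [ih]
      constructor
      · rintro ⟨j, h1, h2, h3, h4, h5⟩
        refine ⟨j, h1, by omega, h3, h4, fun j' h6 h7 => ?_⟩
        rcases Nat.lt_or_ge j' (i + 1) with h | h
        · exact h5 j' h6 (by omega)
        · obtain rfl : j' = i + 1 := by omega
          exact hp
      · rintro ⟨j, h1, h2, h3, h4, h5⟩
        have : j ≠ i + 1 := by rintro rfl; rw [h3, h4] at hp; cases hp
        exact ⟨j, h1, by omega, h3, h4, fun j' h6 h7 => h5 j' h6 (by omega)⟩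

theorem idxOf_selfInvPerm {n ω u : ℕ} (h1 : 1 ≤ u) (h2 : u ≤ 2 * n + 1) :
    (selfInvPerm n ω).idxOf u + 1 = mirror (2 * n + 3) (IsZero n ω) u := by
  rw [selfInvPerm_eq]
  have hm := mirror_spec (ω := ω) h1 h2
  have hnd : ((List.range' 1 (2 * n + 1)).map (mirror (2 * n + 3) (IsZero n ω))).Nodup := by
    refine List.Nodup.map_on ?_ List.nodup_range'
    intro x hx y hy hxy
    rw [List.mem_range'_1] at hx hy
    rw [← mirror_mirror (ω := ω) hx.1 (by omega : x ≤ 2 * n + 1), hxy,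
      mirror_mirror hy.1 (by omega)]
  have hi : mirror (2 * n + 3) (IsZero n ω) u - 1 <
      ((List.range' 1 (2 * n + 1)).map (mirror (2 * n + 3) (IsZero n ω))).length := by
    simp; omega
  have he : ((List.range' 1 (2 * n + 1)).map (mirror (2 * n + 3) (IsZero n ω)))[
      mirror (2 * n + 3) (IsZero n ω) u - 1] = u := by
    simp only [List.getElem_map, List.getElem_range', one_mul]
    rw [show 1 + (mirror (2 * n + 3) (IsZero n ω) u - 1) = mirror (2 * n + 3) (IsZero n ω) u by
      omega]
    exact mirror_mirror h1 h2
  have := List.Nodup.idxOf_getElem hnd _ hi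
  rw [he] at this
  omega

theorem treeParent_eq_iff {n ω u v : ℕ} (h1 : 1 ≤ u) (h2 : u ≤ 2 * n + 1) :
    treeParent n ω u = v ↔ IsParent (2 * n + 3) (IsZero n ω) u v := by
  unfold treeParent IsParent
  have hm := mirror_spec (ω := ω) h1 h2
  have hidx := idxOf_selfInvPerm (ω := ω) h1 h2
  generalize (selfInvPerm n ω).idxOf u = i at *
  rw [selfInvPerm_eq, ← List.map_take, List.take_range'_of_length_ge (by omega)]
  generalize hM : mirror (2 * n + 3) (IsZero n ω) = f at *
  have hinv : ∀ x, 1 ≤ x → x ≤ 2 * n + 1 → f (f x) = x ∧ 1 ≤ f x ∧ f x ≤ 2 * n + 1 := by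
    intro x hx1 hx2
    have := mirror_mirror (ω := ω) hx1 hx2
    have h' := mirror_spec (ω := ω) hx1 hx2
    rw [hM] at this h'
    exact ⟨this, h'.1, h'.2.1⟩
  cases hf : ((List.range' 1 i).map f).reverse.find? fun v => decide (u < v) with
  | none =>
    rw [List.find?_eq_none] at hf
    simp only [List.mem_reverse, List.mem_map, List.mem_range'_1, decide_eq_true_eq,
      forall_exists_index, and_imp] at hf
    have hno : ∀ x, 1 ≤ x → x ≤ 2 * n + 1 → f x < f u → x ≤ u := by
      intro x hx1 hx2 hx
      obtain ⟨e1, e2, e3⟩ := hinv x hx1 hx2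
      have := hf x (f x) e2 (by omega) e1
      omega
    simp only [Option.getD_none]
    constructor
    · rintro rfl
      exact Or.inr ⟨rfl, fun x _ hx1 hx2 hx => hno x hx1 (by omega) hx⟩
    · rintro (⟨h3, h4, h5, h6⟩ | ⟨h3, h4⟩)
      · have := hno v (by omega) (by omega) h5; omega
      · omega
  | some w =>
    rw [reverse_find?_map_range'] at hf
    obtain ⟨j, hj1, hj2, rfl, hj4, hj5⟩ := hf
    simp only [decide_eq_true_eq, decide_eq_false_iff_not, not_lt] at hj4 hj5
    simp only [Option.getD_some]
    obtain ⟨e1, e2, e3⟩ := hinv j hj1 (by omega)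
    have hmain : ∀ x, 1 ≤ x → x ≤ 2 * n + 1 → f (f j) < f x → f x < f u → x ≤ u := by
      intro x hx1 hx2 hx hx'
      obtain ⟨g1, g2, g3⟩ := hinv x hx1 hx2
      have := hj5 (f x) (by omega) (by omega)
      omega
    constructor
    · rintro rfl
      exact Or.inl ⟨by omega, hj4, by omega, fun x _ hx1 hx2 hx hx' =>
        hmain x hx1 (by omega) hx hx'⟩
    · rintro (⟨h3, h4, h5, h6⟩ | ⟨h3, h4⟩)
      · obtain ⟨g1, g2, g3⟩ := hinv v (by omega) (by omega)
        rcases Nat.lt_trichotomy (f v) j with h | h | h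
        · have := h6 (f j) (by omega) e2 (by omega) (by omega) (by omega)
          omega
        · rw [← g1, h]
        · have := hmain v (by omega) (by omega) (by omega) h5
          omega
      · have := h4 (f j) (by omega) e2 (by omega) (by omega)
        omega

/-! ### The tree of a watermark -/

/-- The properties of the zeros `Z` of `B*`, the ranks `r` in the bitonic permutation, the
self-inverting permutation `f` and the tree `q` of a watermark of size `n`. -/
structure TreeData (n : ℕ) (Z : ℕ → Prop) (r f q : ℕ → ℕ) : Prop where
  one_le : 1 ≤ n
  zero_first : Z (n + 1)
  zero_last : Z (2 * n + 1)
  le_of_zero : ∀ {i}, Z i → n + 1 ≤ i ∧ i ≤ 2 * n + 1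
  rank_le : ∀ {x}, 1 ≤ x → x ≤ 2 * n + 1 → r x ≤ 2 * n
  exists_rank : ∀ {i}, i ≤ 2 * n → ∃ x, 1 ≤ x ∧ x ≤ 2 * n + 1 ∧ r x = i
  rank_inj : ∀ {x y}, 1 ≤ x → x ≤ 2 * n + 1 → 1 ≤ y → y ≤ 2 * n + 1 → r x = r y → x = y
  rank_lt : ∀ {x y}, 1 ≤ x → x ≤ 2 * n + 1 → 1 ≤ y → y ≤ 2 * n + 1 →
    (r x < r y ↔ Precedes Z x y)
  mirror_spec : ∀ {x}, 1 ≤ x → x ≤ 2 * n + 1 → 1 ≤ f x ∧ f x ≤ 2 * n + 1 ∧ r (f x) + r x = 2 * n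
  mirror_mirror : ∀ {x}, 1 ≤ x → x ≤ 2 * n + 1 → f (f x) = x
  parent_iff : ∀ {u v}, 1 ≤ u → u ≤ 2 * n + 1 → (q u = v ↔
    (v ≤ 2 * n + 1 ∧ u < v ∧ f v < f u ∧
      ∀ x, 1 ≤ x → x ≤ 2 * n + 1 → f v < f x → f x < f u → x ≤ u) ∨
    (v = 2 * n + 2 ∧ ∀ x, 1 ≤ x → x ≤ 2 * n + 1 → f x < f u → x ≤ u))

theorem isZero_first {n ω : ℕ} (h : ω.size = n) (h0 : 0 < ω) : IsZero n ω (n + 1) := by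
  have hn : 1 ≤ n := by rw [← h]; exact Nat.size_pos.2 h0
  refine Or.inr ⟨le_rfl, by omega, ?_⟩
  have h1 : 2 * n - (n + 1) = n - 1 := by omega
  rw [h1]
  have h2 : ω < 2 ^ (n - 1 + 1) := by
    rw [← Nat.size_le]; omega
  have h3 : 2 ^ (n - 1) ≤ ω := by
    rw [← Nat.lt_size]; omega
  rw [Nat.testBit_eq_decide_div_mod_eq, decide_eq_true_eq]
  have : ω / 2 ^ (n - 1) = 1 := by
    rw [Nat.div_eq_iff (by positivity)]
    rw [pow_succ] at h2
    omega
  rw [this]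

theorem treeData {n ω : ℕ} (h : ω.size = n) (h0 : 0 < ω) :
    TreeData n (IsZero n ω) (rank (2 * n + 3) (IsZero n ω)) (mirror (2 * n + 3) (IsZero n ω))
      (treeParent n ω) where
  one_le := by rw [← h]; exact Nat.size_pos.2 h0
  zero_first := isZero_first h h0
  zero_last := Or.inl rfl
  le_of_zero := by unfold IsZero; omega
  rank_le := rank_le
  exists_rank := exists_rank
  rank_inj := rank_inj
  rank_lt := rank_lt_rank
  mirror_spec := mirror_spec
  mirror_mirror := mirror_mirror
  parent_iff := by
    intro u v h1 h2
    rw [treeParent_eq_iff h1 h2]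
    unfold IsParent
    refine or_congr ?_ ?_
    · refine and_congr (by omega) (and_congr Iff.rfl (and_congr Iff.rfl ?_))
      exact ⟨fun H x a b c d => H x (by omega) a (by omega) c d,
        fun H x _ a b c d => H x a (by omega) c d⟩
    · refine and_congr (by omega) ?_
      exact ⟨fun H x a b c => H x (by omega) a (by omega) c,
        fun H x _ a b c => H x a (by omega) c⟩

namespace TreeData

variable {n : ℕ} {Z : ℕ → Prop} {r f q : ℕ → ℕ}

theorem rank_small (T : TreeData n Z r f q) {i : ℕ} (h1 : 1 ≤ i) (h2 : i ≤ n) :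
    r i = 2 * n + 1 - i := by
  induction i, h1 using Nat.le_induction with
  | base =>
    by_contra hc
    have hle := T.rank_le le_rfl (by omega : 1 ≤ 2 * n + 1)
    obtain ⟨x, hx1, hx2, hx⟩ := T.exists_rank (i := r 1 + 1) (by omega)
    have := (T.rank_lt le_rfl (by omega) hx1 hx2).1 (by omega)
    have hz := @T.le_of_zero 1
    unfold Precedes at this
    have hn := T.one_le
    have : ¬ Z 1 := fun h => by have := hz h; omega
    grind
  | succ i hi ih =>
    have ih := ih (by omega)
    by_contra hc
    have h3 : r (i + 1) < r i := by
      rw [T.rank_lt (by omega) (by omega) (by omega) (by omega)]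
      have b1 : ¬ Z i := fun h => by have := T.le_of_zero h; omega
      have b2 : ¬ Z (i + 1) := fun h => by have := T.le_of_zero h; omega
      exact Or.inr (Or.inr ⟨b2, b1, by omega⟩)
    obtain ⟨x, hx1, hx2, hx⟩ := T.exists_rank (i := r (i + 1) + 1) (by omega)
    have a1 := (T.rank_lt (by omega) (by omega) hx1 hx2).1 (by omega : r (i + 1) < r x)
    have a2 := (T.rank_lt hx1 hx2 (by omega) (by omega)).1 (by omega : r x < r i)
    have b1 : ¬ Z i := fun h => by have := T.le_of_zero h; omega
    have b2 : ¬ Z (i + 1) := fun h => by have := T.le_of_zero h; omega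
    unfold Precedes at a1 a2
    grind

theorem le_iff_lt_rank (T : TreeData n Z r f q) {x : ℕ} (h1 : 1 ≤ x) (h2 : x ≤ 2 * n + 1) :
    x ≤ n ↔ n < r x := by
  constructor
  · intro h; rw [T.rank_small h1 h]; omega
  · intro h
    have hr := T.rank_le h1 h2
    have h3 := T.rank_small (i := 2 * n + 1 - r x) (by omega) (by omega)
    have := T.rank_inj h1 h2 (by omega) (by omega) (by omega : r x = r (2 * n + 1 - r x))
    omega

theorem mirror_of_rank_lt (T : TreeData n Z r f q) {x : ℕ} (h1 : 1 ≤ x) (h2 : x ≤ 2 * n + 1)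
    (h : r x < n) : f x = r x + 1 := by
  have hm := T.mirror_spec h1 h2
  have h3 := T.rank_small (i := r x + 1) (by omega) (by omega)
  exact T.rank_inj hm.1 hm.2.1 (by omega) (by omega) (by omega)

theorem mirror_of_rank_eq (T : TreeData n Z r f q) {x : ℕ} (h1 : 1 ≤ x) (h2 : x ≤ 2 * n + 1)
    (h : r x = n) : f x = x := by
  have hm := T.mirror_spec h1 h2
  exact T.rank_inj hm.1 hm.2.1 h1 h2 (by omega)

theorem mirror_of_le (T : TreeData n Z r f q) {x : ℕ} (h1 : 1 ≤ x) (h2 : x ≤ n) :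
    n < f x ∧ f x ≤ 2 * n + 1 ∧ r (f x) + 1 = x := by
  have hm := T.mirror_spec h1 (by omega)
  have h3 := T.rank_small h1 h2
  have := T.le_iff_lt_rank hm.1 hm.2.1
  omega

theorem precedes_iff (T : TreeData n Z r f q) {x y : ℕ} (h1 : n < x) (h2 : x ≤ 2 * n + 1)
    (h3 : n < y) (h4 : y ≤ 2 * n + 1) : r x < r y ↔ Precedes Z x y :=
  T.rank_lt (by omega) h2 (by omega) h4

theorem parent_of_zero (T : TreeData n Z r f q) {u : ℕ} (hz : Z u) : q u = 2 * n + 2 := by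
  have hu := T.le_of_zero hz
  rw [T.parent_iff (by omega) hu.2]
  refine Or.inr ⟨rfl, fun x h1 h2 h3 => ?_⟩
  by_contra hc
  have hx : n < x := by omega
  have a1 := T.le_iff_lt_rank h1 h2
  have a2 := T.le_iff_lt_rank (by omega) hu.2
  have hp : r u < r x := by
    rw [T.precedes_iff (by omega) hu.2 hx h2]
    unfold Precedes; grind
  rw [T.mirror_of_rank_lt (by omega) hu.2 (by omega)] at h3
  rcases Nat.lt_or_ge (r x) n with h | h
  · rw [T.mirror_of_rank_lt h1 h2 h] at h3; omega
  · rw [T.mirror_of_rank_eq h1 h2 (by omega)] at h3; omega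

theorem mirror_lt_of_rank_lt (T : TreeData n Z r f q) {x y : ℕ} (h1 : n < x)
    (h2 : x ≤ 2 * n + 1) (h3 : n < y) (h4 : y ≤ 2 * n + 1) (h : r x < r y) : f x < f y := by
  have a2 := T.le_iff_lt_rank (by omega) h4
  rw [T.mirror_of_rank_lt (by omega) h2 (by omega)]
  rcases Nat.lt_or_ge (r y) n with h' | h'
  · rw [T.mirror_of_rank_lt (by omega) h4 h']; omega
  · rw [T.mirror_of_rank_eq (by omega) h4 (by omega)]; omega

theorem parent_of_not_zero (T : TreeData n Z r f q) {u w : ℕ} (hu : n < u) (hu' : u ≤ 2 * n + 1)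
    (hz : ¬ Z u) (hw : 1 ≤ w) (hw' : w ≤ 2 * n + 1) (h : r w + 1 = r u) :
    q u = w ∧ n < w ∧ u < w ∧ (Z w → w = 2 * n + 1) := by
  have a1 := T.le_iff_lt_rank hw hw'
  have a2 := T.le_iff_lt_rank (by omega) hu'
  have hwn : n < w := by omega
  have hp := (T.precedes_iff hwn hw' hu hu').1 (by omega)
  have hlast : Z w → w = 2 * n + 1 := by
    intro hzw
    by_contra hne
    have b1 : r w < r (2 * n + 1) := by
      rw [T.precedes_iff hwn hw' (by omega) le_rfl]
      have := T.zero_last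
      unfold Precedes; grind
    have b2 : r (2 * n + 1) < r u := by
      rw [T.precedes_iff (by omega) le_rfl hu hu']
      have := T.zero_last
      unfold Precedes; grind
    omega
  have huw : u < w := by
    have hne : u ≠ 2 * n + 1 := by rintro rfl; exact hz T.zero_last
    unfold Precedes at hp
    grind
  refine ⟨?_, hwn, huw, hlast⟩
  rw [T.parent_iff (by omega) hu']
  refine Or.inl ⟨hw', huw, T.mirror_lt_of_rank_lt hwn hw' hu hu' (by omega), ?_⟩
  intro x h1 h2 h3 h4
  by_contra hc
  have c1 : ¬ r x < r w := fun h' => by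
    have := T.mirror_lt_of_rank_lt (by omega) h2 hwn hw' h'; omega
  have c2 : ¬ r u < r x := fun h' => by
    have := T.mirror_lt_of_rank_lt hu hu' (by omega) h2 h'; omega
  have c3 : r x = r w ∨ r x = r u := by omega
  rcases c3 with c3 | c3
  · rw [T.rank_inj h1 h2 hw hw' c3] at h3; omega
  · rw [T.rank_inj h1 h2 (by omega) hu' c3] at h4; omega

/-- A vertex above `n` that is not a child of the root has a parent, next to it in rank. -/
theorem exists_parent (T : TreeData n Z r f q) {u : ℕ} (hu : n < u) (hu' : u ≤ 2 * n + 1)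
    (hz : ¬ Z u) : n < q u ∧ q u ≤ 2 * n + 1 ∧ r (q u) + 1 = r u ∧ u < q u ∧
      (Z (q u) → q u = 2 * n + 1) := by
  have h0 : r (n + 1) < r u := by
    rw [T.precedes_iff (by omega) (by have := T.one_le; omega) hu hu']
    have := T.zero_first
    unfold Precedes; grind
  have hr := T.rank_le (by omega) hu'
  obtain ⟨w, hw, hw', h⟩ := T.exists_rank (i := r u - 1) (by omega)
  obtain ⟨e1, e2, e3, e4⟩ := T.parent_of_not_zero hu hu' hz hw hw' (by omega)
  rw [e1]
  exact ⟨e2, hw', by omega, e3, e4⟩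

theorem zero_iff_parent (T : TreeData n Z r f q) {u : ℕ} (hu : n < u) (hu' : u ≤ 2 * n + 1) :
    Z u ↔ q u = 2 * n + 2 := by
  refine ⟨T.parent_of_zero, fun h => ?_⟩
  by_contra hz
  have := T.exists_parent hu hu' hz
  omega

theorem lt_parent (T : TreeData n Z r f q) {u : ℕ} (hu : 1 ≤ u) (hu' : u ≤ 2 * n + 1) :
    u < q u ∧ q u ≤ 2 * n + 2 := by
  have := (T.parent_iff hu hu' (v := q u)).1 rfl
  omega

theorem rank_first (T : TreeData n Z r f q) : r (n + 1) = 0 := by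
  obtain ⟨x, h1, h2, h3⟩ := T.exists_rank (i := 0) (by omega)
  by_contra hc
  have h4 : r x < r (n + 1) := by omega
  have hn := T.one_le
  have h5 := (T.rank_lt h1 h2 (by omega) (by omega)).1 h4
  have := T.zero_first
  have := @T.le_of_zero x
  unfold Precedes at h5
  grind

theorem mirror_one (T : TreeData n Z r f q) : f 1 = n + 1 := by
  have hn := T.one_le
  have h := T.mirror_of_le le_rfl hn
  exact T.rank_inj (by omega) (by omega) (by omega) (by omega) (by rw [T.rank_first]; omega)

theorem parent_le (T : TreeData n Z r f q) {u : ℕ} (hu : 1 ≤ u) (hu' : u ≤ n) :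
    q u ≤ 2 * n + 1 := by
  have hn := T.one_le
  have h := (T.parent_iff hu (by omega) (v := q u)).1 rfl
  rcases h with h | ⟨_, h⟩
  · exact h.1
  · have h1 : f (n + 1) = 1 := by rw [← T.mirror_one, T.mirror_mirror le_rfl (by omega)]
    have h2 := T.mirror_of_le hu hu'
    have := h (n + 1) (by omega) (by omega) (by omega)
    omega

theorem parent_one (T : TreeData n Z r f q) : q 1 = f n := by
  have hn := T.one_le
  have hg := T.mirror_of_le hn le_rfl
  rw [T.parent_iff le_rfl (by omega)]
  refine Or.inl ⟨by omega, by omega, ?_, ?_⟩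
  · rw [T.mirror_mirror hn (by omega), T.mirror_one]; omega
  · intro x h1 h2 h3 h4
    rw [T.mirror_mirror hn (by omega)] at h3
    rw [T.mirror_one] at h4
    omega

/-- The fixed point of the self-inverting permutation. -/
theorem exists_fixed (T : TreeData n Z r f q) :
    ∃ x, n < x ∧ x ≤ 2 * n + 1 ∧ r x = n ∧ f x = x := by
  obtain ⟨x, h1, h2, h3⟩ := T.exists_rank (i := n) (by omega)
  have := T.le_iff_lt_rank h1 h2
  exact ⟨x, by omega, h2, h3, T.mirror_of_rank_eq h1 h2 h3⟩

theorem parent_small (T : TreeData n Z r f q) {u x : ℕ} (hu : 1 ≤ u) (hu' : u ≤ n)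
    (hx : n < x) (hx' : x ≤ 2 * n + 1) (hr : r x = n) : q u ≤ n ∨ q u = x ∨ q u = f n := by
  by_contra hc
  have hn := T.one_le
  have hle := T.parent_le hu hu'
  have hg := T.mirror_of_le hn le_rfl
  have hgg := T.mirror_mirror hn (by omega : n ≤ 2 * n + 1)
  have hfu := T.mirror_of_le hu hu'
  rcases (T.parent_iff hu (by omega) (v := q u)).1 rfl with ⟨h1, h2, h3, h4⟩ | ⟨h1, h2⟩
  · have a1 := T.le_iff_lt_rank (by omega) h1
    have a2 : r (q u) ≠ n := fun h => by
      have := T.rank_inj (by omega) h1 (by omega) hx' (h.trans hr.symm); omega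
    have a3 : r (q u) ≠ r (f n) := fun h => by
      have := T.rank_inj (by omega) h1 (by omega) (by omega) h; omega
    have a4 := T.mirror_of_rank_lt (by omega) h1 (by omega : r (q u) < n)
    have := h4 (f n) (by omega) (by omega) (by omega) (by omega)
    omega
  · omega

theorem zero_of_zero_fixed (T : TreeData n Z r f q) {x : ℕ} (hx : n < x)
    (hx' : x ≤ 2 * n + 1) (hr : r x = n) (hz : Z x) :
    x = 2 * n + 1 ∧ (∀ y, n < y → y ≤ 2 * n + 1 → Z y) ∧ f n = 2 * n ∧ q n = 2 * n := by
  have hn := T.one_le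
  have hl := T.zero_last
  have h1 : x = 2 * n + 1 := by
    by_contra hne
    have h2 : r x < r (2 * n + 1) := by
      rw [T.precedes_iff hx hx' (by omega) le_rfl]
      unfold Precedes; grind
    have := T.le_iff_lt_rank (x := 2 * n + 1) (by omega) le_rfl
    omega
  have hall : ∀ y, n < y → y ≤ 2 * n + 1 → Z y := by
    intro y hy hy'
    by_contra hzy
    have h2 : r x < r y := by
      rw [T.precedes_iff hx hx' hy hy']
      unfold Precedes; grind
    have := T.le_iff_lt_rank (x := y) (by omega) hy'
    omega
  have hg := T.mirror_of_le hn le_rfl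
  have hgg := T.mirror_mirror hn (by omega : n ≤ 2 * n + 1)
  have h3 : f n = 2 * n := by
    by_contra hne
    have h4 : f n ≠ x := fun h => by rw [h] at hg; omega
    have hz1 := hall (f n) hg.1 hg.2.1
    have hz2 := hall (2 * n) (by omega) (by omega)
    have h5 : r (f n) < r (2 * n) := by
      rw [T.precedes_iff hg.1 hg.2.1 (by omega) (by omega)]
      exact Or.inl ⟨hz1, hz2, by omega⟩
    have h6 : r (2 * n) < r x := by
      rw [T.precedes_iff (by omega) (by omega) hx hx']
      exact Or.inl ⟨hz2, hz, by omega⟩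
    omega
  refine ⟨h1, hall, h3, ?_⟩
  rw [T.parent_iff hn (by omega)]
  refine Or.inl ⟨by omega, by omega, by rw [← h3, hgg]; omega, ?_⟩
  intro y h4 h5 h6 h7
  by_contra hc
  have a1 := T.le_iff_lt_rank h4 h5
  rcases Nat.lt_or_ge (r y) n with h | h
  · have := T.mirror_of_rank_lt h4 h5 h
    rw [← h3, hgg] at h6
    omega
  · have : y = x := T.rank_inj h4 h5 (by omega) hx' (by omega)
    have := T.mirror_of_rank_eq h4 h5 (by omega)
    omega

theorem parent_last_of_not_zero_fixed (T : TreeData n Z r f q) {x : ℕ} (hx : n < x)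
    (hx' : x ≤ 2 * n + 1) (hr : r x = n) (hz : ¬ Z x) :
    q n = x ∧ q x = f n ∧ x < f n ∧ (Z (f n) → f n = 2 * n + 1) := by
  have hn := T.one_le
  have hg := T.mirror_of_le hn le_rfl
  have hgg := T.mirror_mirror hn (by omega : n ≤ 2 * n + 1)
  have hfx := T.mirror_of_rank_eq (by omega) hx' hr
  obtain ⟨e1, e2, e3, e4⟩ := T.parent_of_not_zero hx hx' hz (w := f n) (by omega) (by omega)
    (by omega)
  refine ⟨?_, e1, e3, e4⟩
  rw [T.parent_iff hn (by omega)]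
  refine Or.inl ⟨hx', hx, by omega, ?_⟩
  intro y h4 h5 h6 h7
  by_contra hc
  have a1 := T.le_iff_lt_rank h4 h5
  rcases Nat.lt_or_ge (r y) n with h | h
  · have := T.mirror_of_rank_lt h4 h5 h
    omega
  · have : y = x := T.rank_inj h4 h5 (by omega) hx' (by omega)
    have := T.mirror_of_rank_eq h4 h5 (by omega)
    omega

theorem parent_last_ne (T : TreeData n Z r f q) : q n ≠ 2 * n + 1 := by
  obtain ⟨x, h1, h2, h3, h4⟩ := T.exists_fixed
  by_cases hz : Z x
  · have := T.zero_of_zero_fixed h1 h2 h3 hz; omega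
  · have := T.parent_last_of_not_zero_fixed h1 h2 h3 hz
    have : x ≠ 2 * n + 1 := by rintro rfl; exact hz T.zero_last
    omega

/-- A child of the root other than `2n + 1` is a leaf, unless the key consists of ones only. -/
theorem all_zero_of_parent (T : TreeData n Z r f q) {a b : ℕ} (ha : 1 ≤ a) (ha' : a ≤ 2 * n)
    (hb : 1 ≤ b) (hb' : b ≤ 2 * n + 1) (hab : q b = a) (h : q a = 2 * n + 2) :
    a = 2 * n ∧ ∀ v, n < v → v ≤ 2 * n + 1 → q v = 2 * n + 2 := by
  have han : n < a := by
    by_contra hc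
    have := T.parent_le ha (by omega); omega
  have hza : Z a := (T.zero_iff_parent han (by omega)).2 h
  by_cases hbn : n < b
  · by_cases hzb : Z b
    · have := T.parent_of_zero hzb; omega
    · have := T.exists_parent hbn hb' hzb
      rw [hab] at this
      have := this.2.2.2.2 hza
      omega
  · obtain ⟨x, h1, h2, h3, h4⟩ := T.exists_fixed
    have h5 := T.parent_small hb (by omega) h1 h2 h3
    by_cases hz : Z x
    · have h6 := T.zero_of_zero_fixed h1 h2 h3 hz
      exact ⟨by omega, fun v hv hv' => T.parent_of_zero (h6.2.1 v hv hv')⟩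
    · have h6 := T.parent_last_of_not_zero_fixed h1 h2 h3 hz
      exfalso
      rw [hab] at h5
      rcases h5 with h5 | h5 | h5
      · omega
      · exact hz (h5 ▸ hza)
      · have := h6.2.2.2 (h5 ▸ hza)
        omega

theorem parent_ne_first (T : TreeData n Z r f q) (hn : 2 < n) {b : ℕ}
    (hb : 1 ≤ b) (hb' : b ≤ 2 * n + 1) : q b ≠ n + 1 := by
  intro h
  have := T.all_zero_of_parent (by omega) (by omega) hb hb' h (T.parent_of_zero T.zero_first)
  omega

theorem eq_of_parent_eq (T : TreeData n Z r f q) {a b : ℕ} (ha : n < a) (ha' : a ≤ 2 * n + 1)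
    (hb : n < b) (hb' : b ≤ 2 * n + 1) (h : q a = q b) (hlt : q a ≤ 2 * n + 1) : a = b := by
  have hza : ¬ Z a := fun hz => by have := T.parent_of_zero hz; omega
  have hzb : ¬ Z b := fun hz => by have := T.parent_of_zero hz; omega
  have h1 := T.exists_parent ha ha' hza
  have h2 := T.exists_parent hb hb' hzb
  rw [← h] at h2
  exact T.rank_inj (by omega) ha' (by omega) hb' (by omega)

theorem fixed_eq_of_not_zero (T : TreeData n Z r f q) (hn : 2 < n) (hz : ¬ Z (n + 2)) :
    r (n + 2) = n := by
  by_contra hc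
  obtain ⟨x, h1, h2, h3, h4⟩ := T.exists_fixed
  have a1 := T.le_iff_lt_rank (x := n + 2) (by omega) (by omega)
  have hp := (T.precedes_iff (x := n + 2) (by omega) (by omega) h1 h2).1 (by omega)
  have hzx : ¬ Z x := by unfold Precedes at hp; grind
  have : x < n + 2 := by unfold Precedes at hp; grind
  obtain rfl : x = n + 1 := by omega
  exact hzx T.zero_first

theorem parent_of_single_one (T : TreeData n Z r f q) (hn : 2 < n)
    (h : ∀ v, n + 2 ≤ v → v ≤ 2 * n → q v ≠ 2 * n + 2) :
    (∀ v, n + 2 ≤ v → v ≤ 2 * n → q v = v + 1) ∧ q n = n + 2 ∧ q 2 = 3 ∧ q 1 = n + 3 := by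
  have hz : ∀ v, n + 2 ≤ v → v ≤ 2 * n → ¬ Z v := fun v h1 h2 hz => h v h1 h2 (T.parent_of_zero hz)
  have hl := T.zero_last
  have hchain : ∀ v, n + 2 ≤ v → v ≤ 2 * n → q v = v + 1 := by
    intro v h1 h2
    have hv := hz v h1 h2
    have hp := T.exists_parent (by omega) (by omega) hv
    by_contra hne
    have b1 : r (v + 1) < r v := by
      rw [T.precedes_iff (by omega) (by omega) (by omega) (by omega)]
      by_cases h3 : v = 2 * n
      · subst h3; exact Or.inr (Or.inl ⟨hl, hv⟩)
      · exact Or.inr (Or.inr ⟨hz _ (by omega) (by omega), hv, by omega⟩)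
    have b2 : r (q v) < r (v + 1) := by
      rw [T.precedes_iff hp.1 hp.2.1 (by omega) (by omega)]
      have hne' : v + 1 ≤ 2 * n := by omega
      have := hz (v + 1) (by omega) (by omega)
      by_cases h3 : q v = 2 * n + 1
      · rw [h3]; exact Or.inr (Or.inl ⟨hl, this⟩)
      · exact Or.inr (Or.inr ⟨hz _ (by omega) (by omega), this, by omega⟩)
    omega
  have hr := T.fixed_eq_of_not_zero hn (hz _ le_rfl (by omega))
  have h1 := T.parent_last_of_not_zero_fixed (by omega) (by omega) hr (hz _ le_rfl (by omega))
  have h2 := hchain (n + 2) le_rfl (by omega)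
  refine ⟨hchain, h1.1, ?_, ?_⟩
  · have r1 : r (2 * n + 1) = 1 := by
      have b0 := T.rank_first
      have b1 : r (n + 1) < r (2 * n + 1) := by
        rw [T.precedes_iff (by omega) (by omega) (by omega) (by omega)]
        exact Or.inl ⟨T.zero_first, hl, by omega⟩
      obtain ⟨x, hx, hx', hx1⟩ := T.exists_rank (i := 1) (by omega)
      by_contra hc
      have a1 := T.le_iff_lt_rank hx hx'
      have b2 := (T.precedes_iff (by omega) hx' (by omega) le_rfl).1
        (by omega : r x < r (2 * n + 1))
      have b3 : x ≠ n + 1 := by rintro rfl; omega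
      have := hz x
      unfold Precedes at b2
      grind
    have r2 : r (2 * n) = 2 := by
      have hp := T.exists_parent (u := 2 * n) (by omega) (by omega) (hz _ (by omega) le_rfl)
      rw [hchain _ (by omega) le_rfl] at hp
      omega
    have f1 := T.mirror_of_rank_lt (x := 2 * n + 1) (by omega) (by omega) (by omega)
    have f2 := T.mirror_of_rank_lt (x := 2 * n) (by omega) (by omega) (by omega)
    have f3 := T.mirror_mirror (x := 2 * n + 1) (by omega) (by omega)
    have f4 := T.mirror_mirror (x := 2 * n) (by omega) (by omega)
    rw [f1, r1] at f3
    rw [f2, r2] at f4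
    norm_num at f3 f4
    rw [T.parent_iff (by omega) (by omega)]
    exact Or.inl ⟨by omega, by omega, by omega, fun x _ _ _ _ => by omega⟩
  · rw [T.parent_one, ← h1.2.1, h2]

theorem parent_two_of_zero (T : TreeData n Z r f q) (hn : 2 < n) (hz : Z (n + 2)) :
    q 2 = f n := by
  have b0 := T.rank_first
  have b1 : r (n + 1) < r (n + 2) := by
    rw [T.precedes_iff (by omega) (by omega) (by omega) (by omega)]
    exact Or.inl ⟨T.zero_first, hz, by omega⟩
  have r1 : r (n + 2) = 1 := by
    obtain ⟨x, hx, hx', hx1⟩ := T.exists_rank (i := 1) (by omega)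
    by_contra hc
    have a1 := T.le_iff_lt_rank hx hx'
    have b2 := (T.precedes_iff (by omega) hx' (by omega) (by omega)).1
      (by omega : r x < r (n + 2))
    have b3 : x ≠ n + 1 := by rintro rfl; omega
    unfold Precedes at b2
    grind
  have f1 := T.mirror_of_rank_lt (x := n + 2) (by omega) (by omega) (by omega)
  have f3 := T.mirror_mirror (x := n + 2) (by omega) (by omega)
  rw [f1, r1] at f3
  norm_num at f3
  have hg := T.mirror_of_le (by omega) (le_refl n)
  have hgg := T.mirror_mirror (by omega) (by omega : n ≤ 2 * n + 1)
  have f4 := T.mirror_mirror (x := 1) (by omega) (by omega)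
  rw [T.mirror_one] at f4
  rw [T.parent_iff (by omega) (by omega)]
  refine Or.inl ⟨by omega, by omega, by omega, fun x h1 h2 h3 h4 => ?_⟩
  have h5 : f x = n + 1 := by omega
  have h6 := T.mirror_mirror h1 h2
  rw [h5] at h6
  omega

theorem parent_last_of_parent_two (T : TreeData n Z r f q) (hn : 2 < n) (h : q 2 = 3) :
    q n = n + 2 := by
  by_cases hz : Z (n + 2)
  · have := T.parent_two_of_zero hn hz
    have := T.mirror_of_le (by omega) (le_refl n)
    omega
  · exact (T.parent_last_of_not_zero_fixed (by omega) (by omega)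
      (T.fixed_eq_of_not_zero hn hz) hz).1

theorem exists_child (T : TreeData n Z r f q) {i : ℕ} (hi : n < i) (hi' : i ≤ 2 * n + 1)
    (hz : ¬ Z i ∨ i = 2 * n + 1) (hr : r i < n) :
    ∃ j, n < j ∧ j < i ∧ q j = i ∧ ¬ Z j ∧ r j = r i + 1 := by
  obtain ⟨j, h1, h2, h3⟩ := T.exists_rank (i := r i + 1) (by omega)
  have a1 := T.le_iff_lt_rank h1 h2
  have hp := (T.precedes_iff hi hi' (by omega) h2).1 (by omega)
  have hzj : ¬ Z j := by
    intro hzj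
    have hlast := T.zero_last
    unfold Precedes at hp
    grind
  have h5 := T.parent_of_not_zero (by omega) h2 hzj (by omega) hi' h3.symm
  exact ⟨j, by omega, by omega, h5.1, hzj, h3⟩

theorem exists_parent_eq (T : TreeData n Z r f q) {i : ℕ} (hi : n < i) (hi' : i ≤ 2 * n)
    (hz : ¬ Z i) : ∃ j, 1 ≤ j ∧ j < i ∧ q j = i := by
  have a1 := T.le_iff_lt_rank (x := i) (by omega) (by omega)
  rcases Nat.lt_or_ge (r i) n with h | h
  · obtain ⟨j, h1, h2, h3, _⟩ := T.exists_child hi (by omega) (Or.inl hz) h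
    exact ⟨j, by omega, h2, h3⟩
  · exact ⟨n, T.one_le, hi, (T.parent_last_of_not_zero_fixed hi (by omega) (by omega) hz).1⟩

theorem chain_cases (T : TreeData n Z r f q) {s : ℕ} (hs : n + 2 ≤ s)
    (hs' : s ≤ 2 * n + 1) (h : ∀ v, s ≤ v → v ≤ 2 * n + 1 → q v = v + 1) :
    (∃ v, 1 ≤ v ∧ v ≤ n ∧ q v = s) ∨
    (∃ a b, n < b ∧ b < a ∧ a < s ∧ q b = a ∧ q a = s) ∨
    (s = 2 * n + 1 ∧ ∀ v, n < v → v ≤ 2 * n + 1 → q v = 2 * n + 2) := by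
  have hn := T.one_le
  obtain ⟨x, h1, h2, h3, h4⟩ := T.exists_fixed
  have hg := T.mirror_of_le hn le_rfl
  by_cases hz : Z x
  · obtain ⟨e1, e2, e3, e4⟩ := T.zero_of_zero_fixed h1 h2 h3 hz
    refine Or.inr (Or.inr ⟨?_, fun v hv hv' => T.parent_of_zero (e2 v hv hv')⟩)
    by_contra hne
    have a1 := h s le_rfl hs'
    have a2 := T.parent_of_zero (e2 s (by omega) hs')
    omega
  · have h5 := T.parent_last_of_not_zero_fixed h1 h2 h3 hz
    have hzs : ¬ Z s ∨ s = 2 * n + 1 := by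
      by_cases hzs : Z s
      · have := T.parent_of_zero hzs
        have := h s le_rfl hs'
        omega
      · exact Or.inl hzs
    have a1 := T.le_iff_lt_rank (x := s) (by omega) hs'
    by_cases hrs : r s = n
    · exact Or.inl ⟨n, hn, le_rfl, by
        rw [h5.1]; exact T.rank_inj (by omega) h2 (by omega) hs' (by omega)⟩
    by_cases hrs' : r s + 1 = n
    · exact Or.inl ⟨1, le_rfl, hn, by
        rw [T.parent_one]; exact T.rank_inj (by omega) (by omega) (by omega) hs' (by omega)⟩
    · obtain ⟨a, b1, b2, b3, b4, b5⟩ := T.exists_child (by omega) hs' hzs (by omega)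
      obtain ⟨b, c1, c2, c3, c4, c5⟩ := T.exists_child b1 (by omega) (Or.inl b4) (by omega)
      exact Or.inr (Or.inl ⟨a, b, c1, c2, b2, c3, b3⟩)

end TreeData

/-! ### Trees of distinct keys -/

namespace TreeData

variable {n : ℕ} {Z Z₁ Z₂ : ℕ → Prop} {r r₁ r₂ f f₁ f₂ q q₁ q₂ : ℕ → ℕ}

theorem parent_rank_last (T : TreeData n Z r f q) {k : ℕ} (hk : r (2 * n + 1) + 1 = k)
    (hkn : k < n) : q k = k + 1 := by
  have hl := T.zero_last
  obtain ⟨o, ho, ho', hro⟩ := T.exists_rank (i := k) (by omega)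
  have a1 := T.le_iff_lt_rank ho ho'
  have hfo := T.mirror_of_rank_lt ho ho' (by omega)
  have hfl := T.mirror_of_rank_lt (x := 2 * n + 1) (by omega) le_rfl (by omega)
  have hffo := T.mirror_mirror ho ho'
  have hffl := T.mirror_mirror (x := 2 * n + 1) (by omega) le_rfl
  rw [hfo, hro] at hffo
  rw [hfl, hk] at hffl
  have hne : o ≠ 2 * n + 1 := by rintro rfl; omega
  have hzo : ¬ Z o := by
    intro hz
    have : r o < r (2 * n + 1) := by
      rw [T.precedes_iff (by omega) ho' (by omega) le_rfl]
      exact Or.inl ⟨hz, hl, by omega⟩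
    omega
  rw [T.parent_iff (by omega) (by omega)]
  refine Or.inl ⟨by omega, by omega, by omega, fun x h1 h2 h3 h4 => ?_⟩
  have hx := T.mirror_mirror h1 h2
  have hs := T.mirror_spec h1 h2
  have a2 := T.le_iff_lt_rank hs.1 hs.2.1
  by_cases hz : Z (f x)
  · have h5 : r (f x) < r (2 * n + 1) := by
      rw [T.precedes_iff (by omega) (by omega) (by omega) le_rfl]
      exact Or.inl ⟨hz, hl, by omega⟩
    rw [T.mirror_of_rank_lt hs.1 hs.2.1 (by omega)] at hx
    omega
  · have h5 : r (f x) < r o := by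
      rw [T.precedes_iff (by omega) (by omega) (by omega) ho']
      exact Or.inr (Or.inr ⟨hz, hzo, by omega⟩)
    have h6 : r (2 * n + 1) < r (f x) := by
      rw [T.precedes_iff (by omega) le_rfl (by omega) (by omega)]
      exact Or.inr (Or.inl ⟨hl, hz⟩)
    omega

/-- Among the children of `i` in the second tree, those of the first tree are missing, if `i`
is a child of the root in the first tree and a vertex on the main chain in the second. -/
theorem exists_child_diff (T₁ : TreeData n Z₁ r₁ f₁ q₁) (T₂ : TreeData n Z₂ r₂ f₂ q₂) {i : ℕ}
    (hi : n < i) (hi' : i ≤ 2 * n) (h₁ : Z₁ i) (h₂ : ¬ Z₂ i)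
    (hne : i ≠ 2 * n ∨ ∃ v, n < v ∧ v ≤ 2 * n + 1 ∧ ¬ Z₁ v) :
    ∃ j, 1 ≤ j ∧ j < i ∧ q₂ j = i ∧ q₁ j ≠ q₂ j := by
  obtain ⟨j, h3, h4, h5⟩ := T₂.exists_parent_eq hi hi' h₂
  refine ⟨j, h3, h4, h5, fun h => ?_⟩
  have h6 := T₁.all_zero_of_parent (by omega) hi' h3 (by omega) (h.trans h5)
    (T₁.parent_of_zero h₁)
  rcases hne with hne | ⟨v, hv, hv', hzv⟩
  · exact hne h6.1
  · exact hzv ((T₁.zero_iff_parent hv hv').2 (h6.2 v hv hv'))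

theorem three_diff_of_subset (hn : 2 < n) (T₁ : TreeData n Z₁ r₁ f₁ q₁)
    (T₂ : TreeData n Z₂ r₂ f₂ q₂) (hsub : ∀ x, Z₂ x → Z₁ x) {i : ℕ} (h₁ : Z₁ i) (h₂ : ¬ Z₂ i)
    (hr : (∀ x, Z₁ x ↔ Z₂ x ∨ x = i) → r₁ (2 * n + 1) = r₂ (2 * n + 1) + 1) :
    ∃ a b c, a ≠ b ∧ a ≠ c ∧ b ≠ c ∧ 1 ≤ a ∧ a ≤ 2 * n + 1 ∧ 1 ≤ b ∧ b ≤ 2 * n + 1 ∧ 1 ≤ c ∧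
      c ≤ 2 * n + 1 ∧ q₁ a ≠ q₂ a ∧ q₁ b ≠ q₂ b ∧ q₁ c ≠ q₂ c := by
  have hdiff : ∀ x, Z₁ x → ¬ Z₂ x → n + 2 ≤ x ∧ x ≤ 2 * n ∧ q₁ x ≠ q₂ x := by
    intro x hx hx'
    have h3 := T₁.le_of_zero hx
    have h4 : x ≠ n + 1 := by rintro rfl; exact hx' T₂.zero_first
    have h5 : x ≠ 2 * n + 1 := by rintro rfl; exact hx' T₂.zero_last
    refine ⟨by omega, by omega, fun h6 => hx' ?_⟩
    rw [T₂.zero_iff_parent (by omega) (by omega), ← h6]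
    exact T₁.parent_of_zero hx
  have two : ∀ a b, a < b → Z₁ a → ¬ Z₂ a → Z₁ b → ¬ Z₂ b →
      ∃ a b c, a ≠ b ∧ a ≠ c ∧ b ≠ c ∧ 1 ≤ a ∧ a ≤ 2 * n + 1 ∧ 1 ≤ b ∧ b ≤ 2 * n + 1 ∧ 1 ≤ c ∧
      c ≤ 2 * n + 1 ∧ q₁ a ≠ q₂ a ∧ q₁ b ≠ q₂ b ∧ q₁ c ≠ q₂ c := by
    intro a b hab ha ha' hb hb'
    have h3 := hdiff a ha ha'
    have h4 := hdiff b hb hb'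
    obtain ⟨j, h5, h6, h7, h8⟩ := exists_child_diff T₁ T₂ (by omega) (by omega) ha ha'
      (Or.inl (by omega))
    exact ⟨a, b, j, by omega, by omega, by omega, by omega, by omega, by omega, by omega,
      by omega, by omega, h3.2.2, h4.2.2, h8⟩
  by_cases hone : ∀ x, Z₁ x ↔ Z₂ x ∨ x = i
  · have hr := hr hone
    have hi := hdiff i h₁ h₂
    have hl := T₂.zero_last
    have h3 : r₂ (2 * n + 1) < r₂ i := by
      rw [T₂.precedes_iff (by omega) le_rfl (by omega) (by omega)]
      exact Or.inr (Or.inl ⟨hl, h₂⟩)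
    have h4 := T₂.le_iff_lt_rank (x := i) (by omega) (by omega)
    rcases Nat.lt_or_ge (r₂ (2 * n + 1) + 1) n with h5 | h5
    · have h6 := T₂.parent_rank_last rfl h5
      have h7 := T₁.mirror_of_rank_lt (x := 2 * n + 1) (by omega) (by omega) (by omega)
      have h8 := T₁.mirror_mirror (x := 2 * n + 1) (by omega) (by omega)
      rw [h7, hr] at h8
      generalize hk : r₂ (2 * n + 1) + 1 = k at *
      have h9 : q₁ k ≠ k + 1 := by
        intro h
        rw [T₁.parent_iff (by omega) (by omega)] at h
        have := T₁.mirror_spec (x := k) (by omega) (by omega)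
        omega
      obtain ⟨x, b1, b2, b3, b4⟩ := T₁.exists_fixed
      have hx : ¬ Z₁ x := by
        intro hz
        have := (T₁.zero_of_zero_fixed b1 b2 b3 hz).1
        rw [this] at b3; omega
      obtain ⟨j, c1, c2, c3, c4⟩ := exists_child_diff T₁ T₂ (by omega) (by omega) h₁ h₂
        (Or.inr ⟨x, b1, b2, hx⟩)
      have c5 : j ≠ k := by rintro rfl; omega
      exact ⟨i, j, k, by omega, by omega, c5, by omega, by omega, by omega, by omega, by omega,
        by omega, hi.2.2, c4, by omega⟩
    · have h6 : r₁ (2 * n + 1) = n := by omega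
      obtain ⟨d1, d2, d3, d4⟩ := T₁.zero_of_zero_fixed (by omega) le_rfl h6 T₁.zero_last
      have h7 := T₂.mirror_of_rank_lt (x := 2 * n + 1) (by omega) (by omega) (by omega)
      have h8 := T₂.mirror_mirror (x := 2 * n + 1) (by omega) (by omega)
      rw [h7, show r₂ (2 * n + 1) + 1 = n by omega] at h8
      have e1 := T₁.parent_one
      have e2 := T₂.parent_one
      by_cases hi2 : i = 2 * n
      · have hz1 := d2 (n + 2) (by omega) (by omega)
        have hz2 : Z₂ (n + 2) := by
          rcases (hone (n + 2)).1 hz1 with h | h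
          · exact h
          · omega
        have g1 := T₁.parent_two_of_zero hn hz1
        have g2 := T₂.parent_two_of_zero hn hz2
        exact ⟨i, 1, 2, by omega, by omega, by omega, by omega, by omega, by omega, by omega,
          by omega, by omega, hi.2.2, by omega, by omega⟩
      · obtain ⟨x, b1, b2, b3, b4⟩ := T₂.exists_fixed
        have hx : ¬ Z₂ x := by
          intro hz
          have := (T₂.zero_of_zero_fixed b1 b2 b3 hz).1
          rw [this] at b3; omega
        have hxi : x = i := ((hone x).1 (d2 x b1 b2)).resolve_left hx
        have g1 := (T₂.parent_last_of_not_zero_fixed b1 b2 b3 hx).1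
        exact ⟨i, 1, n, by omega, by omega, by omega, by omega, by omega, by omega, by omega,
          by omega, by omega, hi.2.2, by omega, by omega⟩
  · have : ∃ x, Z₁ x ∧ ¬ Z₂ x ∧ x ≠ i := by
      by_contra hc
      push Not at hc
      refine hone fun x => ⟨fun hx => ?_, ?_⟩
      · by_cases h3 : Z₂ x
        · exact Or.inl h3
        · exact Or.inr (hc x hx h3)
      · rintro (h | rfl)
        · exact hsub x h
        · exact h₁
    obtain ⟨x, hx, hx', hxi⟩ := this
    rcases Nat.lt_or_gt_of_ne hxi with h | h
    · exact two x i h hx hx' h₁ h₂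
    · exact two i x h h₁ h₂ hx hx'

theorem three_diff_of_not_subset (T₁ : TreeData n Z₁ r₁ f₁ q₁)
    (T₂ : TreeData n Z₂ r₂ f₂ q₂) {i j : ℕ} (h₁ : Z₁ i) (h₂ : ¬ Z₂ i) (h₃ : Z₂ j) (h₄ : ¬ Z₁ j) :
    ∃ a b c, a ≠ b ∧ a ≠ c ∧ b ≠ c ∧ 1 ≤ a ∧ a ≤ 2 * n + 1 ∧ 1 ≤ b ∧ b ≤ 2 * n + 1 ∧ 1 ≤ c ∧
      c ≤ 2 * n + 1 ∧ q₁ a ≠ q₂ a ∧ q₁ b ≠ q₂ b ∧ q₁ c ≠ q₂ c := by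
  have hi := T₁.le_of_zero h₁
  have hj := T₂.le_of_zero h₃
  have h5 : i ≠ 2 * n + 1 := by rintro rfl; exact h₂ T₂.zero_last
  have h6 : q₂ j = 2 * n + 2 := T₂.parent_of_zero h₃
  have h7 : q₁ i = 2 * n + 2 := T₁.parent_of_zero h₁
  have h8 : q₁ j ≠ 2 * n + 2 := fun h => h₄ ((T₁.zero_iff_parent (by omega) (by omega)).2 h)
  have h9 : q₂ i ≠ 2 * n + 2 := fun h => h₂ ((T₂.zero_iff_parent (by omega) (by omega)).2 h)
  obtain ⟨v, c1, c2, c3, c4⟩ := exists_child_diff T₁ T₂ (by omega) (by omega) h₁ h₂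
    (Or.inr ⟨j, by omega, by omega, h₄⟩)
  have c5 : v ≠ j := by rintro rfl; omega
  have c6 : i ≠ j := by rintro rfl; exact h₂ h₃
  exact ⟨i, j, v, c6, by omega, c5.symm, by omega, by omega, by omega, by omega,
        by omega, by omega, by omega, by omega, c4⟩

end TreeData

theorem rank_last_of_insert {n : ℕ} {Z₁ Z₂ : ℕ → Prop} {i : ℕ} (hi : 1 ≤ i) (hi' : i ≤ 2 * n)
    (h₂ : ¬ Z₂ i) (hl : Z₂ (2 * n + 1)) (h : ∀ x, Z₁ x ↔ Z₂ x ∨ x = i) :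
    rank (2 * n + 3) Z₁ (2 * n + 1) = rank (2 * n + 3) Z₂ (2 * n + 1) + 1 := by
  classical
  unfold rank
  rw [Finset.sum_boole, Finset.sum_boole]
  have : (Finset.range (2 * n + 3)).filter (fun y => 1 ≤ y ∧ y + 2 ≤ 2 * n + 3 ∧
      Precedes Z₁ y (2 * n + 1)) = insert i ((Finset.range (2 * n + 3)).filter (fun y => 1 ≤ y ∧
      y + 2 ≤ 2 * n + 3 ∧ Precedes Z₂ y (2 * n + 1))) := by
    ext y
    simp only [Finset.mem_filter, Finset.mem_range, Finset.mem_insert]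
    unfold Precedes
    rw [h, h]
    by_cases hy : y = i
    · subst hy
      simp [hl]; omega
    · simp [hl, hy]
  rw [this, Finset.card_insert_of_notMem]
  · simp
  · simp only [Finset.mem_filter, Finset.mem_range, not_and]
    intro _ _ _
    unfold Precedes
    grind

/-- The trees of distinct keys differ in at least three edges. -/
theorem three_diff_treeParent {n ω₁ ω₂ : ℕ} (hn : 2 < n) (h₁ : ω₁.size = n) (h₂ : ω₂.size = n)
    (hne : ω₁ ≠ ω₂) :
    ∃ a b c, a ≠ b ∧ a ≠ c ∧ b ≠ c ∧ 1 ≤ a ∧ a ≤ 2 * n + 1 ∧ 1 ≤ b ∧ b ≤ 2 * n + 1 ∧ 1 ≤ c ∧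
      c ≤ 2 * n + 1 ∧ treeParent n ω₁ a ≠ treeParent n ω₂ a ∧
      treeParent n ω₁ b ≠ treeParent n ω₂ b ∧ treeParent n ω₁ c ≠ treeParent n ω₂ c := by
  have hp₁ : 0 < ω₁ := Nat.size_pos.1 (by omega)
  have hp₂ : 0 < ω₂ := Nat.size_pos.1 (by omega)
  have T₁ := treeData h₁ hp₁
  have T₂ := treeData h₂ hp₂
  have hsub : ∀ {Z Z' : ℕ → Prop}, (∃ i, Z i ∧ ¬ Z' i) ∨ ∀ x, Z x → Z' x := by
    intro Z Z'
    by_cases h : ∃ i, Z i ∧ ¬ Z' i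
    · exact Or.inl h
    · push Not at h; exact Or.inr h
  rcases hsub (Z := IsZero n ω₁) (Z' := IsZero n ω₂) with ⟨i, hi, hi'⟩ | hs
  · rcases hsub (Z := IsZero n ω₂) (Z' := IsZero n ω₁) with ⟨j, hj, hj'⟩ | hs
    · exact T₁.three_diff_of_not_subset T₂ hi hi' hj hj'
    · refine T₁.three_diff_of_subset hn T₂ hs hi hi' fun h => ?_
      have := T₁.le_of_zero hi
      have : i ≠ 2 * n + 1 := by rintro rfl; exact hi' T₂.zero_last
      exact rank_last_of_insert (by omega) (by omega) hi' T₂.zero_last h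
  · rcases hsub (Z := IsZero n ω₂) (Z' := IsZero n ω₁) with ⟨j, hj, hj'⟩ | hs'
    · obtain ⟨a, b, c, h1, h2, h3, h4, h5, h6, h7, h8, h9, d1, d2, d3⟩ :=
        T₂.three_diff_of_subset hn T₁ hs hj hj' fun h => by
          have := T₂.le_of_zero hj
          have : j ≠ 2 * n + 1 := by rintro rfl; exact hj' T₁.zero_last
          exact rank_last_of_insert (by omega) (by omega) hj' T₁.zero_last h
      exact ⟨a, b, c, h1, h2, h3, h4, h5, h6, h7, h8, h9, d1.symm, d2.symm, d3.symm⟩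
    · exfalso
      refine hne (Nat.eq_of_testBit_eq fun b => ?_)
      by_cases hb : b < n
      · have h3 := hs (2 * n - b)
        have h4 := hs' (2 * n - b)
        unfold IsZero at h3 h4
        have e : 2 * n - (2 * n - b) = b := by omega
        have e1 : 2 * n - b ≠ 2 * n + 1 := by omega
        have e2 : n + 1 ≤ 2 * n - b := by omega
        have e3 : 2 * n - b ≤ 2 * n := by omega
        simp only [e, e1, e2, e3, false_or, true_and] at h3 h4
        exact Bool.eq_iff_iff.2 ⟨h3, h4⟩
      · have hlt : ∀ ω : ℕ, ω.size = n → ω.testBit b = false := fun ω h =>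
          Nat.testBit_lt_two_pow (lt_of_lt_of_le (Nat.lt_size_self ω)
            (Nat.pow_le_pow_right (by norm_num) (by omega)))
        rw [hlt _ h₁, hlt _ h₂]

/-! ### Two labellings of one vertex set -/

/-- The tree of some watermark of size `n`. -/
def IsTree (n : ℕ) (q : ℕ → ℕ) : Prop := ∃ Z r f, TreeData n Z r f q

/-- The edges of the watermark of size `n` with the tree `q`. -/
def Edge (n : ℕ) (q : ℕ → ℕ) (u v : ℕ) : Prop :=
  u = v + 1 ∨ (1 ≤ u ∧ u ≤ 2 * n + 1 ∧ v = q u)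

/-- Two watermarks with the trees `q₁` and `q₂` on the same vertices: the vertex with the label
`u` in the first has the label `t u` in the second. -/
structure Relabeling (n : ℕ) (q₁ q₂ t s : ℕ → ℕ) : Prop where
  two_lt : 2 < n
  tree₁ : IsTree n q₁
  tree₂ : IsTree n q₂
  t_le : ∀ {u}, u ≤ 2 * n + 2 → t u ≤ 2 * n + 2
  s_le : ∀ {u}, u ≤ 2 * n + 2 → s u ≤ 2 * n + 2
  s_t : ∀ {u}, u ≤ 2 * n + 2 → s (t u) = u
  t_s : ∀ {u}, u ≤ 2 * n + 2 → t (s u) = u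

/-- The vertex `u` has the same outgoing edges in both watermarks. -/
def Intact (n : ℕ) (q₁ q₂ t : ℕ → ℕ) (u : ℕ) : Prop :=
  ∀ v ≤ 2 * n + 2, Edge n q₁ u v ↔ Edge n q₂ (t u) (t v)

namespace Relabeling

variable {n : ℕ} {q₁ q₂ t s : ℕ → ℕ}

theorem symm (P : Relabeling n q₁ q₂ t s) : Relabeling n q₂ q₁ s t :=
  ⟨P.two_lt, P.tree₂, P.tree₁, P.s_le, P.t_le, P.t_s, P.s_t⟩

theorem t_inj (P : Relabeling n q₁ q₂ t s) {u v : ℕ} (hu : u ≤ 2 * n + 2) (hv : v ≤ 2 * n + 2)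
    (h : t u = t v) : u = v := by
  rw [← P.s_t hu, h, P.s_t hv]

theorem lt_q₁ (P : Relabeling n q₁ q₂ t s) {u : ℕ} (hu : 1 ≤ u) (hu' : u ≤ 2 * n + 1) :
    u < q₁ u ∧ q₁ u ≤ 2 * n + 2 := by
  obtain ⟨_, _, _, T⟩ := P.tree₁
  exact T.lt_parent hu hu'

theorem lt_q₂ (P : Relabeling n q₁ q₂ t s) {u : ℕ} (hu : 1 ≤ u) (hu' : u ≤ 2 * n + 1) :
    u < q₂ u ∧ q₂ u ≤ 2 * n + 2 := P.symm.lt_q₁ hu hu'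

theorem q₁_first (P : Relabeling n q₁ q₂ t s) : q₁ (n + 1) = 2 * n + 2 := by
  obtain ⟨_, _, _, T⟩ := P.tree₁
  exact T.parent_of_zero T.zero_first

theorem q₁_last (P : Relabeling n q₁ q₂ t s) : q₁ (2 * n + 1) = 2 * n + 2 := by
  obtain ⟨_, _, _, T⟩ := P.tree₁
  exact T.parent_of_zero T.zero_last

theorem q₁_le (P : Relabeling n q₁ q₂ t s) {u : ℕ} (hu : 1 ≤ u) (hu' : u ≤ n) :
    q₁ u ≤ 2 * n + 1 := by
  obtain ⟨_, _, _, T⟩ := P.tree₁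
  exact T.parent_le hu hu'

theorem q₁_ne_first (P : Relabeling n q₁ q₂ t s) {u : ℕ} (hu : 1 ≤ u) (hu' : u ≤ 2 * n + 1) :
    q₁ u ≠ n + 1 := by
  obtain ⟨_, _, _, T⟩ := P.tree₁
  exact T.parent_ne_first P.two_lt hu hu'

theorem q₁_n_ne (P : Relabeling n q₁ q₂ t s) : q₁ n ≠ 2 * n + 1 := by
  obtain ⟨_, _, _, T⟩ := P.tree₁
  exact T.parent_last_ne

theorem q₁_of_single_one (P : Relabeling n q₁ q₂ t s)
    (h : ∀ v, n + 2 ≤ v → v ≤ 2 * n → q₁ v ≠ 2 * n + 2) :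
    (∀ v, n + 2 ≤ v → v ≤ 2 * n → q₁ v = v + 1) ∧ q₁ n = n + 2 ∧ q₁ 2 = 3 ∧ q₁ 1 = n + 3 := by
  obtain ⟨_, _, _, T⟩ := P.tree₁
  exact T.parent_of_single_one P.two_lt h

/-- An intact vertex either keeps its path edge and its tree edge or exchanges them. -/
theorem intact_cases (P : Relabeling n q₁ q₂ t s) {v : ℕ} (hv : 1 ≤ v) (hv' : v ≤ 2 * n + 1)
    (h : Intact n q₁ q₂ t v) :
    (t v = t (v - 1) + 1 ∧ t (q₁ v) = q₂ (t v) ∧ t v < t (q₁ v)) ∨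
    (t v = t (q₁ v) + 1 ∧ t (v - 1) = q₂ (t v) ∧ t v < t (v - 1)) := by
  have hq := P.lt_q₁ hv hv'
  have h1 := (h (v - 1) (by omega)).1 (Or.inl (by omega))
  have h2 := (h (q₁ v) hq.2).1 (Or.inr ⟨hv, hv', rfl⟩)
  have hne : t (v - 1) ≠ t (q₁ v) := fun h => by
    have := P.t_inj (by omega) hq.2 h; omega
  have htv := P.t_le (u := v) (by omega)
  have h0 : 1 ≤ t v := by
    rcases h1 with h1 | h1
    · omega
    · exact h1.1
  have h3 := (h (s (t v - 1)) (P.s_le (by omega))).2 (Or.inl (by rw [P.t_s (by omega)]; omega))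
  have h4 : t v = t (v - 1) + 1 ∨ t v = t (q₁ v) + 1 := by
    rcases h3 with h3 | ⟨_, _, h3⟩
    · left
      have : v - 1 = s (t v - 1) := by omega
      rw [this, P.t_s (by omega)]; omega
    · right
      rw [← h3, P.t_s (by omega)]; omega
  rcases h4 with h4 | h4
  · left
    rcases h2 with h2 | ⟨h2, h2', h2''⟩
    · omega
    · have := P.lt_q₂ h2 h2'
      exact ⟨h4, h2'', by omega⟩
  · right
    rcases h1 with h1 | ⟨h2, h2', h2''⟩
    · omega
    · have := P.lt_q₂ h2 h2'
      exact ⟨h4, h2'', by omega⟩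

theorem intact_symm (P : Relabeling n q₁ q₂ t s) {j : ℕ} (hj : j ≤ 2 * n + 2)
    (h : Intact n q₁ q₂ t (s j)) : Intact n q₂ q₁ s j := by
  intro v hv
  have := h (s v) (P.s_le hv)
  rw [P.t_s hj, P.t_s hv] at this
  exact this.symm

/-- If every step upward in a segment either increments the second label or lowers it, then a
segment is a run of increments or its upper end lies lower. -/
theorem run_or_lt (P : Relabeling n q₁ q₂ t s) {a : ℕ} (b : ℕ) (hab : a ≤ b)
    (hb : b ≤ 2 * n + 2) (h : ∀ v, a < v → v ≤ b → t v = t (v - 1) + 1 ∨ t v < t (v - 1)) :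
    (∀ v, a ≤ v → v ≤ b → t v = t a + (v - a)) ∨ t b < t a := by
  induction b, hab using Nat.le_induction with
  | base => left; intro v h1 h2; obtain rfl : v = a := by omega
            omega
  | succ b hab ih =>
    have ih := ih (by omega) fun v h1 h2 => h v h1 (by omega)
    have hs := h (b + 1) (by omega) le_rfl
    simp only [Nat.add_sub_cancel] at hs
    rcases ih with ih | ih
    · have e := ih b hab le_rfl
      rcases hs with hs | hs
      · left
        intro v h1 h2
        rcases Nat.lt_or_ge v (b + 1) with h3 | h3
        · exact ih v h1 (by omega)
        · obtain rfl : v = b + 1 := by omega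
          omega
      · right
        by_contra hc
        have h4 := ih (a + (t (b + 1) - t a)) (by omega) (by omega)
        have := P.t_inj (by omega) hb (h4.trans (by omega) : _ = t (b + 1))
        omega
    · right
      rcases hs with hs | hs
      · by_contra hc
        have : t (b + 1) = t a := by omega
        have := P.t_inj hb (by omega) this
        omega
      · omega

theorem t_ge_of_fixed (P : Relabeling n q₁ q₂ t s) {r v : ℕ} (hfix : ∀ v < r, t v = v)
    (hv : v ≤ 2 * n + 2) (hrv : r ≤ v) : r ≤ t v := by
  by_contra hc
  have h1 := hfix (t v) (by omega)
  have := P.t_inj (P.t_le hv) hv h1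
  omega

theorem mono_of_intact (P : Relabeling n q₁ q₂ t s) {v : ℕ} (hv : 1 ≤ v) (hv' : v ≤ 2 * n + 1)
    (h : Intact n q₁ q₂ t v) : t v = t (v - 1) + 1 ∨ t v < t (v - 1) := by
  rcases P.intact_cases hv hv' h with h | h
  · exact Or.inl h.1
  · exact Or.inr h.2.2

/-- A run of increments through intact vertices continues. -/
theorem run_continues (P : Relabeling n q₁ q₂ t s) {a c : ℕ} (ha : 1 ≤ a)
    (hc : c ≤ 2 * n + 2) (hI : ∀ v, a ≤ v → v < c → Intact n q₁ q₂ t v)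
    (hmono : ∀ v, a ≤ v → v ≤ 2 * n + 2 → t v = t (v - 1) + 1 ∨ t v < t (v - 1))
    (hrun : t a = t (a - 1) + 1) : ∀ v, a ≤ v → v ≤ c → t v = t (v - 1) + 1 := by
  intro v hav
  induction v, hav using Nat.le_induction with
  | base => intro _; exact hrun
  | succ v hav ih =>
    intro hvc
    have ih := ih (by omega)
    have hq := P.lt_q₁ (u := v) (by omega) (by omega)
    rcases P.intact_cases (by omega) (by omega) (hI v hav (by omega)) with h | h
    · rcases P.run_or_lt (q₁ v) hq.1.le hq.2 (fun w h1 h2 => hmono w (by omega) (by omega)) with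
        h3 | h3
      · have := h3 (v + 1) (by omega) (by omega)
        simp only [Nat.add_sub_cancel]
        omega
      · omega
    · omega

/-- The labels of a segment of intact vertices that ends at the lowest label decrease. -/
theorem decreasing (P : Relabeling n q₁ q₂ t s) {r c : ℕ} (hrc : r < c)
    (hc : c ≤ 2 * n + 2) (hfix : ∀ v < r, t v = v) (htc : t c = r)
    (hI : ∀ v, r < v → v < c → Intact n q₁ q₂ t v)
    (hmono : ∀ v, r < v → v ≤ 2 * n + 2 → t v = t (v - 1) + 1 ∨ t v < t (v - 1)) :
    (∀ v w, r ≤ v → v < w → w ≤ c → t w < t v) ∧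
    (∀ w, c ≤ w → w ≤ 2 * n + 2 → t w = r + (w - c)) ∧
    (∀ v, r ≤ v → v < c → v ≤ 2 * n + 1 → v < q₁ v → q₁ v ≤ 2 * n + 2 → t v = t (q₁ v) + 1 →
      (v + 1 < c → q₁ v = v + 1) ∧ (v + 1 = c → q₁ v = 2 * n + 2)) := by
  have hge : ∀ v, r ≤ v → v ≤ 2 * n + 2 → r ≤ t v := fun v h1 h2 => P.t_ge_of_fixed hfix h2 h1
  have hstep : ∀ v, r < v → v ≤ c → t v < t (v - 1) := by
    intro v h1 h2
    refine (hmono v h1 (by omega)).resolve_left fun h3 => ?_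
    have h4 := P.run_continues (a := v) (c := c) (by omega) hc
      (fun w h5 h6 => hI w (by omega) h6) (fun w h5 h6 => hmono w (by omega) h6) h3 c h2 le_rfl
    have := hge (c - 1) (by omega) (by omega)
    omega
  have hdec : ∀ v w, r ≤ v → v < w → w ≤ c → t w < t v := by
    intro v w h1 h2
    induction w, h2 using Nat.le_induction with
    | base => intro h3; exact hstep (v + 1) (by omega) h3
    | succ w h2 ih =>
      intro h3
      have := ih (by omega)
      have := hstep (w + 1) (by omega) h3
      simp only [Nat.add_sub_cancel] at this
      omega
  have hrun : ∀ w, c ≤ w → w ≤ 2 * n + 2 → t w = r + (w - c) := by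
    intro w h1 h2
    rcases P.run_or_lt w h1 h2 (fun v h3 h4 => hmono v (by omega) (by omega)) with h | h
    · rw [h w h1 le_rfl, htc]
    · have := hge w (by omega) h2
      omega
  refine ⟨hdec, hrun, fun v h1 h2 h3 hq hq' h4 => ⟨fun h5 => ?_, fun h5 => ?_⟩⟩
  · have h6 := hdec v (v + 1) h1 (by omega) (by omega)
    by_contra hne
    rcases Nat.lt_or_ge (q₁ v) c with h7 | h7
    · have := hdec (v + 1) (q₁ v) (by omega) (by omega) (by omega)
      omega
    · have h8 := hrun _ h7 hq'
      have h9 := hge (v + 1) (by omega) (by omega)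
      have h10 := hrun (c + (t (v + 1) - r)) (by omega) (by omega)
      have := P.t_inj (by omega) (by omega) (h10.trans (by omega) : _ = t (v + 1))
      omega
  · by_contra hne
    have h6 := hrun (q₁ v) (by omega) hq'
    have h7 := hrun (q₁ v + 1) (by omega) (by omega)
    have := P.t_inj (by omega) (by omega) (h7.trans (by omega) : _ = t v)
    omega

/-- The path edge of the second root, if it is an edge of the first watermark. -/
theorem root_edge (P : Relabeling n q₁ q₂ t s) {r : ℕ} (hr' : r ≤ 2 * n + 1)
    (hfix : ∀ v < r, t v = v) (htr : t r = 2 * n + 2)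
    (hO : ∀ w ≤ 2 * n + 2, Edge n q₂ (t r) (t w) → Edge n q₁ r w) :
    t r = t (q₁ r) + 1 := by
  have h := hO (s (2 * n + 1)) (P.s_le (by omega)) (Or.inl (by rw [P.t_s (by omega), htr]))
  rcases h with h | ⟨_, _, h⟩
  · have h1 := hfix (s (2 * n + 1)) (by omega)
    rw [P.t_s (by omega)] at h1
    omega
  · rw [← h, P.t_s (by omega), htr]

theorem fixed_q₁ (P : Relabeling n q₁ q₂ t s) {r v : ℕ} (hfix : ∀ v < r, t v = v)
    (hv : 1 ≤ v) (hvr : v < r) (hr : r ≤ 2 * n + 2) (h : Intact n q₁ q₂ t v) :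
    t (q₁ v) = q₂ v := by
  have h1 := hfix v hvr
  have h2 := hfix (v - 1) (by omega)
  rcases P.intact_cases hv (by omega) h with h | h
  · rw [h.2.1, h1]
  · omega

theorem false_of_root_lowest_intact (P : Relabeling n q₁ q₂ t s) {r c : ℕ} (hr : 1 ≤ r)
    (hrc : r < c) (hc : c ≤ 2 * n + 1) (hfix : ∀ v < r, t v = v) (htr : t r = 2 * n + 2)
    (htc : t c = r)
    (hI : ∀ v, 1 ≤ v → v ≤ 2 * n + 1 → v ≠ r → v ≠ c → Intact n q₁ q₂ t v)
    (hO : ∀ w ≤ 2 * n + 2, Edge n q₂ (t r) (t w) → Edge n q₁ r w)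
    (hN : ∀ w ≤ 2 * n + 2, Edge n q₁ (2 * n + 2) w → Edge n q₂ (t (2 * n + 2)) (t w)) :
    False := by
  have hn := P.two_lt
  have hge : ∀ v, r ≤ v → v ≤ 2 * n + 2 → r ≤ t v := fun v h1 h2 => P.t_ge_of_fixed hfix h2 h1
  have hmono : ∀ v, r < v → v ≤ 2 * n + 2 → t v = t (v - 1) + 1 ∨ t v < t (v - 1) := by
    intro v h1 h2
    by_cases hvN : v = 2 * n + 2
    · subst hvN
      rcases hN (2 * n + 1) (by omega) (Or.inl rfl) with h | ⟨h3, h4, h5⟩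
      · exact Or.inl h
      · have := P.lt_q₂ h3 h4
        right
        rw [show 2 * n + 2 - 1 = 2 * n + 1 by omega]
        omega
    by_cases hvc : v = c
    · subst hvc
      have := hge (v - 1) (by omega) (by omega)
      have : t (v - 1) ≠ t v := fun h => by
        have := P.t_inj (by omega) (by omega) h; omega
      omega
    exact P.mono_of_intact (by omega) (by omega) (hI v (by omega) (by omega) (by omega) hvc)
  obtain ⟨hdec, hrun, hq⟩ := P.decreasing hrc (by omega) hfix htc
    (fun v h1 h2 => hI v (by omega) (by omega) (by omega) (by omega)) hmono
  have hflip : ∀ v, r ≤ v → v < c → t v = t (q₁ v) + 1 := by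
    intro v h1 h2
    by_cases hvr : v = r
    · subst hvr
      exact P.root_edge (by omega) hfix htr hO
    · have h3 := hdec (v - 1) v (by omega) (by omega) (by omega)
      rcases P.intact_cases (by omega) (by omega)
        (hI v (by omega) (by omega) hvr (by omega)) with h | h
      · omega
      · exact h.1
  have hq' : ∀ v, r ≤ v → v < c → (v + 1 < c → q₁ v = v + 1) ∧ (v + 1 = c → q₁ v = 2 * n + 2) := by
    intro v h1 h2
    have h3 := P.lt_q₁ (u := v) (by omega) (by omega)
    exact hq v h1 h2 (by omega) h3.1 h3.2 (hflip v h1 h2)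
  have hfirst := P.q₁_first
  have hrn : r ≤ n + 1 := by
    by_contra hlt
    have h1 := P.fixed_q₁ hfix (v := n + 1) (by omega) (by omega) (by omega)
      (hI (n + 1) (by omega) (by omega) (by omega) (by omega))
    rw [hfirst, P.symm.q₁_first] at h1
    have := P.t_inj le_rfl (by omega) (h1.trans htr.symm)
    omega
  have hc1 : c = n + 2 := by
    rcases Nat.lt_trichotomy c (n + 2) with h | h | h
    · have h1 := (hq' (c - 1) (by omega) (by omega)).2 (by omega)
      have := P.q₁_le (u := c - 1) (by omega) (by omega)
      omega
    · exact h
    · have := (hq' (n + 1) (by omega) (by omega)).1 (by omega)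
      omega
  have hr1 : r = n + 1 := by
    by_contra hne
    exact P.q₁_ne_first (by omega) (by omega) ((hq' n (by omega) (by omega)).1 (by omega))
  subst hc1 hr1
  have hshift : ∀ w, n + 2 ≤ w → w ≤ 2 * n + 2 → t w + 1 = w := by
    intro w h1 h2; have := hrun w h1 h2; omega
  have hsingle : ∀ j, n + 2 ≤ j → j ≤ 2 * n → q₂ j ≠ 2 * n + 2 := by
    intro j h1 h2
    have h3 := hshift (j + 1) (by omega) (by omega)
    have h4 := hshift j (by omega) (by omega)
    have h5 := P.lt_q₁ (u := j + 1) (by omega) (by omega)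
    have h6 := hshift (q₁ (j + 1)) (by omega) (by omega)
    rcases P.intact_cases (v := j + 1) (by omega) (by omega)
      (hI (j + 1) (by omega) (by omega) (by omega) (by omega)) with h | h
    · rw [show t (j + 1) = j by omega] at h; omega
    · simp only [Nat.add_sub_cancel] at h; omega
  obtain ⟨_, g1, g2, _⟩ := P.symm.q₁_of_single_one hsingle
  have e1 := P.fixed_q₁ hfix (v := n) (by omega) (by omega) (by omega)
    (hI n (by omega) (by omega) (by omega) (by omega))
  have e2 := P.fixed_q₁ hfix (v := 2) (by omega) (by omega) (by omega)
    (hI 2 (by omega) (by omega) (by omega) (by omega))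
  have e3 : q₁ 2 = 3 := by
    have := P.lt_q₁ (u := 2) (by omega) (by omega)
    refine P.t_inj this.2 (by omega) ?_
    rw [e2, g2, hfix 3 (by omega)]
  have e4 : q₁ n = n + 2 := by
    obtain ⟨_, _, _, T⟩ := P.tree₁
    exact T.parent_last_of_parent_two hn e3
  rw [e4] at e1
  have := hshift (n + 2) le_rfl (by omega)
  omega

end Relabeling

namespace Relabeling

variable {n : ℕ} {q₁ q₂ t s : ℕ → ℕ}

theorem mono_of_lowest_last (P : Relabeling n q₁ q₂ t s) {r v : ℕ}
    (hfix : ∀ v < r, t v = v) (htN : t (2 * n + 2) = r) (hrv : r < v) (hv : v ≤ 2 * n + 2)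
    (h : v ≤ 2 * n + 1 → t v = t (v - 1) + 1 ∨ t v < t (v - 1)) :
    t v = t (v - 1) + 1 ∨ t v < t (v - 1) := by
  by_cases hvN : v = 2 * n + 2
  · subst hvN
    have h1 := P.t_ge_of_fixed hfix (v := 2 * n + 2 - 1) (by omega) (by omega)
    have : t (2 * n + 2 - 1) ≠ t (2 * n + 2) := fun h => by
      have := P.t_inj (by omega) (by omega) h; omega
    omega
  · exact h (by omega)

/-- If the labels above `r` are reversed, the tree has a chain there. -/
theorem chain_of_reversed (P : Relabeling n q₁ q₂ t s) {r : ℕ} (hr' : r ≤ 2 * n + 1)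
    (hfix : ∀ v < r, t v = v) (htN : t (2 * n + 2) = r)
    (hI : ∀ v, r < v → v ≤ 2 * n + 1 → Intact n q₁ q₂ t v) :
    (∀ v, r < v → v ≤ 2 * n + 1 → q₁ v = v + 1 ∧ t v = t (v + 1) + 1) ∧
    (t r = t (q₁ r) + 1 → 1 ≤ r → q₁ r = r + 1) := by
  have hmono : ∀ v, r < v → v ≤ 2 * n + 2 → t v = t (v - 1) + 1 ∨ t v < t (v - 1) :=
    fun v h1 h2 => P.mono_of_lowest_last hfix htN h1 h2 fun h3 =>
      P.mono_of_intact (by omega) h3 (hI v h1 h3)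
  obtain ⟨hdec, _, hq⟩ := P.decreasing (c := 2 * n + 2) (by omega) le_rfl hfix htN
    (fun v h1 h2 => hI v h1 (by omega)) hmono
  have hq' : ∀ v, r ≤ v → v ≤ 2 * n + 1 → 1 ≤ v → t v = t (q₁ v) + 1 → q₁ v = v + 1 := by
    intro v h1 h2 h3 h4
    have h5 := P.lt_q₁ h3 h2
    have := hq v h1 (by omega) h2 h5.1 h5.2 h4
    omega
  refine ⟨fun v h1 h2 => ?_, fun h1 h2 => hq' r le_rfl hr' h2 h1⟩
  have h3 := hdec (v - 1) v (by omega) (by omega) (by omega)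
  rcases P.intact_cases (by omega) h2 (hI v h1 h2) with h | h
  · omega
  · have := hq' v (by omega) h2 (by omega) h.1
    rw [← this]
    exact ⟨rfl, h.1⟩

theorem false_of_swapped_first_changed (P : Relabeling n q₁ q₂ t s) {r : ℕ}
    (hr : n + 1 < r) (hr' : r ≤ 2 * n + 1) (hfix : ∀ v < r, t v = v) (htr : t r = 2 * n + 2)
    (htN : t (2 * n + 2) = r)
    (hI : ∀ v, 1 ≤ v → v ≤ 2 * n + 1 → v ≠ r → v ≠ n + 1 → Intact n q₁ q₂ t v)
    (hO : ∀ w ≤ 2 * n + 2, Edge n q₂ (t r) (t w) → Edge n q₁ r w) : False := by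
  have hn := P.two_lt
  obtain ⟨h1, h2⟩ := P.chain_of_reversed hr' hfix htN
    (fun v h1 h2 => hI v (by omega) h2 (by omega) (by omega))
  have h3 := h2 (P.root_edge hr' hfix htr hO) (by omega)
  have hlow : ∀ v, 1 ≤ v → v < r → v ≠ n + 1 → t (q₁ v) = q₂ v := fun v h4 h5 h6 =>
    P.fixed_q₁ hfix h4 h5 (by omega) (hI v h4 (by omega) (by omega) h6)
  obtain ⟨Z₁, r₁, f₁, T₁⟩ := P.tree₁
  obtain ⟨Z₂, r₂, f₂, T₂⟩ := P.tree₂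
  have hfirst := P.q₁_first
  rcases T₁.chain_cases hr hr' (fun v h4 h5 => by
    rcases Nat.lt_or_ge r v with h6 | h6
    · exact (h1 v h6 h5).1
    · obtain rfl : v = r := by omega
      exact h3) with ⟨v, h4, h5, h6⟩ | ⟨a, b, h4, h5, h6, h7, h8⟩ | ⟨h4, h5⟩
  · have := hlow v h4 (by omega) (by omega)
    have := T₂.parent_le h4 h5
    rw [h6] at *
    omega
  · have ha : a ≠ n + 1 := by rintro rfl; omega
    have hb : b ≠ n + 1 := by rintro rfl; omega
    have e1 := hlow a (by omega) (by omega) ha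
    have e2 := hlow b (by omega) (by omega) hb
    rw [h8, htr] at e1
    rw [h7, hfix a h6] at e2
    obtain ⟨h9, h10⟩ := T₂.all_zero_of_parent (by omega) (by omega) (by omega) (by omega)
      e2.symm e1.symm
    have e3 := hlow (n + 2) (by omega) (by omega) (by omega)
    rw [h10 (n + 2) (by omega) (by omega), ← htr] at e3
    have h11 := P.t_inj (T₁.lt_parent (by omega) (by omega)).2 (by omega) e3
    have := T₁.eq_of_parent_eq (a := n + 2) (b := a) (by omega) (by omega) (by omega) (by omega)
      (by omega) (by omega)
    omega
  · have e1 := hlow (n + 2) (by omega) (by omega) (by omega)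
    have e2 := hlow (2 * n) (by omega) (by omega) (by omega)
    rw [h5 _ (by omega) (by omega)] at e1 e2
    have := T₂.eq_of_parent_eq (a := n + 2) (b := 2 * n) (by omega) (by omega) (by omega)
      (by omega) (by omega) (by omega)
    omega

theorem false_of_swapped_intact (P : Relabeling n q₁ q₂ t s) {r : ℕ} (hr : 1 ≤ r)
    (hrn : r ≤ n + 1) (hfix : ∀ v < r, t v = v) (htr : t r = 2 * n + 2)
    (htN : t (2 * n + 2) = r)
    (hI : ∀ v, r < v → v ≤ 2 * n + 1 → Intact n q₁ q₂ t v)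
    (hO : (∀ w ≤ 2 * n + 2, Edge n q₂ (t r) (t w) → Edge n q₁ r w) ∨
      Intact n q₁ q₂ t n) : False := by
  have hn := P.two_lt
  obtain ⟨h1, h2⟩ := P.chain_of_reversed (by omega) hfix htN hI
  have hfirst := P.q₁_first
  have h3 : r = n + 1 := by
    by_contra hne
    have := h1 (n + 1) (by omega) (by omega)
    omega
  subst h3
  rcases hO with hO | hO
  · have := h2 (P.root_edge (by omega) hfix htr hO) hr
    omega
  · obtain ⟨_, g1, _, _⟩ := P.q₁_of_single_one fun v h4 h5 => by
      have := h1 v (by omega) (by omega); omega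
    have e := P.fixed_q₁ hfix (v := n) (by omega) (by omega) (by omega) hO
    rw [g1] at e
    have hdown : ∀ i v, v + i = 2 * n + 2 → n + 2 ≤ v → t v = n + 1 + i := by
      intro i
      induction i with
      | zero => intro v h4 h5; obtain rfl : v = 2 * n + 2 := by omega
                exact htN
      | succ i ih =>
        intro v h4 h5
        have := ih (v + 1) (by omega) (by omega)
        have := (h1 v (by omega) (by omega)).2
        omega
    have := hdown n (n + 2) (by omega) le_rfl
    have := P.symm.q₁_n_ne
    omega

theorem flipped_of_lowest_last (P : Relabeling n q₁ q₂ t s) {r c : ℕ} (hrc : r ≤ c)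
    (hfix : ∀ v < r, t v = v) (htN : t (2 * n + 2) = r)
    (hI : ∀ v, c < v → v ≤ 2 * n + 1 → Intact n q₁ q₂ t v)
    {v : ℕ} (h1 : c < v) (h2 : v ≤ 2 * n + 2) :
    t v < t (v - 1) ∧ (v ≤ 2 * n + 1 → t v = t (q₁ v) + 1) := by
  have hmono : ∀ v, c < v → v ≤ 2 * n + 2 → t v = t (v - 1) + 1 ∨ t v < t (v - 1) :=
    fun v h1 h2 => P.mono_of_lowest_last hfix htN (by omega) h2 fun h3 =>
      P.mono_of_intact (by omega) h3 (hI v h1 h3)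
  have hlt : t v < t (v - 1) := by
    refine (hmono v h1 h2).resolve_left fun h3 => ?_
    have h4 := P.run_continues (a := v) (c := 2 * n + 2) (by omega) le_rfl
      (fun w h5 h6 => hI w (by omega) (by omega)) (fun w h5 h6 => hmono w (by omega) h6) h3
      (2 * n + 2) h2 le_rfl
    have := P.t_ge_of_fixed hfix (v := 2 * n + 2 - 1) (by omega) (by omega)
    omega
  refine ⟨hlt, fun h3 => ?_⟩
  rcases P.intact_cases (by omega) h3 (hI v h1 h3) with h | h
  · omega
  · exact h.1

theorem false_of_swapped_not_mono (P : Relabeling n q₁ q₂ t s) {r c : ℕ} (hr : 1 ≤ r)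
    (hrc : r < c) (hc : c ≤ 2 * n + 1) (hfix : ∀ v < r, t v = v) (htN : t (2 * n + 2) = r)
    (hI : ∀ v, c < v → v ≤ 2 * n + 1 → Intact n q₁ q₂ t v)
    (hlt : t (c - 1) < t c) (hcq : Edge n q₂ (t c) (t (q₁ c))) : False := by
  have hq := P.lt_q₁ (u := c) (by omega) hc
  have hdec : ∀ w, c < w → w ≤ 2 * n + 2 → t w < t c := by
    intro w h1
    induction w, h1 using Nat.le_induction with
    | base => intro h2; exact (P.flipped_of_lowest_last hrc.le hfix htN hI (by omega) h2).1
    | succ w h1 ih =>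
      intro h2
      have h3 := ih (by omega)
      have h4 := (P.flipped_of_lowest_last hrc.le hfix htN hI (v := w + 1) (by omega) h2).1
      simp only [Nat.add_sub_cancel] at h4
      omega
  have hcq' : t c = t (q₁ c) + 1 := by
    rcases hcq with h | ⟨h1, h2, h3⟩
    · exact h
    · have := P.lt_q₂ h1 h2
      have := hdec (q₁ c) hq.1 hq.2
      omega
  have htc := P.t_le (u := c) (by omega)
  have hdown : ∀ i j, j + i = t c → r ≤ j → c ≤ s j := by
    intro i
    induction i with
    | zero => intro j h1 h2; obtain rfl : j = t c := by omega
              rw [P.s_t (by omega)]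
    | succ i ih =>
      intro j h1 h2
      have h3 := ih (j + 1) (by omega) (by omega)
      have h4 := P.s_le (u := j + 1) (by omega)
      have h5 := P.t_s (u := j + 1) (by omega)
      have h6 : s (j + 1) ≠ 2 * n + 2 := by
        intro h; rw [h] at h5; omega
      have h7 : t (s (j + 1)) = t (q₁ (s (j + 1))) + 1 := by
        rcases Nat.lt_or_ge c (s (j + 1)) with h | h
        · exact (P.flipped_of_lowest_last hrc.le hfix htN hI h h4).2 (by omega)
        · obtain h : s (j + 1) = c := by omega
          rw [h]; exact hcq'
      have h8 := P.lt_q₁ (u := s (j + 1)) (by omega) (by omega)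
      have h9 : s j = q₁ (s (j + 1)) := by
        rw [← P.s_t h8.2]; congr 1; omega
      omega
  have h1 := P.t_ge_of_fixed hfix (v := c - 1) (by omega) (by omega)
  have h2 := hdown (t c - t (c - 1)) (t (c - 1)) (by omega) h1
  rw [P.s_t (by omega)] at h2
  omega

theorem false_of_swapped_mono (P : Relabeling n q₁ q₂ t s) {r c : ℕ} (hr : 1 ≤ r)
    (hrn : r ≤ n + 1)
    (hrc : r < c) (hc : c ≤ 2 * n + 1) (hfix : ∀ v < r, t v = v) (htr : t r = 2 * n + 2)
    (htN : t (2 * n + 2) = r)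
    (hI : ∀ v, r < v → v ≤ 2 * n + 1 → v ≠ c → Intact n q₁ q₂ t v)
    (hO : ∀ w ≤ 2 * n + 2, Edge n q₂ (t r) (t w) → Edge n q₁ r w)
    (hcm : t c = t (c - 1) + 1 ∨ t c < t (c - 1)) : False := by
  have hn := P.two_lt
  have hfirst := P.q₁_first
  have hge : ∀ v, r ≤ v → v ≤ 2 * n + 2 → r ≤ t v := fun v h1 h2 => P.t_ge_of_fixed hfix h2 h1
  have hmono : ∀ v, r < v → v ≤ 2 * n + 2 → t v = t (v - 1) + 1 ∨ t v < t (v - 1) :=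
    fun v h1 h2 => P.mono_of_lowest_last hfix htN h1 h2 fun h3 => by
      by_cases hvc : v = c
      · rw [hvc]; exact hcm
      · exact P.mono_of_intact (by omega) h3 (hI v h1 h3 hvc)
  have hup : ∀ v, c < v → v ≤ 2 * n + 2 → t v < t (v - 1) ∧
      (v ≤ 2 * n + 1 → t v = t (q₁ v) + 1) := fun v h1 h2 =>
    P.flipped_of_lowest_last hrc.le hfix htN (fun w h3 h4 => hI w (by omega) h4 (by omega)) h1 h2
  have hdecc : ∀ w, c < w → w ≤ 2 * n + 2 → t w < t c := by
    intro w h1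
    induction w, h1 using Nat.le_induction with
    | base => intro h2; exact (hup _ (by omega) h2).1
    | succ w h1 ih =>
      intro h2
      have h3 := ih (by omega)
      have h4 := (hup (w + 1) (by omega) h2).1
      simp only [Nat.add_sub_cancel] at h4
      omega
  have htNmin : ∀ v, r ≤ v → v ≤ 2 * n + 1 → r < t v := by
    intro v h1 h2
    have h3 := hge v h1 (by omega)
    have : t v ≠ t (2 * n + 2) := fun h => by
      have := P.t_inj (by omega) le_rfl h; omega
    omega
  have hbig : ∀ v, r ≤ v → v ≤ 2 * n + 1 → t v = t (2 * n + 2) + 1 →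
      ∀ w, v < w → w ≤ 2 * n + 2 → t w < t v → w = 2 * n + 2 := by
    intro v h1 h2 h3 w h4 h5 h6
    have := hge w (by omega) h5
    exact P.t_inj h5 le_rfl (by omega)
  have hex : ∃ e, r < e ∧ e ≤ c ∧ (∀ w, e < w → w ≤ c → t w = t (w - 1) + 1) := ⟨c, hrc, le_rfl,
    fun w h1 h2 => by omega⟩
  classical
  obtain ⟨he1, he2, he3⟩ := Nat.find_spec hex
  have hemin := fun m => Nat.find_min hex (m := m)
  generalize Nat.find hex = e at he1 he2 he3 hemin
  have hne : ¬ (t e = t (e - 1) + 1) := by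
    intro h
    by_cases her : e = r + 1
    · subst her
      have := P.t_le (u := r + 1) (by omega)
      simp only [Nat.add_sub_cancel] at h
      omega
    · refine hemin (e - 1) (by omega) ⟨by omega, by omega, fun w h1 h2 => ?_⟩
      rcases Nat.lt_or_ge e w with h3 | h3
      · exact he3 w h3 h2
      · obtain rfl : w = e := by omega
        exact h
  have hlow : ∀ v, r < v → v < e → t v < t (v - 1) ∧ t v = t (q₁ v) + 1 := by
    intro v h1 h2
    have h3 : ¬ (t v = t (v - 1) + 1) := by
      intro h3
      exact hne (P.run_continues (a := v) (c := c) (by omega) (by omega)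
        (fun w h5 h6 => hI w (by omega) (by omega) (by omega))
        (fun w h5 h6 => hmono w (by omega) h6) h3 e (by omega) he2)
    rcases P.intact_cases (by omega) (by omega)
      (hI v (by omega) (by omega) (by omega)) with h | h
    · exact absurd h.1 h3
    · exact ⟨by have := hmono v h1 (by omega); omega, h.1⟩
  have hbelow : ∀ v, r ≤ v → v < e → ∀ w, v < w → w ≤ 2 * n + 2 → t w < t v := by
    intro v h1 h2 w h3 h4
    rcases P.run_or_lt w h3.le h4 (fun x h5 h6 => hmono x (by omega) (by omega)) with h | h
    · have h5 := h (v + 1) (by omega) (by omega)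
      by_cases hv : v + 1 = e
      · subst hv
        simp only [Nat.add_sub_cancel] at hne
        omega
      · have := (hlow (v + 1) (by omega) (by omega)).1
        simp only [Nat.add_sub_cancel] at this
        omega
    · exact h
  have hflip : ∀ v, r ≤ v → v < e → t v = t (q₁ v) + 1 := by
    intro v h1 h2
    by_cases hvr : v = r
    · subst hvr
      exact P.root_edge (by omega) hfix htr hO
    · exact (hlow v (by omega) h2).2
  have hec : t e ≤ t c ∧ ∀ w, e ≤ w → w ≤ c → t w ≤ t c := by
    have : ∀ w, e ≤ w → w ≤ c → t w = t e + (w - e) := by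
      intro w h1
      induction w, h1 using Nat.le_induction with
      | base => intro _; omega
      | succ w h1 ih =>
        intro h2
        have := ih (by omega)
        have := he3 (w + 1) (by omega) h2
        simp only [Nat.add_sub_cancel] at this
        omega
    have h1 := this c he2 le_rfl
    exact ⟨by omega, fun w h2 h3 => by have := this w h2 h3; omega⟩
  have hqe : q₁ (e - 1) = c := by
    have h1 := hflip (e - 1) (by omega) (by omega)
    have h2 := P.lt_q₁ (u := e - 1) (by omega) (by omega)
    have h3 := hbelow (e - 1) (by omega) (by omega) c (by omega) (by omega)
    have h4 : t (q₁ (e - 1)) ≤ t c := by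
      rcases Nat.lt_or_ge c (q₁ (e - 1)) with h5 | h5
      · exact (hdecc _ h5 h2.2).le
      · exact hec.2 _ (by omega) h5
    exact P.t_inj h2.2 (by omega) (by omega)
  rcases Nat.lt_trichotomy (n + 1) c with h | h | h
  · rcases Nat.lt_trichotomy (n + 1) e with h1 | h1 | h1
    · by_cases h2 : n + 2 = e
      · subst h2
        rw [show n + 2 - 1 = n + 1 by omega] at hqe
        omega
      · have h3 := hflip (n + 1) hrn h1
        rw [hfirst] at h3
        have := hbig (n + 1) hrn (by omega) h3 (n + 2) (by omega) (by omega)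
          (hbelow (n + 1) hrn h1 (n + 2) (by omega) (by omega))
        omega
    · subst h1
      have h3 : t (n + 1) = t (q₁ (n + 1)) + 1 := by
        rcases P.intact_cases (by omega) (by omega)
          (hI (n + 1) (by omega) (by omega) (by omega)) with h | h
        · exact absurd h.1 hne
        · exact h.1
      rw [hfirst] at h3
      rcases P.run_or_lt (a := n + 1) (c + 1) (by omega) (by omega)
        (fun x h5 h6 => hmono x (by omega) (by omega)) with h5 | h5
      · have h6 := h5 (c + 1) (by omega) le_rfl
        have h7 := h5 c (by omega) (by omega)
        have := hdecc (c + 1) (by omega) (by omega)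
        omega
      · have := hbig (n + 1) hrn (by omega) h3 (c + 1) (by omega) (by omega) h5
        have e2 := P.q₁_n_ne
        simp only [Nat.add_sub_cancel] at hqe
        omega
    · have h3 := he3 (n + 1) h1 h.le
      rcases P.intact_cases (by omega) (by omega)
          (hI (n + 1) (by omega) (by omega) (by omega)) with h4 | h4
      · have := htNmin (n + 1) (by omega) (by omega)
        rw [hfirst] at h4
        omega
      · omega
  · exact P.q₁_ne_first (u := e - 1) (by omega) (by omega) (hqe.trans h.symm)
  · have h1 := (hup (n + 1) h (by omega)).2 (by omega)
    rw [hfirst] at h1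
    have h2 := (hup (n + 2) (by omega) (by omega)).1
    have := hbig (n + 1) (by omega) (by omega) h1 (n + 2) (by omega) (by omega) h2
    omega

end Relabeling

open Classical in
/-- The number of edges leaving `u` that only the second watermark has. -/
noncomputable def added (n : ℕ) (q₁ q₂ t : ℕ → ℕ) (u : ℕ) : ℕ :=
  ((Finset.range (2 * n + 3)).filter fun w => Edge n q₂ (t u) (t w) ∧ ¬ Edge n q₁ u w).card

open Classical in
/-- The number of edges leaving `u` that only the first watermark has. -/
noncomputable def removed (n : ℕ) (q₁ q₂ t : ℕ → ℕ) (u : ℕ) : ℕ :=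
  ((Finset.range (2 * n + 3)).filter fun w => Edge n q₁ u w ∧ ¬ Edge n q₂ (t u) (t w)).card

/-- The number of edges leaving the vertex with the label `u` in a watermark of size `n`. -/
def outDegree (n u : ℕ) : ℕ := if u = 0 then 0 else if u = 2 * n + 2 then 1 else 2

open Classical in
theorem card_edge {n : ℕ} {q : ℕ → ℕ} (hq : IsTree n q) {u : ℕ} (hu : u ≤ 2 * n + 2) :
    ((Finset.range (2 * n + 3)).filter fun w => Edge n q u w).card = outDegree n u := by
  unfold outDegree
  split_ifs with h0 hN
  · subst h0
    rw [Finset.card_eq_zero, Finset.filter_eq_empty_iff]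
    rintro w _ (h | h) <;> omega
  · subst hN
    rw [Finset.card_eq_one]
    refine ⟨2 * n + 1, ?_⟩
    ext w
    simp only [Finset.mem_filter, Finset.mem_range, Finset.mem_singleton]
    unfold Edge
    omega
  · obtain ⟨_, _, _, T⟩ := hq
    have := T.lt_parent (u := u) (by omega) (by omega)
    have : (Finset.range (2 * n + 3)).filter (fun w => Edge n q u w) = {u - 1, q u} := by
      ext w
      simp only [Finset.mem_filter, Finset.mem_range, Finset.mem_insert, Finset.mem_singleton]
      unfold Edge
      omega
    rw [this, Finset.card_pair (by omega)]

namespace Relabeling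

variable {n : ℕ} {q₁ q₂ t s : ℕ → ℕ}

theorem card_edge_relabel (P : Relabeling n q₁ q₂ t s) {u : ℕ} (hu : u ≤ 2 * n + 2) :
    open Classical in
    ((Finset.range (2 * n + 3)).filter fun w => Edge n q₂ (t u) (t w)).card =
      outDegree n (t u) := by
  classical
  rw [← card_edge P.tree₂ (P.t_le hu)]
  refine Finset.card_bij (fun w _ => t w) ?_ ?_ ?_
  · intro w hw
    simp only [Finset.mem_filter, Finset.mem_range] at hw ⊢
    exact ⟨by have := P.t_le (u := w) (by omega); omega, hw.2⟩
  · intro a ha b hb hab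
    simp only [Finset.mem_filter, Finset.mem_range] at ha hb
    exact P.t_inj (by omega) (by omega) hab
  · intro w hw
    simp only [Finset.mem_filter, Finset.mem_range] at hw
    refine ⟨s w, ?_, P.t_s (by omega)⟩
    simp only [Finset.mem_filter, Finset.mem_range, P.t_s (show w ≤ 2 * n + 2 by omega)]
    exact ⟨by have := P.s_le (u := w) (by omega); omega, hw.2⟩

theorem added_add (P : Relabeling n q₁ q₂ t s) {u : ℕ} (hu : u ≤ 2 * n + 2) :
    added n q₁ q₂ t u + outDegree n u = removed n q₁ q₂ t u + outDegree n (t u) := by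
  classical
  rw [← card_edge P.tree₁ hu, ← P.card_edge_relabel hu]
  unfold added removed
  have h := Finset.card_sdiff_add_card
    ((Finset.range (2 * n + 3)).filter fun w => Edge n q₂ (t u) (t w))
    ((Finset.range (2 * n + 3)).filter fun w => Edge n q₁ u w)
  have h' := Finset.card_sdiff_add_card
    ((Finset.range (2 * n + 3)).filter fun w => Edge n q₁ u w)
    ((Finset.range (2 * n + 3)).filter fun w => Edge n q₂ (t u) (t w))
  rw [Finset.union_comm] at h'
  have e1 : (Finset.range (2 * n + 3)).filter (fun w => Edge n q₂ (t u) (t w)) \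
      (Finset.range (2 * n + 3)).filter (fun w => Edge n q₁ u w) =
      (Finset.range (2 * n + 3)).filter fun w => Edge n q₂ (t u) (t w) ∧ ¬ Edge n q₁ u w := by
    ext w; simp only [Finset.mem_filter, Finset.mem_sdiff]; tauto
  have e2 : (Finset.range (2 * n + 3)).filter (fun w => Edge n q₁ u w) \
      (Finset.range (2 * n + 3)).filter (fun w => Edge n q₂ (t u) (t w)) =
      (Finset.range (2 * n + 3)).filter fun w => Edge n q₁ u w ∧ ¬ Edge n q₂ (t u) (t w) := by
    ext w; simp only [Finset.mem_filter, Finset.mem_sdiff]; tauto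
  rw [e1] at h
  rw [e2] at h'
  omega

theorem added_pos {u w : ℕ} (hw : w ≤ 2 * n + 2) (h₂ : Edge n q₂ (t u) (t w))
    (h₁ : ¬ Edge n q₁ u w) : 1 ≤ added n q₁ q₂ t u := by
  classical
  unfold added
  refine Finset.card_pos.2 ⟨w, ?_⟩
  simp only [Finset.mem_filter, Finset.mem_range]
  exact ⟨by omega, h₂, h₁⟩

theorem removed_pos {u w : ℕ} (hw : w ≤ 2 * n + 2) (h₁ : Edge n q₁ u w)
    (h₂ : ¬ Edge n q₂ (t u) (t w)) : 1 ≤ removed n q₁ q₂ t u := by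
  classical
  unfold removed
  refine Finset.card_pos.2 ⟨w, ?_⟩
  simp only [Finset.mem_filter, Finset.mem_range]
  exact ⟨by omega, h₁, h₂⟩

theorem two_le_added {u v w : ℕ} (hv : v ≤ 2 * n + 2) (hw : w ≤ 2 * n + 2) (hvw : v ≠ w)
    (h₂ : Edge n q₂ (t u) (t v)) (h₁ : ¬ Edge n q₁ u v) (h₂' : Edge n q₂ (t u) (t w))
    (h₁' : ¬ Edge n q₁ u w) : 2 ≤ added n q₁ q₂ t u := by
  classical
  unfold added
  refine (Finset.one_lt_card).2 ⟨v, ?_, w, ?_, hvw⟩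
  · simp only [Finset.mem_filter, Finset.mem_range]; exact ⟨by omega, h₂, h₁⟩
  · simp only [Finset.mem_filter, Finset.mem_range]; exact ⟨by omega, h₂', h₁'⟩

theorem two_le_removed {u v w : ℕ} (hv : v ≤ 2 * n + 2) (hw : w ≤ 2 * n + 2) (hvw : v ≠ w)
    (h₁ : Edge n q₁ u v) (h₂ : ¬ Edge n q₂ (t u) (t v)) (h₁' : Edge n q₁ u w)
    (h₂' : ¬ Edge n q₂ (t u) (t w)) : 2 ≤ removed n q₁ q₂ t u := by
  classical
  unfold removed
  refine (Finset.one_lt_card).2 ⟨v, ?_, w, ?_, hvw⟩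
  · simp only [Finset.mem_filter, Finset.mem_range]; exact ⟨by omega, h₁, h₂⟩
  · simp only [Finset.mem_filter, Finset.mem_range]; exact ⟨by omega, h₁', h₂'⟩

theorem edge_of_added {u w : ℕ} (hw : w ≤ 2 * n + 2) (h : added n q₁ q₂ t u = 0)
    (h₂ : Edge n q₂ (t u) (t w)) : Edge n q₁ u w := by
  by_contra h₁
  have := added_pos hw h₂ h₁
  omega

theorem edge_of_removed {u w : ℕ} (hw : w ≤ 2 * n + 2) (h : removed n q₁ q₂ t u = 0)
    (h₁ : Edge n q₁ u w) : Edge n q₂ (t u) (t w) := by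
  by_contra h₂
  have := removed_pos hw h₁ h₂
  omega

theorem intact_of {u : ℕ} (h : added n q₁ q₂ t u = 0) (h' : removed n q₁ q₂ t u = 0) :
    Intact n q₁ q₂ t u :=
  fun _ hw => ⟨edge_of_removed hw h', edge_of_added hw h⟩

/-- The upper half of a chain keeps its order if its top does. -/
theorem descend (P : Relabeling n q₁ q₂ t s) {d : ℕ}
    (hchain : ∀ v, n + 2 ≤ v → v ≤ 2 * n → q₁ v = v + 1)
    (hI : ∀ v, n + 2 ≤ v → v ≤ 2 * n → Intact n q₁ q₂ t v)
    (h1 : t (2 * n + 1) = 2 * n + 1 + d) (h2 : t (2 * n) = 2 * n + d) :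
    t (n + 1) = n + 1 + d := by
  have hn := P.two_lt
  have : ∀ i v, v + i = 2 * n → n + 1 ≤ v → t v = v + d ∧ t (v + 1) = v + 1 + d := by
    intro i
    induction i with
    | zero => intro v h3 h4; obtain rfl : v = 2 * n := by omega
              exact ⟨h2, h1⟩
    | succ i ih =>
      intro v h3 h4
      have h5 := ih (v + 1) (by omega) (by omega)
      have h6 := hchain (v + 1) (by omega) (by omega)
      rcases P.intact_cases (v := v + 1) (by omega) (by omega)
        (hI (v + 1) (by omega) (by omega)) with h | h
      · simp only [Nat.add_sub_cancel] at h; omega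
      · rw [h6] at h; omega
  exact (this (n - 1) (n + 1) (by omega) le_rfl).1

theorem false_of_root_to_sink (P : Relabeling n q₁ q₂ t s) {r : ℕ} (hr : 1 ≤ r)
    (hr' : r ≤ 2 * n + 1) (htN : t (2 * n + 2) = 0) (htr : t r = 2 * n + 2)
    (hI : ∀ v, 1 ≤ v → v ≤ 2 * n + 1 → v ≠ r → Intact n q₁ q₂ t v)
    (hO : ∀ w ≤ 2 * n + 2, Edge n q₂ (t r) (t w) → Edge n q₁ r w) : False := by
  have hn := P.two_lt
  have hin : ∀ v, 1 ≤ v → v ≤ 2 * n + 1 → v ≠ r → q₁ v = 2 * n + 2 → t v = 1 := by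
    intro v h1 h2 h3 h4
    rcases P.intact_cases h1 h2 (hI v h1 h2 h3) with h | h <;> rw [h4] at h <;> omega
  have hfirst := P.q₁_first
  have hlast := P.q₁_last
  have hr2 : r = n + 1 ∨ r = 2 * n + 1 := by
    by_contra hc
    have h1 := hin (n + 1) (by omega) (by omega) (by omega) hfirst
    have h2 := hin (2 * n + 1) (by omega) (by omega) (by omega) hlast
    have := P.t_inj (by omega) (by omega) (h1.trans h2.symm)
    omega
  obtain ⟨g1, g2, g3, g4⟩ := P.q₁_of_single_one fun v h1 h2 h3 => by
    have h4 := hin v (by omega) (by omega) (by omega) h3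
    rcases hr2 with h | h
    · have := P.t_inj (by omega) (by omega)
        (h4.trans (hin (2 * n + 1) (by omega) (by omega) (by omega) hlast).symm)
      omega
    · have := P.t_inj (by omega) (by omega)
        (h4.trans (hin (n + 1) (by omega) (by omega) (by omega) hfirst).symm)
      omega
  have hnext : t (r - 1) = 2 * n + 1 := by
    have h := hO (s (2 * n + 1)) (P.s_le (by omega)) (Or.inl (by rw [P.t_s (by omega), htr]))
    rcases h with h | ⟨_, _, h⟩
    · rw [show r - 1 = s (2 * n + 1) by omega, P.t_s (by omega)]
    · have h5 : s (2 * n + 1) = 2 * n + 2 := by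
        rcases hr2 with h6 | h6 <;> rw [h, h6] <;> assumption
      have := P.t_s (u := 2 * n + 1) (by omega)
      rw [h5] at this
      omega
  rcases hr2 with h | h
  · subst h
    simp only [Nat.add_sub_cancel] at hnext
    have a1 := P.t_le (u := n + 2) (by omega)
    have a2 := P.t_le (u := n - 1) (by omega)
    rcases P.intact_cases (by omega) (by omega) (hI n (by omega) (by omega) (by omega)) with h | h
    · rw [g2] at h
      have := P.t_inj (u := n + 2) (v := n + 1) (by omega) (by omega) (by omega)
      omega
    · have := P.t_inj (u := n - 1) (v := n + 1) (by omega) (by omega) (by omega)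
      omega
  · subst h
    have := P.descend (d := 1) g1 (fun v h1 h2 => hI v (by omega) (by omega) (by omega)) htr
      hnext
    have := hin (n + 1) (by omega) (by omega) (by omega) hfirst
    omega

theorem false_of_reversed (P : Relabeling n q₁ q₂ t s) (ht0 : t 0 = 2 * n + 2)
    (htN : t (2 * n + 2) = 0)
    (hA : ∀ u v w, u ≠ v → u ≠ w → v ≠ w → u ≤ 2 * n + 2 → v ≤ 2 * n + 2 → w ≤ 2 * n + 2 →
      added n q₁ q₂ t u + added n q₁ q₂ t v + added n q₁ q₂ t w ≤ 2)
    (hD : ∀ u v w, u ≠ v → u ≠ w → v ≠ w → u ≤ 2 * n + 2 → v ≤ 2 * n + 2 → w ≤ 2 * n + 2 →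
      removed n q₁ q₂ t u + removed n q₁ q₂ t v + removed n q₁ q₂ t w ≤ 2) : False := by
  have hn := P.two_lt
  have hfirst := P.q₁_first
  have hlast := P.q₁_last
  have b0 := P.added_add (u := 0) (by omega)
  have bN := P.added_add (u := 2 * n + 2) le_rfl
  rw [ht0] at b0
  rw [htN] at bN
  simp only [outDegree, if_true] at b0 bN
  rw [if_neg (by omega)] at b0 bN
  have hbal : ∀ v, 1 ≤ v → v ≤ 2 * n + 1 → added n q₁ q₂ t v = removed n q₁ q₂ t v := by
    intro v h1 h2
    have h3 := P.added_add (u := v) (by omega)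
    have h4 : t v ≠ 0 := fun h => by
      have := P.t_inj (by omega) le_rfl (h.trans htN.symm); omega
    have h5 : t v ≠ 2 * n + 2 := fun h => by
      have := P.t_inj (by omega) (by omega) (h.trans ht0.symm); omega
    unfold outDegree at h3
    rw [if_neg (by omega), if_neg (by omega), if_neg h4, if_neg h5] at h3
    omega
  have hin : ∀ v, 1 ≤ v → v ≤ 2 * n + 1 → q₁ v = 2 * n + 2 → t v ≠ 1 →
      1 ≤ removed n q₁ q₂ t v := by
    intro v h1 h2 h3 h4
    refine removed_pos le_rfl (Or.inr ⟨h1, h2, h3.symm⟩) ?_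
    rintro (h | ⟨h5, h6, h⟩)
    · omega
    · have := P.lt_q₂ h5 h6
      omega
  have hx : ∃ x z, ((x = n + 1 ∧ z = 2 * n + 1) ∨ (x = 2 * n + 1 ∧ z = n + 1)) ∧ t z = 1 ∧
      t x ≠ 1 := by
    have hne : t (n + 1) ≠ t (2 * n + 1) := fun h => by
      have := P.t_inj (by omega) (by omega) h; omega
    by_cases h1 : t (n + 1) = 1
    · exact ⟨2 * n + 1, n + 1, Or.inr ⟨rfl, rfl⟩, h1, by omega⟩
    · by_cases h2 : t (2 * n + 1) = 1
      · exact ⟨n + 1, 2 * n + 1, Or.inl ⟨rfl, rfl⟩, h2, h1⟩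
      · have h3 := hin _ (by omega) (by omega) hfirst h1
        have h4 := hin _ (by omega) (by omega) hlast h2
        have := hD (n + 1) (2 * n + 1) (2 * n + 2) (by omega) (by omega) (by omega) (by omega)
          (by omega) (by omega)
        omega
  obtain ⟨x, z, hxz, hz, hx1⟩ := hx
  have hxq : q₁ x = 2 * n + 2 := by rcases hxz with h | h <;> rw [h.1] <;> assumption
  have hdx := hin x (by omega) (by omega) hxq hx1
  have hbx := hbal x (by omega) (by omega)
  have hI : ∀ v, 1 ≤ v → v ≤ 2 * n + 1 → v ≠ x → Intact n q₁ q₂ t v := by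
    intro v h1 h2 h3
    have h4 := hbal v h1 h2
    have := hA 0 x v (by omega) (by omega) (by omega) (by omega) (by omega) (by omega)
    exact intact_of (by omega) (by omega)
  have hax : added n q₁ q₂ t x ≤ 1 := by
    have := hA 0 x z (by omega) (by omega) (by omega) (by omega) (by omega) (by omega)
    omega
  obtain ⟨g1, g2, g3, g4⟩ := P.q₁_of_single_one fun v h1 h2 h3 => by
    have h4 : t v = 1 := by
      have h := (hI v (by omega) (by omega) (by omega) (2 * n + 2) le_rfl).1
        (Or.inr ⟨by omega, by omega, h3.symm⟩)
      rcases h with h | ⟨h5, h6, h⟩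
      · omega
      · have := P.lt_q₂ h5 h6
        omega
    have := P.t_inj (by omega) (by omega) (h4.trans hz.symm)
    omega
  have hroot : ∀ j, 1 ≤ j → j ≤ 2 * n + 1 → q₂ j = 2 * n + 2 → s j = 1 ∨ s j = x := by
    intro j h1 h2 h3
    have h4 := P.s_le (u := j) (by omega)
    have h5 := P.t_s (u := j) (by omega)
    by_contra hc
    push Not at hc
    have h6 : s j ≠ 0 := fun h => by rw [h] at h5; omega
    have h7 : s j ≠ 2 * n + 2 := fun h => by rw [h] at h5; omega
    have h8 := (hI (s j) (by omega) (by omega) hc.2 0 (by omega)).2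
      (Or.inr ⟨by omega, by omega, by rw [h5, ht0, h3]⟩)
    rcases h8 with h8 | ⟨h9, h10, h8⟩
    · omega
    · have := P.lt_q₁ h9 h10
      omega
  have hq2 : ∀ v, 1 ≤ v → v ≤ 2 * n + 2 → v ≠ x → t v ≤ 2 * n + 1 := by
    intro v h1 h2 h3
    have := P.t_le h2
    have : t v ≠ 2 * n + 2 := fun h => by
      have := P.t_inj h2 (by omega) (h.trans ht0.symm); omega
    omega
  have hr1 := hroot (2 * n + 1) (by omega) (by omega) P.symm.q₁_last
  have hr2 := hroot (n + 1) (by omega) (by omega) P.symm.q₁_first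
  have e1 := P.t_s (u := 2 * n + 1) (by omega)
  have e2 := P.t_s (u := n + 1) (by omega)
  rcases hr1 with h | h
  · rw [h] at e1
    have h1 : t (n + 3) = 2 * n := by
      rcases P.intact_cases le_rfl (by omega) (hI 1 le_rfl (by omega) (by omega)) with h' | h'
      · simp only [Nat.sub_self] at h'; omega
      · rw [g4] at h'; omega
    have h2 : ∀ v, 2 ≤ v → v ≤ 2 * n + 2 → t v ≤ 2 * n := by
      intro v h3 h4
      have := P.t_le h4
      have : t v ≠ 2 * n + 2 := fun h => by
        have := P.t_inj h4 (by omega) (h.trans ht0.symm); omega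
      have : t v ≠ 2 * n + 1 := fun h => by
        have := P.t_inj h4 (by omega) (h.trans e1.symm); omega
      omega
    have hq := P.lt_q₁ (u := n + 3) (by omega) (by omega)
    rcases P.intact_cases (by omega) (by omega)
      (hI (n + 3) (by omega) (by omega) (by omega)) with h' | h'
    · have := h2 (q₁ (n + 3)) (by omega) hq.2
      omega
    · have := h2 (n + 3 - 1) (by omega) (by omega)
      omega
  · rw [h] at e1
    have h3 : s (n + 1) = 1 := by
      rcases hr2 with h' | h'
      · exact h'
      · have : t (s (n + 1)) = t (s (2 * n + 1)) := by rw [h', h]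
        rw [P.t_s (by omega), P.t_s (by omega)] at this
        omega
    rw [h3] at e2
    have h4 := P.t_s (u := 2 * n) (by omega)
    have h5 : s (2 * n) = x - 1 := by
      have hsl := P.s_le (u := 2 * n) (by omega)
      by_contra hne
      have h6 : ¬ Edge n q₁ x (s (2 * n)) := by
        rintro (h7 | ⟨_, _, h7⟩)
        · omega
        · rw [h7, hxq] at h4; omega
      have h7 : ¬ Edge n q₁ x 0 := by
        rintro (h7 | ⟨_, _, h7⟩) <;> omega
      have h8 : s (2 * n) ≠ 0 := fun h => by rw [h] at h4; omega
      have := two_le_added (q₂ := q₂) (t := t) hsl (Nat.zero_le _) h8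
        (Or.inl (by omega)) h6 (Or.inr ⟨by omega, by omega, by
          rw [ht0, e1, P.symm.q₁_last]⟩) h7
      omega
    rw [h5] at h4
    rcases hxz with ⟨h6, h7⟩ | ⟨h6, h7⟩
    · subst h6
      simp only [Nat.add_sub_cancel] at h4
      have h2 : ∀ v, 1 ≤ v → v ≤ 2 * n + 2 → v ≠ n + 1 → t v ≤ 2 * n := by
        intro v h8 h9 h10
        have := hq2 v h8 h9 h10
        have : t v ≠ 2 * n + 1 := fun h => by
          have := P.t_inj h9 (by omega) (h.trans e1.symm); omega
        omega
      rcases P.intact_cases (by omega) (by omega) (hI n (by omega) (by omega) (by omega)) with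
        h' | h'
      · rw [g2] at h'
        have := h2 (n + 2) (by omega) (by omega) (by omega)
        omega
      · have := h2 (n - 1) (by omega) (by omega) (by omega)
        omega
    · subst h6
      have := P.descend (d := 0) g1 (fun v h1 h2 => hI v (by omega) (by omega) (by omega)) e1 h4
      rw [h7] at hz
      omega

/-- If at most two edges are added and at most two are removed, the labels agree. -/
theorem eq_of_le_two (P : Relabeling n q₁ q₂ t s)
    (hA : ∀ u v w, u ≠ v → u ≠ w → v ≠ w → u ≤ 2 * n + 2 → v ≤ 2 * n + 2 → w ≤ 2 * n + 2 →
      added n q₁ q₂ t u + added n q₁ q₂ t v + added n q₁ q₂ t w ≤ 2)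
    (hD : ∀ u v w, u ≠ v → u ≠ w → v ≠ w → u ≤ 2 * n + 2 → v ≤ 2 * n + 2 → w ≤ 2 * n + 2 →
      removed n q₁ q₂ t u + removed n q₁ q₂ t v + removed n q₁ q₂ t w ≤ 2) :
    ∀ u ≤ 2 * n + 2, t u = u := by
  have hn := P.two_lt
  have hbal : ∀ v, 1 ≤ v → v ≤ 2 * n + 1 → t v ≠ 0 → t v ≠ 2 * n + 2 →
      added n q₁ q₂ t v = removed n q₁ q₂ t v := by
    intro v h1 h2 h4 h5
    have h3 := P.added_add (u := v) (by omega)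
    unfold outDegree at h3
    rw [if_neg (by omega), if_neg (by omega), if_neg h4, if_neg h5] at h3
    omega
  by_contra hid
  push Not at hid
  obtain ⟨u₀, hu₀, hmoved⟩ := hid
  have hs0 := P.t_s (u := 0) (by omega)
  have hs0' := P.s_le (u := 0) (by omega)
  have hsN := P.t_s (u := 2 * n + 2) (by omega)
  have hsN' := P.s_le (u := 2 * n + 2) (by omega)
  have b0 := P.added_add (u := 0) (by omega)
  have bN := P.added_add (u := 2 * n + 2) (by omega)
  have bs := P.added_add hs0'
  have br := P.added_add hsN'
  rw [hs0] at bs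
  rw [hsN] at br
  by_cases ht0 : t 0 = 0
  · -- the lowest vertex that changes its label
    have hlow : ∃ y, y + 1 ≤ 2 * n + 2 ∧ (∀ v ≤ y, t v = v) ∧ t (y + 1) ≠ y + 1 := by
      classical
      have hex : ∃ u, u ≤ 2 * n + 2 ∧ t u ≠ u := ⟨u₀, hu₀, hmoved⟩
      have h1 := Nat.find_spec hex
      have h2 := fun m => Nat.find_min hex (m := m)
      generalize Nat.find hex = u at h1 h2
      have h3 : u ≠ 0 := by rintro rfl; exact h1.2 ht0
      refine ⟨u - 1, by omega, fun v hv => ?_, by rw [show u - 1 + 1 = u by omega]; exact h1.2⟩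
      have := h2 v (by omega)
      by_contra hc
      exact this ⟨by omega, hc⟩
    obtain ⟨y, hy, hfix, hyt⟩ := hlow
    have hfix' : ∀ v < y + 1, t v = v := fun v hv => hfix v (by omega)
    have ht1 := P.t_s hy
    have hs1 := P.s_le hy
    have hgt : y + 1 < s (y + 1) := by
      by_contra hc
      rcases Nat.lt_or_ge y (s (y + 1)) with h | h
      · rw [show s (y + 1) = y + 1 by omega] at ht1
        exact hyt ht1
      · have := hfix _ h
        omega
    have hgt' : y + 1 < t (y + 1) := by
      have := P.t_ge_of_fixed hfix' hy le_rfl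
      omega
    have hty := P.t_le hy
    have hDy : 1 ≤ removed n q₁ q₂ t (y + 1) := by
      refine removed_pos (w := y) (by omega) (Or.inl rfl) ?_
      rw [hfix y le_rfl]
      rintro (h | ⟨h1, h2, h⟩)
      · omega
      · have := P.lt_q₂ h1 h2
        omega
    have hAv : 1 ≤ added n q₁ q₂ t (s (y + 1)) := by
      refine added_pos (w := y) (by omega) ?_ ?_
      · rw [ht1, hfix y le_rfl]; exact Or.inl rfl
      · rintro (h | ⟨h1, h2, h⟩)
        · omega
        · have := P.lt_q₁ h1 h2
          omega
    have htsy : t (s (y + 1)) ≠ 0 := by omega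
    by_cases htN : t (2 * n + 2) = 2 * n + 2
    · have hup : ∃ u, u ≤ 2 * n + 2 ∧ y + 1 < u ∧ t u = u ∧ (∀ v, u ≤ v → v ≤ 2 * n + 2 → t v = v) ∧
          t (u - 1) ≠ u - 1 := by
        classical
        have hex : ∃ u, ∀ v, u ≤ v → v ≤ 2 * n + 2 → t v = v := ⟨2 * n + 2, fun v h1 h2 => by
          obtain rfl : v = 2 * n + 2 := by omega
          exact htN⟩
        have h1 := Nat.find_spec hex
        have h2 := fun m => Nat.find_min hex (m := m)
        have h0 : Nat.find hex ≤ 2 * n + 2 := Nat.find_min' hex fun v h1 h2 => by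
          obtain rfl : v = 2 * n + 2 := by omega
          exact htN
        generalize Nat.find hex = u at h0 h1 h2
        have h3 : y + 1 < u := by
          by_contra hc
          exact hyt (h1 _ (by omega) hy)
        refine ⟨u, h0, h3, h1 u le_rfl h0, h1, fun h4 => h2 (u - 1) (by omega) fun v h5 h6 => ?_⟩
        rcases Nat.lt_or_ge v u with h7 | h7
        · obtain rfl : v = u - 1 := by omega
          exact h4
        · exact h1 v h7 h6
      obtain ⟨u, hu, hyu, htu, hufix, hut⟩ := hup
      have hDu : 1 ≤ removed n q₁ q₂ t u := by
        refine removed_pos (w := u - 1) (by omega) (Or.inl (by omega)) ?_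
        rintro (h | ⟨h1, h2, h⟩)
        · omega
        · have h3 := P.lt_q₂ h1 h2
          have h4 := hufix (t (u - 1)) (by omega) (by omega)
          have := P.t_inj (P.t_le (by omega)) (by omega) h4
          omega
      have h1 : s (y + 1) ≠ 2 * n + 2 := fun h => by rw [h] at ht1; omega
      have h2 := hbal (s (y + 1)) (by omega) (by omega) htsy (by omega)
      have h3 : u ≠ s (y + 1) := by
        intro h; rw [← h] at ht1; omega
      have := hD (y + 1) (s (y + 1)) u (by omega) (by omega) (by omega) (by omega) (by omega)
        (by omega)
      omega
    · have htN0 : t (2 * n + 2) ≠ 0 := fun h => by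
        have := P.t_inj (by omega) (by omega) (h.trans ht0.symm); omega
      unfold outDegree at bN br
      rw [if_neg (by omega), if_pos rfl, if_neg htN0, if_neg htN] at bN
      have hsN1 : s (2 * n + 2) ≠ 2 * n + 2 := fun h => by rw [h] at hsN; exact htN hsN
      have hsN0 : s (2 * n + 2) ≠ 0 := fun h => by rw [h] at hsN; omega
      rw [if_neg hsN0, if_neg hsN1, if_neg (by omega), if_pos rfl] at br
      have hyN : y + 1 ≠ 2 * n + 2 := by omega
      have hbal' : ∀ v, 1 ≤ v → v ≤ 2 * n + 1 → v ≠ s (2 * n + 2) →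
          added n q₁ q₂ t v = removed n q₁ q₂ t v := by
        intro v h1 h2 h3
        refine hbal v h1 h2 (fun h => ?_) fun h => ?_
        · have := P.t_inj (by omega) (by omega) (h.trans ht0.symm); omega
        · exact h3 (P.t_inj (by omega) hsN' (h.trans hsN.symm))
      generalize hr : s (2 * n + 2) = r at *
      by_cases hyr : y + 1 = r
      · subst hyr
        by_cases hc : s (y + 1) = 2 * n + 2
        · rw [hc] at ht1
          rcases Nat.lt_or_ge (n + 1) (y + 1) with hlt | hge
          · have h1 : 1 ≤ added n q₁ q₂ t (n + 1) := by
              refine added_pos (w := y + 1) (by omega) (Or.inr ?_) ?_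
              · rw [hfix (n + 1) (by omega), hsN, P.symm.q₁_first]
                exact ⟨by omega, by omega, rfl⟩
              · rintro (h | ⟨_, _, h⟩)
                · omega
                · rw [P.q₁_first] at h; omega
            have h2 : ∀ v, v ≠ 2 * n + 2 → v ≠ n + 1 → v ≤ 2 * n + 1 →
                added n q₁ q₂ t v = 0 := by
              intro v h3 h4 h5
              have := hA (2 * n + 2) (n + 1) v (by omega) (by omega) (by omega) (by omega)
                (by omega) (by omega)
              omega
            refine P.false_of_swapped_first_changed hlt (by omega) hfix' hsN ht1 ?_
              (fun w hw => edge_of_added hw (h2 (y + 1) (by omega) (by omega) (by omega)))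
            intro v h3 h4 h5 h6
            have := h2 v (by omega) h6 h4
            have := hbal' v h3 h4 h5
            exact intact_of (by omega) (by omega)
          · by_cases hall : ∀ v, y + 1 < v → v ≤ 2 * n + 1 → added n q₁ q₂ t v = 0
            · refine P.false_of_swapped_intact (by omega) hge hfix' hsN ht1 ?_ ?_
              · intro v h1 h2
                have := hall v h1 h2
                have := hbal' v (by omega) h2 (by omega)
                exact intact_of (by omega) (by omega)
              · by_cases h1 : added n q₁ q₂ t (y + 1) = 0
                · exact Or.inl fun w hw => edge_of_added hw h1
                · by_cases h2 : y + 1 = n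
                  · have h3 := P.chain_of_reversed (r := y + 1) (by omega) hfix' ht1
                      (fun v h1 h2 => by
                        have := hall v h1 h2
                        have := hbal' v (by omega) h2 (by omega)
                        exact intact_of (by omega) (by omega))
                    have := h3.1 (n + 1) (by omega) (by omega)
                    have := P.q₁_first
                    omega
                  · right
                    have := hA (2 * n + 2) (y + 1) n (by omega) (by omega) (by omega) (by omega)
                      (by omega) (by omega)
                    have := hbal' n (by omega) (by omega) (by omega)
                    exact intact_of (by omega) (by omega)
            · push Not at hall
              obtain ⟨c, hc1, hc2, hc3⟩ := hall
              have hbc := hbal' c (by omega) hc2 (by omega)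
              have h2 : ∀ v, v ≠ 2 * n + 2 → v ≠ c → v ≤ 2 * n + 1 → added n q₁ q₂ t v = 0 := by
                intro v h3 h4 h5
                have := hA (2 * n + 2) c v (by omega) (by omega) (by omega) (by omega)
                  (by omega) (by omega)
                omega
              have hI : ∀ v, y + 1 < v → v ≤ 2 * n + 1 → v ≠ c → Intact n q₁ q₂ t v := by
                intro v h3 h4 h5
                have := h2 v (by omega) h5 h4
                have := hbal' v (by omega) h4 (by omega)
                exact intact_of (by omega) (by omega)
              have hO : ∀ w ≤ 2 * n + 2, Edge n q₂ (t (y + 1)) (t w) → Edge n q₁ (y + 1) w :=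
                fun w hw => edge_of_added hw (h2 (y + 1) (by omega) (by omega) (by omega))
              by_cases hm : t c = t (c - 1) + 1 ∨ t c < t (c - 1)
              · exact P.false_of_swapped_mono (by omega) hge hc1 hc2 hfix' hsN ht1 hI hO hm
              · have hqc := P.lt_q₁ (u := c) (by omega) hc2
                have h3 : ¬ Edge n q₂ (t c) (t (c - 1)) := by
                  rintro (h | ⟨h4, h5, h⟩)
                  · exact hm (Or.inl h)
                  · have := P.lt_q₂ h4 h5
                    exact hm (Or.inr (by omega))
                have h4 : t (c - 1) ≠ t c := fun h => by
                  have := P.t_inj (by omega) (by omega) h; omega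
                refine P.false_of_swapped_not_mono (by omega) hc1 hc2 hfix' ht1
                  (fun v h5 h6 => hI v (by omega) h6 (by omega)) (by omega) ?_
                by_contra h5
                have h6 := two_le_removed (n := n) (q₁ := q₁) (q₂ := q₂) (t := t) (u := c)
                  (v := c - 1) (w := q₁ c) (by omega) hqc.2 (by omega)
                  (Or.inl (by omega)) h3 (Or.inr ⟨by omega, hc2, rfl⟩) h5
                have := hD c (y + 1) 0 (by omega) (by omega) (by omega) (by omega) (by omega)
                  (by omega)
                omega
        · have h2 : ∀ v, v ≠ 2 * n + 2 → v ≠ s (y + 1) → v ≤ 2 * n + 1 →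
              added n q₁ q₂ t v = 0 := by
            intro v h3 h4 h5
            have := hA (2 * n + 2) (s (y + 1)) v (by omega) (by omega) (by omega) (by omega)
              (by omega) (by omega)
            omega
          have h1 := hA (2 * n + 2) (s (y + 1)) 0 (by omega) (by omega) (by omega) (by omega)
              (by omega) (by omega)
          refine P.false_of_root_lowest_intact (r := y + 1) (c := s (y + 1)) (by omega) hgt
            (by omega) hfix' hsN ht1 ?_
            (fun w hw => edge_of_added hw (h2 (y + 1) (by omega) (by omega) (by omega)))
            (fun w hw => edge_of_removed hw (by omega))
          intro v h3 h4 h5 h6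
          have := h2 v (by omega) h6 h4
          have := hbal' v h3 h4 h5
          exact intact_of (by omega) (by omega)
      · have hby := hbal' (y + 1) (by omega) (by omega) hyr
        by_cases hc : s (y + 1) = 2 * n + 2
        · have h2 : ∀ v, v ≠ y + 1 → v ≠ r → v ≤ 2 * n + 2 → removed n q₁ q₂ t v = 0 := by
            intro v h3 h4 h5
            have := hD (y + 1) r v hyr (by omega) (by omega) (by omega)
              (by omega) (by omega)
            omega
          have h1 := hD (y + 1) r 0 hyr (by omega) (by omega) (by omega) (by omega) (by omega)
          rw [hc] at ht1
          refine P.symm.false_of_root_lowest_intact (r := y + 1) (c := t (y + 1)) (by omega) hgt'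
            ?_ (fun v hv => ?_) hc (P.s_t (by omega)) ?_ ?_ ?_
          · have : t (y + 1) ≠ 2 * n + 2 := fun h =>
              hyr (P.t_inj (by omega) hsN' (h.trans hsN.symm))
            omega
          · have := P.s_t (u := v) (by omega)
            rw [hfix' v hv] at this
            exact this
          · intro j h3 h4 h5 h6
            refine P.intact_symm (by omega) ?_
            have h7 := P.t_s (u := j) (by omega)
            have h8 := P.s_le (u := j) (by omega)
            have h9 : s j ≠ 2 * n + 2 := fun h => by rw [h] at h7; omega
            have h10 : s j ≠ y + 1 := fun h => by rw [h] at h7; omega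
            have h11 : s j ≠ r := fun h => by rw [h] at h7; omega
            have h12 : s j ≠ 0 := fun h => by rw [h] at h7; omega
            have := h2 (s j) h10 h11 h8
            have := hbal' (s j) (by omega) (by omega) h11
            exact intact_of (by omega) (by omega)
          · intro w hw h
            rw [hc] at h
            have := edge_of_removed (q₂ := q₂) (t := t) (P.s_le hw)
              (h2 (2 * n + 2) (by omega) (by omega) le_rfl) h
            rwa [P.t_s hw, ht1] at this
          · intro w hw h
            rw [hr]
            refine edge_of_added (q₂ := q₂) (t := t) (P.s_le hw) (by omega) ?_
            rw [hsN, P.t_s hw]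
            exact h
        · have := hA (2 * n + 2) (y + 1) (s (y + 1)) (by omega) (by omega) (by omega) (by omega)
              (by omega) (by omega)
          omega
  · have hs00 : s 0 ≠ 0 := fun h => by rw [h] at hs0; exact ht0 hs0
    unfold outDegree at b0 bs bN br
    rw [if_pos rfl, if_neg ht0] at b0
    rw [if_neg hs00, if_pos rfl] at bs
    by_cases htN : t (2 * n + 2) = 2 * n + 2
    · have ht0N : t 0 ≠ 2 * n + 2 := fun h => by
        have := P.t_inj (by omega) (by omega) (h.trans htN.symm); omega
      have hs0N : s 0 ≠ 2 * n + 2 := fun h => by rw [h] at hs0; omega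
      rw [if_neg ht0N] at b0
      rw [if_neg hs0N] at bs
      have hI : ∀ v, 1 ≤ v → v ≤ 2 * n + 2 → v ≠ s 0 → Intact n q₁ q₂ t v := by
        intro v h1 h2 h3
        have h4 : ∃ w, 1 ≤ w ∧ w ≤ 2 ∧ w ≠ v := by
          by_cases h : v = 1
          · exact ⟨2, by omega⟩
          · exact ⟨1, by omega⟩
        obtain ⟨w, h5, h6, h7⟩ := h4
        have a1 := hA 0 v w (by omega) (by omega) (by omega) (by omega) (by omega) (by omega)
        have a2 := hD (s 0) v 0 (by omega) (by omega) (by omega) (by omega) (by omega) (by omega)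
        exact intact_of (by omega) (by omega)
      have hdown : ∀ i v, v + i = 2 * n + 2 → s 0 ≤ v →
          ∀ w, v ≤ w → w ≤ 2 * n + 2 → t w = w := by
        intro i
        induction i with
        | zero => intro v h1 h2 w h3 h4; obtain rfl : w = 2 * n + 2 := by omega
                  exact htN
        | succ i ih =>
          intro v h1 h2 w h5 h6
          have h3 := ih (v + 1) (by omega) (by omega)
          by_cases hw : v + 1 ≤ w
          · exact h3 w hw h6
          obtain rfl : w = v := by omega
          have h4 := hI (w + 1) (by omega) (by omega) (by omega)
          have h7 := h3 (w + 1) le_rfl (by omega)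
          by_cases hv : w + 1 = 2 * n + 2
          · rcases (h4 w (by omega)).1 (Or.inl rfl) with h | ⟨_, h, _⟩
            · omega
            · omega
          · have hq := P.lt_q₁ (u := w + 1) (by omega) (by omega)
            have h8 := h3 _ hq.1.le hq.2
            rcases P.intact_cases (by omega) (by omega) h4 with h | h
            · simp only [Nat.add_sub_cancel] at h; omega
            · omega
      have := hdown (2 * n + 2 - s 0) (s 0) (by omega) le_rfl (s 0) le_rfl hs0'
      omega
    · have hsNN : s (2 * n + 2) ≠ 2 * n + 2 := fun h => by rw [h] at hsN; exact htN hsN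
      rw [if_neg (by omega), if_pos rfl] at bN
      by_cases htN0 : t (2 * n + 2) = 0
      · rw [if_pos htN0] at bN
        by_cases ht0N : t 0 = 2 * n + 2
        · exact P.false_of_reversed ht0N htN0 hA hD
        · rw [if_neg ht0N] at b0
          have hr0 : s (2 * n + 2) ≠ 0 := fun h => by rw [h] at hsN; omega
          rw [if_neg hr0, if_neg hsNN, if_neg (by omega), if_pos rfl] at br
          have hA0 : ∀ v, 1 ≤ v → v ≤ 2 * n + 2 → added n q₁ q₂ t v = 0 := by
            intro v h1 h2
            by_cases h : v = 1
            · have := hA 0 v 2 (by omega) (by omega) (by omega) (by omega) (by omega) (by omega)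
              omega
            · have := hA 0 v 1 (by omega) (by omega) (by omega) (by omega) (by omega) (by omega)
              omega
          refine P.false_of_root_to_sink (r := s (2 * n + 2)) (by omega) (by omega) htN0 hsN ?_
            (fun w hw => edge_of_added hw (hA0 _ (by omega) (by omega)))
          intro v h1 h2 h3
          have := hA0 v h1 (by omega)
          have := hD (2 * n + 2) (s (2 * n + 2)) v (by omega) (by omega) (by omega) (by omega)
            (by omega) (by omega)
          exact intact_of (by omega) (by omega)
      · rw [if_neg htN0, if_neg htN] at bN
        have hs0N : s 0 ≠ 2 * n + 2 := fun h => by rw [h] at hs0; omega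
        rw [if_neg hs0N] at bs
        by_cases ht0N : t 0 = 2 * n + 2
        · rw [if_pos ht0N] at b0
          have hA0 : ∀ v, 1 ≤ v → v ≤ 2 * n + 1 → added n q₁ q₂ t v = 0 := by
            intro v h1 h2
            have := hA 0 (2 * n + 2) v (by omega) (by omega) (by omega) (by omega) (by omega)
              (by omega)
            omega
          have hD0 : ∀ v, 1 ≤ v → v ≤ 2 * n + 2 → v ≠ s 0 → removed n q₁ q₂ t v = 0 := by
            intro v h1 h2 h3
            have := hD (s 0) v 0 (by omega) (by omega) (by omega) (by omega) (by omega)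
              (by omega)
            omega
          have htNle := P.t_le (u := 2 * n + 2) le_rfl
          refine P.symm.false_of_root_to_sink (r := t (2 * n + 2)) (by omega) (by omega) ?_
            (P.s_t le_rfl) ?_ ?_
          · rw [← ht0N, P.s_t (by omega)]
          · intro j h1 h2 h3
            refine P.intact_symm (by omega) ?_
            have h7 := P.t_s (u := j) (by omega)
            have h8 := P.s_le (u := j) (by omega)
            have h9 : s j ≠ 2 * n + 2 := fun h => by rw [h] at h7; omega
            have h10 : s j ≠ 0 := fun h => by rw [h] at h7; omega
            have h11 : s j ≠ s 0 := fun h => by rw [h, hs0] at h7; omega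
            exact intact_of (hA0 _ (by omega) (by omega)) (hD0 _ (by omega) h8 h11)
          · intro w hw h
            rw [P.s_t le_rfl] at h
            have := edge_of_removed (q₂ := q₂) (t := t) (P.s_le hw)
              (hD0 (2 * n + 2) (by omega) (by omega) (by omega)) h
            rwa [P.t_s hw] at this
        · rw [if_neg ht0N] at b0
          have := hA 0 (2 * n + 2) 1 (by omega) (by omega) (by omega) (by omega) (by omega)
            (by omega)
          omega

end Relabeling

/-! ### The distance between canonical reducible permutation graphs -/

theorem ncard_setOf_label {m : ℕ} (e : Fin m ≃ Fin m) (p : ℕ → ℕ → Prop)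
    [∀ u, DecidablePred (p u)] :
    {x : Fin m × Fin m | p (e x.1) (e x.2)}.ncard =
      ∑ u ∈ Finset.range m, ((Finset.range m).filter fun w => p u w).card := by
  have h : {x : Fin m × Fin m | p (e x.1) (e x.2)} =
      ((Finset.univ.filter fun x : Fin m × Fin m => p (e x.1) (e x.2) : Finset _) :
        Set (Fin m × Fin m)) := by
    ext x; simp
  rw [h, Set.ncard_coe_finset, Finset.card_filter, ← Finset.univ_product_univ,
    Finset.sum_product]
  rw [← Fin.sum_univ_eq_sum_range (fun u => ((Finset.range m).filter fun w => p u w).card)]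
  rw [← Equiv.sum_comp e (fun u : Fin m => ((Finset.range m).filter fun w => p u w).card)]
  refine Finset.sum_congr rfl fun x _ => ?_
  rw [Finset.card_filter, ← Fin.sum_univ_eq_sum_range (fun w => if p (e x) w then 1 else 0)]
  rw [← Equiv.sum_comp e (fun w : Fin m => if p (e x) w then 1 else 0)]

theorem isTree_treeParent {n ω : ℕ} (h : ω.size = n) (h0 : 0 < ω) :
    IsTree n (treeParent n ω) := ⟨_, _, _, treeData h h0⟩

/-- The label in the second watermark of the vertex with the label `u` in the first. -/
def relabel {m : ℕ} [NeZero m] (e₁ e₂ : Fin m ≃ Fin m) (u : ℕ) : ℕ :=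
  e₂ (e₁.symm (Fin.ofNat m u))

theorem relabel_relabel {m : ℕ} [NeZero m] (e₁ e₂ : Fin m ≃ Fin m) {u : ℕ} (hu : u < m) :
    relabel e₂ e₁ (relabel e₁ e₂ u) = u := by
  unfold relabel
  have : Fin.ofNat m (e₂ (e₁.symm (Fin.ofNat m u))).val = e₂ (e₁.symm (Fin.ofNat m u)) := by
    ext; simp
  rw [this]
  simp [Nat.mod_eq_of_lt hu]

theorem relabel_apply {m : ℕ} [NeZero m] (e₁ e₂ : Fin m ≃ Fin m) (x : Fin m) :
    relabel e₁ e₂ (e₁ x) = e₂ x := by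
  unfold relabel
  have : Fin.ofNat m (e₁ x).val = e₁ x := by
    ext; simp
  rw [this, Equiv.symm_apply_apply]

theorem relabeling {n ω₁ ω₂ : ℕ} (hn : 2 < n) (h₁ : ω₁.size = n) (h₂ : ω₂.size = n)
    (e₁ e₂ : Fin (2 * n + 3) ≃ Fin (2 * n + 3)) :
    Relabeling n (treeParent n ω₁) (treeParent n ω₂) (relabel e₁ e₂) (relabel e₂ e₁) where
  two_lt := hn
  tree₁ := isTree_treeParent h₁ (Nat.size_pos.1 (by omega))
  tree₂ := isTree_treeParent h₂ (Nat.size_pos.1 (by omega))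
  t_le := fun {u} _ => Nat.lt_succ_iff.1 (Fin.is_lt (e₂ (e₁.symm (Fin.ofNat _ u))))
  s_le := fun {u} _ => Nat.lt_succ_iff.1 (Fin.is_lt (e₁ (e₂.symm (Fin.ofNat _ u))))
  s_t := fun {_} hu => relabel_relabel e₁ e₂ (by omega)
  t_s := fun {_} hu => relabel_relabel e₂ e₁ (by omega)

theorem adj_iff_edge {n ω : ℕ} {G : Digraph (Fin (2 * n + 3))}
    (e : G.Adj ≃r (watermark n ω).Adj) (x y : Fin (2 * n + 3)) :
    G.Adj x y ↔ Edge n (treeParent n ω) (e x) (e y) :=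
  e.map_rel_iff.symm

theorem ncard_added {n ω₁ ω₂ : ℕ} {G₁ G₂ : Digraph (Fin (2 * n + 3))}
    (e₁ : G₁.Adj ≃r (watermark n ω₁).Adj) (e₂ : G₂.Adj ≃r (watermark n ω₂).Adj) :
    (edgeSet G₂ \ edgeSet G₁).ncard = ∑ u ∈ Finset.range (2 * n + 3),
      added n (treeParent n ω₁) (treeParent n ω₂) (relabel e₁.toEquiv e₂.toEquiv) u := by
  classical
  unfold added
  rw [← ncard_setOf_label e₁.toEquiv (fun u w => Edge n (treeParent n ω₂)
    (relabel e₁.toEquiv e₂.toEquiv u) (relabel e₁.toEquiv e₂.toEquiv w) ∧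
      ¬ Edge n (treeParent n ω₁) u w)]
  congr 1
  ext ⟨x, y⟩
  simp only [edgeSet, Set.mem_sdiff, Set.mem_ofPred_eq, relabel_apply]
  rw [adj_iff_edge e₁, adj_iff_edge e₂]
  rfl

theorem ncard_removed {n ω₁ ω₂ : ℕ} {G₁ G₂ : Digraph (Fin (2 * n + 3))}
    (e₁ : G₁.Adj ≃r (watermark n ω₁).Adj) (e₂ : G₂.Adj ≃r (watermark n ω₂).Adj) :
    (edgeSet G₁ \ edgeSet G₂).ncard = ∑ u ∈ Finset.range (2 * n + 3),
      removed n (treeParent n ω₁) (treeParent n ω₂) (relabel e₁.toEquiv e₂.toEquiv) u := by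
  classical
  unfold removed
  rw [← ncard_setOf_label e₁.toEquiv (fun u w => Edge n (treeParent n ω₁) u w ∧
    ¬ Edge n (treeParent n ω₂) (relabel e₁.toEquiv e₂.toEquiv u)
      (relabel e₁.toEquiv e₂.toEquiv w))]
  congr 1
  ext ⟨x, y⟩
  simp only [edgeSet, Set.mem_sdiff, Set.mem_ofPred_eq, relabel_apply]
  rw [adj_iff_edge e₁, adj_iff_edge e₂]
  rfl

theorem Relabeling.sum_added {n : ℕ} {q₁ q₂ t s : ℕ → ℕ} (P : Relabeling n q₁ q₂ t s) :
    ∑ u ∈ Finset.range (2 * n + 3), added n q₁ q₂ t u =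
      ∑ u ∈ Finset.range (2 * n + 3), removed n q₁ q₂ t u := by
  have h : ∑ u ∈ Finset.range (2 * n + 3), (added n q₁ q₂ t u + outDegree n u) =
      ∑ u ∈ Finset.range (2 * n + 3), (removed n q₁ q₂ t u + outDegree n (t u)) :=
    Finset.sum_congr rfl fun u hu => P.added_add (by simp at hu; omega)
  rw [Finset.sum_add_distrib, Finset.sum_add_distrib] at h
  have h2 : ∑ u ∈ Finset.range (2 * n + 3), outDegree n (t u) =
      ∑ u ∈ Finset.range (2 * n + 3), outDegree n u := by
    refine Finset.sum_nbij' t s ?_ ?_ ?_ ?_ ?_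
    · intro a ha; simp at ha ⊢; have := P.t_le (u := a) (by omega); omega
    · intro a ha; simp at ha ⊢; have := P.s_le (u := a) (by omega); omega
    · intro a ha; simp at ha; exact P.s_t (by omega)
    · intro a ha; simp at ha; exact P.t_s (by omega)
    · intro a ha; rfl
  omega

theorem add_add_le_sum {m : ℕ} (F : ℕ → ℕ) {u v w : ℕ} (h1 : u ≠ v) (h2 : u ≠ w) (h3 : v ≠ w)
    (hu : u < m) (hv : v < m) (hw : w < m) : F u + F v + F w ≤ ∑ x ∈ Finset.range m, F x := by
  have hsub : ({u, v, w} : Finset ℕ) ⊆ Finset.range m := by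
    intro x hx
    simp only [Finset.mem_insert, Finset.mem_singleton] at hx
    rw [Finset.mem_range]; omega
  have := Finset.sum_le_sum_of_subset (f := F) hsub
  rw [Finset.sum_insert (by simp [h1, h2]), Finset.sum_pair h3] at this
  omega

theorem ncard_diff_eq {n : ℕ} (hn : 2 < n) {G₁ G₂ : Digraph (Fin (2 * n + 3))}
    (h₁ : IsCanonicalRPG n G₁) (h₂ : IsCanonicalRPG n G₂) :
    (edgeSet G₁ \ edgeSet G₂).ncard = (edgeSet G₂ \ edgeSet G₁).ncard := by
  obtain ⟨ω₁, _, hs₁, ⟨e₁⟩⟩ := h₁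
  obtain ⟨ω₂, _, hs₂, ⟨e₂⟩⟩ := h₂
  rw [ncard_added e₁ e₂, ncard_removed e₁ e₂]
  exact (relabeling hn hs₁ hs₂ e₁.toEquiv e₂.toEquiv).sum_added.symm

/-- Distinct canonical reducible permutation graphs differ in at least three edges. -/
theorem three_le_ncard_diff {n : ℕ} (hn : 2 < n) {G₁ G₂ : Digraph (Fin (2 * n + 3))}
    (h₁ : IsCanonicalRPG n G₁) (h₂ : IsCanonicalRPG n G₂) (hne : G₁ ≠ G₂) :
    3 ≤ (edgeSet G₁ \ edgeSet G₂).ncard := by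
  have heq := ncard_diff_eq hn h₁ h₂
  obtain ⟨ω₁, _, hs₁, ⟨e₁⟩⟩ := h₁
  obtain ⟨ω₂, _, hs₂, ⟨e₂⟩⟩ := h₂
  by_contra hlt
  have P := relabeling hn hs₁ hs₂ e₁.toEquiv e₂.toEquiv
  have hA := ncard_added e₁ e₂
  have hD := ncard_removed e₁ e₂
  have hid := P.eq_of_le_two
    (fun u v w h1 h2 h3 hu hv hw => by
      have := add_add_le_sum (m := 2 * n + 3) (added n (treeParent n ω₁) (treeParent n ω₂)
        (relabel e₁.toEquiv e₂.toEquiv)) h1 h2 h3 (by omega) (by omega) (by omega)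
      omega)
    (fun u v w h1 h2 h3 hu hv hw => by
      have := add_add_le_sum (m := 2 * n + 3) (removed n (treeParent n ω₁) (treeParent n ω₂)
        (relabel e₁.toEquiv e₂.toEquiv)) h1 h2 h3 (by omega) (by omega) (by omega)
      omega)
  by_cases hω : ω₁ = ω₂
  · subst hω
    refine hne ?_
    ext x y
    rw [adj_iff_edge e₁, adj_iff_edge e₂]
    have hx := hid (e₁ x) (by omega)
    have hy := hid (e₁ y) (by omega)
    rw [show relabel e₁.toEquiv e₂.toEquiv (e₁ x) = e₂ x from relabel_apply _ _ x] at hx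
    rw [show relabel e₁.toEquiv e₂.toEquiv (e₁ y) = e₂ y from relabel_apply _ _ y] at hy
    rw [hx, hy]
  · obtain ⟨a, b, c, h1, h2, h3, h4, h5, h6, h7, h8, h9, d1, d2, d3⟩ :=
      three_diff_treeParent hn hs₁ hs₂ hω
    have key : ∀ u, 1 ≤ u → u ≤ 2 * n + 1 → treeParent n ω₁ u ≠ treeParent n ω₂ u →
        1 ≤ added n (treeParent n ω₁) (treeParent n ω₂) (relabel e₁.toEquiv e₂.toEquiv) u := by
      intro u hu hu' hq
      have h10 := P.lt_q₂ hu hu'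
      refine Relabeling.added_pos (w := treeParent n ω₂ u) h10.2 ?_ ?_
      · rw [hid u (by omega), hid _ h10.2]
        exact Or.inr ⟨hu, hu', rfl⟩
      · rintro (h | ⟨_, _, h⟩)
        · omega
        · exact hq h.symm
    have := add_add_le_sum (m := 2 * n + 3) (added n (treeParent n ω₁) (treeParent n ω₂)
        (relabel e₁.toEquiv e₂.toEquiv)) h1 h2 h3 (by omega) (by omega) (by omega)
    have := key a h4 h5 d1
    have := key b h6 h7 d2
    have := key c h8 h9 d3
    omega

theorem numModifications_eq {n : ℕ} (G₁ G₂ : Digraph (Fin (2 * n + 3))) :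
    numModifications G₁ G₂ =
      (edgeSet G₁ \ edgeSet G₂).ncard + (edgeSet G₂ \ edgeSet G₁).ncard := by
  unfold numModifications
  rw [Set.symmDiff_def, Set.ncard_union_eq disjoint_sdiff_sdiff (Set.toFinite _) (Set.toFinite _)]

theorem six_le_numModifications {n : ℕ} (hn : 2 < n) {G₁ G₂ : Digraph (Fin (2 * n + 3))}
    (h₁ : IsCanonicalRPG n G₁) (h₂ : IsCanonicalRPG n G₂) (hne : G₁ ≠ G₂) :
    6 ≤ numModifications G₁ G₂ := by
  have a := three_le_ncard_diff hn h₁ h₂ hne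
  have b := three_le_ncard_diff hn h₂ h₁ hne.symm
  rw [numModifications_eq]
  omega

theorem numModifications_triangle {m : ℕ} (G H K : Digraph (Fin m)) :
    numModifications G K ≤ numModifications G H + numModifications H K := by
  unfold numModifications
  refine (Set.ncard_le_ncard (t := symmDiff (edgeSet G) (edgeSet H) ∪
    symmDiff (edgeSet H) (edgeSet K)) ?_ (Set.toFinite _)).trans (Set.ncard_union_le _ _)
  exact symmDiff_triangle _ _ _

/-! ### Expressions that are evaluated in polynomial time -/

/-- The context in which an expression is evaluated: the size of the input (register `0`), the
values of the variables, and the memory. -/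
structure Ctx where
  size : ℕ
  var : ℕ → ℕ
  mem : ℕ → ℕ

/-- The context without the innermost variable. -/
def Ctx.tail (c : Ctx) : Ctx := ⟨c.size, fun x => c.var (x + 1), c.mem⟩

/-- The context with a new innermost variable. -/
def Ctx.cons (i : ℕ) (c : Ctx) : Ctx := ⟨c.size, fun x => Nat.casesOn x i c.var, c.mem⟩

/-- The context with renamed variables. -/
def Ctx.rename (f : ℕ → ℕ) (c : Ctx) : Ctx := ⟨c.size, fun x => c.var (f x), c.mem⟩

/-- The context with another memory. -/
def Ctx.withMem (c : Ctx) (μ : ℕ → ℕ) : Ctx := ⟨c.size, c.var, μ⟩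

/-- The context given by a configuration, where the variable `x` is held by the register
`loc x`. -/
def Config.ctx (s : Config) (loc : ℕ → ℕ) : Ctx := ⟨s.reg 0, fun x => s.reg (loc x), s.mem⟩

/-- The expression `E` can be evaluated into any register in polynomial time, without changing
the memory and the lower registers. -/
def Evaluable (E : Ctx → ℕ) : Prop :=
  ∀ (loc : ℕ → ℕ) (d : ℕ), 0 < d → (∀ x, loc x < d) → ∃ (P : Program) (p : Polynomial ℕ),
    ∀ s : Config, ∃ (t : ℕ) (s' : Config), Runs P s t s' ∧ t ≤ p.eval (s.reg 0) ∧
      s'.reg d = E (s.ctx loc) ∧ s'.mem = s.mem ∧ ∀ x < d, s'.reg x = s.reg x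

theorem Config.ctx_eq {s s' : Config} {loc : ℕ → ℕ} {d : ℕ} (hd : 0 < d) (hloc : ∀ x, loc x < d)
    (hmem : s'.mem = s.mem) (hreg : ∀ x < d, s'.reg x = s.reg x) : s'.ctx loc = s.ctx loc := by
  unfold Config.ctx
  rw [hreg 0 hd, hmem]
  congr 1
  funext x
  exact hreg _ (hloc x)

theorem Evaluable.const (k : ℕ) : Evaluable fun _ => k := by
  intro loc d hd hloc
  refine ⟨.const d k, 1, fun s => ⟨_, _, Runs.const d k s, by simp, by simp, rfl, ?_⟩⟩
  intro x hx
  simp [Function.update, hx.ne]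

theorem Evaluable.of_copy {E : Ctx → ℕ} (h : ∀ loc : ℕ → ℕ, ∀ d, 0 < d → (∀ x, loc x < d) →
    ∃ y < d, ∀ s : Config, s.reg y = E (s.ctx loc)) : Evaluable E := by
  intro loc d hd hloc
  obtain ⟨y, hy, he⟩ := h loc d hd hloc
  refine ⟨.seq (.const d 0) (.add d y d), 2, fun s => ⟨_, _,
    Runs.seq (Runs.const d 0 s) (Runs.add d y d _), by simp, ?_, rfl, ?_⟩⟩
  · rw [← he s]
    simp [Function.update, hy.ne]
  · intro x hx
    simp [Function.update, hx.ne]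

theorem Evaluable.var (x : ℕ) : Evaluable fun c => c.var x :=
  .of_copy fun loc _ _ hloc => ⟨loc x, hloc x, fun _ => rfl⟩

theorem Evaluable.size : Evaluable fun c => c.size :=
  .of_copy fun _ _ hd _ => ⟨0, hd, fun _ => rfl⟩

theorem Evaluable.rename {E : Ctx → ℕ} (h : Evaluable E) (f : ℕ → ℕ) :
    Evaluable fun c => E (c.rename f) :=
  fun loc d hd hloc => h (fun x => loc (f x)) d hd fun x => hloc (f x)

theorem Evaluable.tail {E : Ctx → ℕ} (h : Evaluable E) : Evaluable fun c => E c.tail :=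
  h.rename (· + 1)

theorem casesOn_lt {loc : ℕ → ℕ} {y d e : ℕ} (hloc : ∀ x, loc x < d) (hy : y < e) (hde : d ≤ e)
    (x : ℕ) : (Nat.casesOn x y loc : ℕ) < e := by
  cases x with
  | zero => exact hy
  | succ x => exact (hloc x).trans_le hde

/-- A binary operation that one instruction sequence performs on two registers. -/
theorem Evaluable.of_binary {op : ℕ → ℕ → ℕ} (I : ℕ → ℕ → Program)
    (hI : ∀ d e s, Runs (I d e) s 1 ⟨Function.update s.reg d (op (s.reg d) (s.reg e)), s.mem⟩)
    {A B : Ctx → ℕ} (hA : Evaluable A) (hB : Evaluable B) :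
    Evaluable fun c => op (A c) (B c) := by
  intro loc d hd hloc
  obtain ⟨P, p, hP⟩ := hA loc d hd hloc
  obtain ⟨Q, q, hQ⟩ := hB loc (d + 1) (by omega) fun x => (hloc x).trans (by omega)
  refine ⟨.seq (.seq P Q) (I d (d + 1)), p + q + 1, fun s => ?_⟩
  obtain ⟨t₁, s₁, r₁, c₁, v₁, m₁, e₁⟩ := hP s
  obtain ⟨t₂, s₂, r₂, c₂, v₂, m₂, e₂⟩ := hQ s₁
  refine ⟨_, _, .seq (.seq r₁ r₂) (hI d (d + 1) s₂), ?_, ?_, ?_, ?_⟩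
  · rw [e₁ 0 hd] at c₂
    simp only [Polynomial.eval_add, Polynomial.eval_one]
    omega
  · rw [Config.ctx_eq hd hloc m₁ e₁] at v₂
    simp [v₂, e₂ d (by omega), v₁]
  · simp [m₂, m₁]
  · intro x hx
    simp [Function.update, hx.ne, e₂ x (by omega), e₁ x hx]

theorem Evaluable.add {A B : Ctx → ℕ} (hA : Evaluable A) (hB : Evaluable B) :
    Evaluable fun c => A c + B c :=
  .of_binary (op := (· + ·)) (fun d e => .add d d e) (fun d e s => .add d d e s) hA hB

theorem Evaluable.sub {A B : Ctx → ℕ} (hA : Evaluable A) (hB : Evaluable B) :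
    Evaluable fun c => A c - B c :=
  .of_binary (op := (· - ·)) (fun d e => .sub d d e) (fun d e s => .sub d d e s) hA hB

theorem Evaluable.load {A : Ctx → ℕ} (hA : Evaluable A) : Evaluable fun c => c.mem (A c) := by
  intro loc d hd hloc
  obtain ⟨P, p, hP⟩ := hA loc d hd hloc
  refine ⟨.seq P (.load d d), p + 1, fun s => ?_⟩
  obtain ⟨t₁, s₁, r₁, c₁, v₁, m₁, e₁⟩ := hP s
  refine ⟨_, _, .seq r₁ (.load d d s₁), ?_, ?_, m₁, ?_⟩
  · simp only [Polynomial.eval_add, Polynomial.eval_one]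
    omega
  · simp [v₁, m₁, Config.ctx]
  · intro x hx
    simp [Function.update, hx.ne, e₁ x hx]

theorem Evaluable.cond {C A B : Ctx → ℕ} (hC : Evaluable C) (hA : Evaluable A)
    (hB : Evaluable B) : Evaluable fun c => if C c ≠ 0 then A c else B c := by
  intro loc d hd hloc
  obtain ⟨P, p, hP⟩ := hC loc d hd hloc
  obtain ⟨Q, q, hQ⟩ := hA loc d hd hloc
  obtain ⟨R, r, hR⟩ := hB loc d hd hloc
  refine ⟨.seq P (.cond d Q R), p + (q + r + 1), fun s => ?_⟩
  obtain ⟨t₁, s₁, r₁, c₁, v₁, m₁, e₁⟩ := hP s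
  have hctx := Config.ctx_eq hd hloc m₁ e₁
  by_cases hz : C (s.ctx loc) = 0
  · obtain ⟨t₂, s₂, r₂, c₂, v₂, m₂, e₂⟩ := hR s₁
    refine ⟨_, _, .seq r₁ (.cond_false (by rw [v₁, hz]) r₂), ?_, ?_, m₂.trans m₁, ?_⟩
    · rw [e₁ 0 hd] at c₂
      simp only [Polynomial.eval_add, Polynomial.eval_one]
      omega
    · rw [v₂, hctx]; simp [hz]
    · intro x hx
      rw [e₂ x hx, e₁ x hx]
  · obtain ⟨t₂, s₂, r₂, c₂, v₂, m₂, e₂⟩ := hQ s₁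
    refine ⟨_, _, .seq r₁ (.cond_true (by rw [v₁]; exact hz) r₂), ?_, ?_, m₂.trans m₁, ?_⟩
    · rw [e₁ 0 hd] at c₂
      simp only [Polynomial.eval_add, Polynomial.eval_one]
      omega
    · rw [v₂, hctx]; simp [hz]
    · intro x hx
      rw [e₂ x hx, e₁ x hx]

/-- A loop that counts in the register `d` up to the value of register `0`. It keeps the number
of the remaining rounds in the register `d + 1`, and uses the register `d + 2`. -/
def countingLoop (d : ℕ) (P : Program) : Program :=
  .seq (.seq (.const d 0) (.sub (d + 1) 0 d))
    (.loop (d + 1) (.seq P (.seq (.const (d + 2) 1)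
      (.seq (.add d d (d + 2)) (.sub (d + 1) 0 d)))))

theorem countingLoop_runs {d : ℕ} (hd : 0 < d) (P : Program) (T : ℕ) (I : ℕ → Config → Prop)
    (m : ℕ) (hm : ∀ i s, I i s → s.reg 0 = m)
    (hI : ∀ i s s', I i s → s'.mem = s.mem →
      (∀ x, x < d ∨ d + 2 < x → s'.reg x = s.reg x) → I i s')
    (hP : ∀ i s, I i s → i < m → s.reg d = i → ∃ t s', Runs P s t s' ∧ t ≤ T ∧ I (i + 1) s' ∧
      s'.reg d = i)
    {s : Config} (h0 : I 0 s) :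
    ∃ t s', Runs (countingLoop d P) s t s' ∧ t ≤ m * (T + 4) + 3 ∧ I m s' := by
  have key : ∀ k i s, i + k = m → I i s → s.reg d = i → s.reg (d + 1) = k →
      ∃ t s', Runs (.loop (d + 1) (.seq P (.seq (.const (d + 2) 1)
        (.seq (.add d d (d + 2)) (.sub (d + 1) 0 d))))) s t s' ∧ t ≤ k * (T + 4) + 1 ∧
          I m s' := by
    intro k
    induction k with
    | zero =>
      intro i s hi h1 h2 h3
      obtain rfl : i = m := by omega
      exact ⟨1, s, .loop_done h3, by omega, h1⟩
    | succ k ih =>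
      intro i s hi h1 h2 h3
      obtain ⟨t₁, s₁, r₁, c₁, h4, h5⟩ := hP i s h1 (by omega) h2
      have h6 := Runs.seq r₁ (.seq (.const (d + 2) 1 s₁)
        (.seq (.add d d (d + 2) _) (.sub (d + 1) 0 d _)))
      have hm' := hm _ _ h4
      obtain ⟨t₂, s₂, r₂, c₂, h7⟩ := ih (i + 1)
        ⟨Function.update (Function.update (Function.update s₁.reg (d + 2) 1) d (i + 1)) (d + 1) k,
          s₁.mem⟩ (by omega)
        (hI _ s₁ _ h4 rfl fun x hx => by
          have : x ≠ d := by omega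
          have : x ≠ d + 1 := by omega
          have : x ≠ d + 2 := by omega
          simp [Function.update, *])
        (by simp [Function.update]) (by simp [Function.update])
      refine ⟨t₁ + (1 + (1 + 1)) + t₂ + 1, s₂, .loop_step (by omega) h6 ?_, ?_, h7⟩
      · have h0' : (0 : ℕ) ≠ d := by omega
        convert r₂ using 3
        · simp [Function.update, h5]
        · simp [Function.update, h5, h0', hm']
          omega
      · rw [Nat.succ_mul]
        omega
  have hm0 := hm _ _ h0
  obtain ⟨t, s', r, c, h⟩ := key m 0
    ⟨Function.update (Function.update s.reg d 0) (d + 1) m, s.mem⟩ (by omega)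
    (hI _ s _ h0 rfl fun x hx => by
      have : x ≠ d := by omega
      have : x ≠ d + 1 := by omega
      simp [Function.update, *])
    (by simp [Function.update]) (by simp [Function.update])
  refine ⟨1 + 1 + t, s', .seq (.seq (.const d 0 s) (.sub (d + 1) 0 d _)) ?_, ?_, h⟩
  · convert r using 3
    have h0' : (0 : ℕ) ≠ d := by omega
    simp [Function.update, h0', hm0]
  · omega

theorem Evaluable.sum {F : ℕ → Ctx → ℕ} (hF : Evaluable fun c => F (c.var 0) c.tail) :
    Evaluable fun c => ∑ i ∈ Finset.range c.size, F i c := by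
  intro loc d hd hloc
  obtain ⟨P, p, hP⟩ := hF (fun x => Nat.casesOn x (d + 1) loc) (d + 4) (by omega)
    (casesOn_lt hloc (by omega) (by omega))
  refine ⟨.seq (.const d 0) (countingLoop (d + 1) (.seq P (.add d d (d + 4)))),
    Polynomial.X * (p + 5) + 4, fun s => ?_⟩
  obtain ⟨t, s', r, ct, hm, hv, he⟩ := countingLoop_runs (d := d + 1) (by omega)
    (.seq P (.add d d (d + 4)))
    (p.eval (s.reg 0) + 1) (fun i s₁ => s₁.mem = s.mem ∧
      s₁.reg d = ∑ j ∈ Finset.range i, F j (s.ctx loc) ∧ ∀ x < d, s₁.reg x = s.reg x) (s.reg 0)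
    (fun i s₁ h => h.2.2 0 hd)
    (fun i s₁ s₂ h h1 h2 => ⟨h1.trans h.1, (h2 d (by omega)).trans h.2.1,
      fun x hx => (h2 x (by omega)).trans (h.2.2 x hx)⟩)
    (by
      rintro i s₁ ⟨h1, h2, h3⟩ hi hd1
      obtain ⟨t, s₂, r, ct, v, m, e⟩ := hP s₁
      refine ⟨_, _, .seq r (.add d d (d + 4) s₂), ?_, ⟨m.trans h1, ?_, ?_⟩, ?_⟩
      · rw [h3 0 hd] at ct; omega
      · replace v : s₂.reg (d + 4) = F (s₁.reg (d + 1)) (s₁.ctx loc) := v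
        rw [hd1, Config.ctx_eq hd hloc h1 h3] at v
        rw [Finset.sum_range_succ]
        simp [v, e d (by omega), h2]
      · intro x hx
        simp [Function.update, hx.ne, e x (by omega), h3 x hx]
      · simp [Function.update, e (d + 1) (by omega), hd1])
    (s := ⟨Function.update s.reg d 0, s.mem⟩)
    ⟨rfl, by simp, fun x hx => by simp [Function.update, hx.ne]⟩
  refine ⟨_, s', .seq (.const d 0 s) r, ?_, hv, hm, he⟩
  simp only [Polynomial.eval_add, Polynomial.eval_mul, Polynomial.eval_X, Polynomial.eval_ofNat]
  have : p.eval (s.reg 0) + 1 + 4 = p.eval (s.reg 0) + 5 := by omega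
  rw [this] at ct
  omega

/-! ### Conditions that are decided in polynomial time -/

open Classical in
/-- The condition `φ` can be evaluated in polynomial time. -/
def Testable (φ : Ctx → Prop) : Prop := Evaluable fun c => if φ c then 1 else 0

theorem Testable.congr {φ ψ : Ctx → Prop} (h : Testable φ) (e : ∀ c, φ c ↔ ψ c) : Testable ψ := by
  have : φ = ψ := funext fun c => propext (e c)
  rwa [← this]

theorem Testable.ite {φ : Ctx → Prop} {inst : DecidablePred φ} {A B : Ctx → ℕ} (h : Testable φ)
    (hA : Evaluable A) (hB : Evaluable B) :
    Evaluable fun c => @ite ℕ (φ c) (inst c) (A c) (B c) := by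
  refine (congrArg Evaluable (funext fun c => ?_)).mp (Evaluable.cond h hA hB)
  by_cases h1 : φ c <;> simp [h1]

theorem Testable.of_ne_zero {A : Ctx → ℕ} (hA : Evaluable A) : Testable fun c => A c ≠ 0 := by
  unfold Testable
  have := Evaluable.cond hA (.const 1) (.const 0)
  convert this

theorem Testable.lt {A B : Ctx → ℕ} (hA : Evaluable A) (hB : Evaluable B) :
    Testable fun c => A c < B c :=
  (Testable.of_ne_zero (hB.sub hA)).congr fun c => by omega

theorem Testable.and {φ ψ : Ctx → Prop} (h : Testable φ) (h' : Testable ψ) :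
    Testable fun c => φ c ∧ ψ c := by
  unfold Testable
  refine (congrArg Evaluable (funext fun c => ?_)).mp (Testable.ite (inst := Classical.decPred φ) h h' (.const 0))
  by_cases h1 : φ c <;> by_cases h2 : ψ c <;> simp [h1, h2]

theorem Testable.not {φ : Ctx → Prop} (h : Testable φ) : Testable fun c => ¬ φ c := by
  unfold Testable
  refine (congrArg Evaluable (funext fun c => ?_)).mp (Testable.ite (inst := Classical.decPred φ) h (.const 0) (.const 1))
  by_cases h1 : φ c <;> simp [h1]

theorem Testable.or {φ ψ : Ctx → Prop} (h : Testable φ) (h' : Testable ψ) :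
    Testable fun c => φ c ∨ ψ c :=
  (h.not.and h'.not).not.congr fun c => by tauto

theorem Testable.imp {φ ψ : Ctx → Prop} (h : Testable φ) (h' : Testable ψ) :
    Testable fun c => φ c → ψ c :=
  (h.not.or h').congr fun c => by tauto

theorem Testable.iff {φ ψ : Ctx → Prop} (h : Testable φ) (h' : Testable ψ) :
    Testable fun c => φ c ↔ ψ c :=
  ((h.imp h').and (h'.imp h)).congr fun c => by tauto

theorem Testable.le {A B : Ctx → ℕ} (hA : Evaluable A) (hB : Evaluable B) :
    Testable fun c => A c ≤ B c :=
  (Testable.lt hB hA).not.congr fun c => by omega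

theorem Testable.eq {A B : Ctx → ℕ} (hA : Evaluable A) (hB : Evaluable B) :
    Testable fun c => A c = B c :=
  ((Testable.le hA hB).and (Testable.le hB hA)).congr fun c => by omega

theorem Testable.ex {φ : ℕ → Ctx → Prop} (h : Testable fun c => φ (c.var 0) c.tail) :
    Testable fun c => ∃ i < c.size, φ i c := by
  classical
  have := Testable.of_ne_zero (Evaluable.sum (F := fun i c => if φ i c then 1 else 0) h)
  refine this.congr fun c => ?_
  rw [Finset.sum_boole]
  simp [Finset.filter_eq_empty_iff]

theorem Testable.all {φ : ℕ → Ctx → Prop} (h : Testable fun c => φ (c.var 0) c.tail) :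
    Testable fun c => ∀ i < c.size, φ i c :=
  (Testable.ex (φ := fun i c => ¬ φ i c) h.not).not.congr fun c => by push Not; rfl

/-! ### Commands that run in polynomial time -/

/-- The transformation `F` of the memory can be executed in polynomial time, without changing
low registers. -/
def Executable (F : Ctx → ℕ → ℕ) : Prop :=
  ∀ (loc : ℕ → ℕ) (d : ℕ), 0 < d → (∀ x, loc x < d) → ∃ (P : Program) (p : Polynomial ℕ),
    ∀ s : Config, ∃ (t : ℕ) (s' : Config), Runs P s t s' ∧ t ≤ p.eval (s.reg 0) ∧
      s'.mem = F (s.ctx loc) ∧ ∀ x < d, s'.reg x = s.reg x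

theorem Executable.store {A B : Ctx → ℕ} (hA : Evaluable A) (hB : Evaluable B) :
    Executable fun c => Function.update c.mem (A c) (B c) := by
  intro loc d hd hloc
  obtain ⟨P, p, hP⟩ := hA loc d hd hloc
  obtain ⟨Q, q, hQ⟩ := hB loc (d + 1) (by omega) fun x => (hloc x).trans (by omega)
  refine ⟨.seq (.seq P Q) (.store d (d + 1)), p + q + 1, fun s => ?_⟩
  obtain ⟨t₁, s₁, r₁, c₁, v₁, m₁, e₁⟩ := hP s
  obtain ⟨t₂, s₂, r₂, c₂, v₂, m₂, e₂⟩ := hQ s₁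
  refine ⟨_, _, .seq (.seq r₁ r₂) (.store d (d + 1) s₂), ?_, ?_, ?_⟩
  · rw [e₁ 0 hd] at c₂
    simp only [Polynomial.eval_add, Polynomial.eval_one]
    omega
  · rw [Config.ctx_eq hd hloc m₁ e₁] at v₂
    simp [v₂, e₂ d (by omega), v₁, m₂, m₁, Config.ctx]
  · intro x hx
    simp [e₂ x (by omega), e₁ x hx]

theorem Config.ctx_withMem {s s' : Config} {loc : ℕ → ℕ} {d : ℕ} (hd : 0 < d)
    (hloc : ∀ x, loc x < d) (hreg : ∀ x < d, s'.reg x = s.reg x) :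
    s'.ctx loc = (s.ctx loc).withMem s'.mem := by
  unfold Config.ctx Ctx.withMem
  rw [hreg 0 hd]
  congr 1
  funext x
  exact hreg _ (hloc x)

theorem Executable.seq {F G : Ctx → ℕ → ℕ} (hF : Executable F) (hG : Executable G) :
    Executable fun c => G (c.withMem (F c)) := by
  intro loc d hd hloc
  obtain ⟨P, p, hP⟩ := hF loc d hd hloc
  obtain ⟨Q, q, hQ⟩ := hG loc d hd hloc
  refine ⟨.seq P Q, p + q, fun s => ?_⟩
  obtain ⟨t₁, s₁, r₁, c₁, v₁, e₁⟩ := hP s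
  obtain ⟨t₂, s₂, r₂, c₂, v₂, e₂⟩ := hQ s₁
  refine ⟨_, _, .seq r₁ r₂, ?_, ?_, fun x hx => (e₂ x hx).trans (e₁ x hx)⟩
  · rw [e₁ 0 hd] at c₂
    simp only [Polynomial.eval_add]
    omega
  · rw [v₂, Config.ctx_withMem hd hloc e₁, v₁]

theorem Executable.when {φ : Ctx → Prop} {inst : DecidablePred φ} {F : Ctx → ℕ → ℕ}
    (hφ : Testable φ) (hF : Executable F) :
    Executable fun c => @ite (ℕ → ℕ) (φ c) (inst c) (F c) c.mem := by
  intro loc d hd hloc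
  obtain ⟨P, p, hP⟩ := hφ loc d hd hloc
  obtain ⟨Q, q, hQ⟩ := hF loc d hd hloc
  refine ⟨.seq P (.cond d Q (.const d 0)), p + (q + 2), fun s => ?_⟩
  obtain ⟨t₁, s₁, r₁, c₁, v₁, m₁, e₁⟩ := hP s
  have hctx := Config.ctx_eq hd hloc m₁ e₁
  by_cases hz : φ (s.ctx loc)
  · obtain ⟨t₂, s₂, r₂, c₂, v₂, e₂⟩ := hQ s₁
    refine ⟨_, _, .seq r₁ (.cond_true (by rw [v₁]; simp [hz]) r₂), ?_, ?_, ?_⟩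
    · rw [e₁ 0 hd] at c₂
      simp only [Polynomial.eval_add, Polynomial.eval_ofNat]
      omega
    · rw [v₂, hctx]; simp [hz]
    · intro x hx
      rw [e₂ x hx, e₁ x hx]
  · refine ⟨_, _, .seq r₁ (.cond_false (by rw [v₁]; simp [hz]) (.const d 0 s₁)), ?_, ?_, ?_⟩
    · simp only [Polynomial.eval_add, Polynomial.eval_ofNat]
      omega
    · beta_reduce
      rw [if_neg hz]
      exact m₁
    · intro x hx
      simp [Function.update, hx.ne, e₁ x hx]

/-- The memory after the rounds `0, …, m - 1` of a loop. -/
def iterate (F : ℕ → (ℕ → ℕ) → ℕ → ℕ) (μ : ℕ → ℕ) : ℕ → ℕ → ℕ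
  | 0 => μ
  | i + 1 => F i (iterate F μ i)

theorem Executable.for {F : ℕ → Ctx → ℕ → ℕ} (hF : Executable fun c => F (c.var 0) c.tail) :
    Executable fun c => iterate (fun i μ => F i (c.withMem μ)) c.mem c.size := by
  intro loc d hd hloc
  obtain ⟨P, p, hP⟩ := hF (fun x => Nat.casesOn x d loc) (d + 3) (by omega)
    (casesOn_lt hloc (by omega) (by omega))
  refine ⟨countingLoop d P, Polynomial.X * (p + 4) + 3, fun s => ?_⟩
  obtain ⟨t, s', r, ct, hv, he⟩ := countingLoop_runs hd P
    (p.eval (s.reg 0)) (fun i s₁ => s₁.mem = iterate (fun i μ => F i ((s.ctx loc).withMem μ))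
      s.mem i ∧ ∀ x < d, s₁.reg x = s.reg x) (s.reg 0)
    (fun i s₁ h => h.2 0 hd)
    (fun i s₁ s₂ h h1 h2 => ⟨h1.trans h.1,
      fun x hx => (h2 x (by omega)).trans (h.2 x hx)⟩)
    (by
      rintro i s₁ ⟨h1, h3⟩ hi hd1
      obtain ⟨t, s₂, r, ct, v, e⟩ := hP s₁
      refine ⟨_, _, r, ?_, ⟨?_, ?_⟩, ?_⟩
      · rwa [h3 0 hd] at ct
      · replace v : s₂.mem = F (s₁.reg d) (s₁.ctx loc) := v
        rw [hd1, Config.ctx_withMem hd hloc h3, h1] at v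
        rw [v]; rfl
      · intro x hx
        rw [e x (by omega), h3 x hx]
      · rw [e d (by omega), hd1])
    (s := s) ⟨rfl, fun x hx => rfl⟩
  refine ⟨_, s', r, ?_, hv, he⟩
  simp only [Polynomial.eval_add, Polynomial.eval_mul, Polynomial.eval_X, Polynomial.eval_ofNat]
  omega

theorem Ctx.cons_var_tail (c : Ctx) : c.tail.cons (c.var 0) = c := by
  unfold Ctx.tail Ctx.cons
  congr 1
  funext x
  cases x <;> rfl

/-- The loop that runs `B` with the innermost variable `0, …, m - 1`. -/
def forLoop (B : Ctx → ℕ → ℕ) (c : Ctx) : ℕ → ℕ :=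
  iterate (fun i μ => B ((c.withMem μ).cons i)) c.mem c.size

theorem Executable.forLoop {B : Ctx → ℕ → ℕ} (hB : Executable B) :
    Executable (Watermark.forLoop B) := by
  refine Executable.for (F := fun i c => B (c.cons i)) ?_
  simpa only [Ctx.cons_var_tail] using hB

/-! ### The algorithm -/

/-- The predicate `Z` is decided in polynomial time, in any scope. -/
def TestablePred (Z : Ctx → ℕ → Prop) : Prop :=
  ∀ (f : ℕ → ℕ) {A : Ctx → ℕ}, Evaluable A → Testable fun c => Z (c.rename f) (A c)

/-- The relation `R` is decided in polynomial time, in any scope. -/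
def TestableRel (R : Ctx → ℕ → ℕ → Prop) : Prop :=
  ∀ (f : ℕ → ℕ) {A B : Ctx → ℕ}, Evaluable A → Evaluable B →
    Testable fun c => R (c.rename f) (A c) (B c)

/-- The function `r` is evaluated in polynomial time, in any scope. -/
def EvaluableFun (r : Ctx → ℕ → ℕ) : Prop :=
  ∀ (f : ℕ → ℕ) {A : Ctx → ℕ}, Evaluable A → Evaluable fun c => r (c.rename f) (A c)

theorem TestablePred.precedes {Z : Ctx → ℕ → Prop} (hZ : TestablePred Z) :
    TestableRel fun c => Precedes (Z c) := fun f _ _ hA hB =>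
  (((hZ f hA).and ((hZ f hB).and (.lt hA hB))).or (((hZ f hA).and (hZ f hB).not).or
    ((hZ f hA).not.and ((hZ f hB).not.and (.lt hB hA)))))

open Classical in
theorem TestablePred.rank {Z : Ctx → ℕ → Prop} (hZ : TestablePred Z) :
    EvaluableFun fun c => rank c.size (Z c) := fun f A hA =>
  Evaluable.sum (F := fun y c => if 1 ≤ y ∧ y + 2 ≤ c.size ∧ Precedes (Z (c.rename f)) y (A c)
    then 1 else 0) (Testable.ite ((Testable.le (.const 1) (.var 0)).and
      ((Testable.le ((Evaluable.var 0).add (.const 2)) .size).and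
        (hZ.precedes (fun x => f x + 1) (.var 0) hA.tail))) (.const 1) (.const 0))

open Classical in
theorem TestablePred.mirror {Z : Ctx → ℕ → Prop} (hZ : TestablePred Z) :
    EvaluableFun fun c => mirror c.size (Z c) := fun f A hA =>
  Evaluable.sum (F := fun y c => if 1 ≤ y ∧ y + 2 ≤ c.size ∧ Watermark.rank c.size
    (Z (c.rename f)) y + Watermark.rank c.size (Z (c.rename f)) (A c) + 3 = c.size then y else 0)
    (Testable.ite ((Testable.le (.const 1) (.var 0)).and
      ((Testable.le ((Evaluable.var 0).add (.const 2)) .size).and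
        (Testable.eq (((hZ.rank (fun x => f x + 1) (.var 0)).add
          (hZ.rank (fun x => f x + 1) hA.tail)).add (.const 3)) .size))) (.var 0) (.const 0))

theorem TestablePred.isParent {Z : Ctx → ℕ → Prop} (hZ : TestablePred Z) :
    TestableRel fun c => IsParent c.size (Z c) := fun f A B hA hB =>
  have hf {A : Ctx → ℕ} (hA : Evaluable A) := hZ.mirror f hA
  have hf' {A : Ctx → ℕ} (hA : Evaluable A) := hZ.mirror (fun x => f x + 1) hA
  ((Testable.le (hB.add (.const 2)) .size).and ((Testable.lt hA hB).and
    ((Testable.lt (hf hB) (hf hA)).and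
      (Testable.all (φ := fun x c => 1 ≤ x → x + 2 ≤ c.size →
        Watermark.mirror c.size (Z (c.rename f)) (B c) <
          Watermark.mirror c.size (Z (c.rename f)) x →
        Watermark.mirror c.size (Z (c.rename f)) x <
          Watermark.mirror c.size (Z (c.rename f)) (A c) → x ≤ A c)
        ((Testable.le (.const 1) (.var 0)).imp
          ((Testable.le ((Evaluable.var 0).add (.const 2)) .size).imp
            ((Testable.lt (hf' hB.tail) (hf' (.var 0))).imp
              ((Testable.lt (hf' (.var 0)) (hf' hA.tail)).imp
                (Testable.le (.var 0) hA.tail)))))))) ).or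
  ((Testable.eq (hB.add (.const 1)) .size).and
    (Testable.all (φ := fun x c => 1 ≤ x → x + 2 ≤ c.size →
        Watermark.mirror c.size (Z (c.rename f)) x <
          Watermark.mirror c.size (Z (c.rename f)) (A c) → x ≤ A c)
        ((Testable.le (.const 1) (.var 0)).imp
          ((Testable.le ((Evaluable.var 0).add (.const 2)) .size).imp
            ((Testable.lt (hf' (.var 0)) (hf' hA.tail)).imp
                (Testable.le (.var 0) hA.tail))))))

/-- The address of the entry `(u, v)` of an `m × m` matrix, for `u ≤ m`. -/
def cell (m u v : ℕ) : ℕ := (∑ i ∈ Finset.range m, if i < u then m else 0) + v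

theorem Evaluable.cell {A B : Ctx → ℕ} (hA : Evaluable A) (hB : Evaluable B) :
    Evaluable fun c => cell c.size (A c) (B c) :=
  (Evaluable.sum (F := fun i c => if i < A c then c.size else 0)
    (Testable.ite (Testable.lt (.var 0) hA.tail) .size (.const 0))).add hB

/-- The adjacency in the virtual digraph, which differs from the digraph in the memory at
most in the pairs `(c.var 0, c.var 1)` and `(c.var 2, c.var 3)`, and does not differ at all
if `c.var 4 = 0`. -/
def VirtualEdge (c : Ctx) (u v : ℕ) : Prop :=
  ¬ (c.mem (cell c.size u v) ≠ 0 ↔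
    c.var 4 ≠ 0 ∧ ((u = c.var 0 ∧ v = c.var 1) ∨ (u = c.var 2 ∧ v = c.var 3)))

theorem testableRel_virtualEdge : TestableRel VirtualEdge := fun f _ _ hA hB =>
  ((Testable.of_ne_zero (hA.cell hB).load).iff ((Testable.of_ne_zero (.var (f 4))).and
    (((Testable.eq hA (.var (f 0))).and (Testable.eq hB (.var (f 1)))).or
      ((Testable.eq hA (.var (f 2))).and (Testable.eq hB (.var (f 3))))))).not

/-- The vertex that has been found to have the label `j`. -/
def order (c : Ctx) (j : ℕ) : ℕ := c.mem (cell c.size c.size j)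

theorem evaluableFun_order : EvaluableFun order := fun _ _ hA =>
  (Evaluable.size.cell hA).load

open Classical in
/-- The vertex `w` can be given the label `j`, when all greater labels have been given. -/
def IsNext (c : Ctx) (j w : ℕ) : Prop :=
  (j + 1 = c.size ∧ ∑ x ∈ Finset.range c.size, (if VirtualEdge c w x then 1 else 0) = 1) ∨
  (j + 1 < c.size ∧ VirtualEdge c (order c (j + 1)) w ∧ ∀ i < c.size, j < i → order c i ≠ w)

open Classical in
theorem testableRel_isNext : TestableRel IsNext := fun f A B hA hB =>
  ((Testable.eq (hA.add (.const 1)) .size).and (Testable.eq (Evaluable.sum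
    (F := fun x c => if VirtualEdge (c.rename f) (B c) x then 1 else 0)
      (Testable.ite (testableRel_virtualEdge (fun x => f x + 1) hB.tail (.var 0))
        (.const 1) (.const 0))) (.const 1))).or
  ((Testable.lt (hA.add (.const 1)) .size).and
    ((testableRel_virtualEdge f (evaluableFun_order f (hA.add (.const 1))) hB).and
      (Testable.all (φ := fun i c => A c < i → order (c.rename f) i ≠ B c)
        ((Testable.lt hA.tail (.var 0)).imp
          (Testable.eq (evaluableFun_order (fun x => f x + 1) (.var 0)) hB.tail).not))))

open Classical in
/-- The vertex that is given the label `j`. -/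
noncomputable def nextVertex (c : Ctx) (j : ℕ) : ℕ :=
  ∑ w ∈ Finset.range c.size, if IsNext c j w then w else 0

open Classical in
theorem evaluableFun_nextVertex : EvaluableFun nextVertex := fun f A hA =>
  Evaluable.sum (F := fun w c => if IsNext (c.rename f) (A c) w then w else 0)
    (Testable.ite (testableRel_isNext (fun x => f x + 1) hA.tail (.var 0)) (.var 0) (.const 0))

/-- Find the vertex with the label `m - 1 - c.var 0`. -/
noncomputable def labelStep (c : Ctx) : ℕ → ℕ :=
  Function.update c.mem (cell c.size c.size (c.size - 1 - c.var 0))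
    (nextVertex (c.rename (· + 1)) (c.size - 1 - c.var 0))

/-- Label the vertices. -/
noncomputable def labelAll : Ctx → ℕ → ℕ := forLoop labelStep

theorem executable_labelAll : Executable labelAll :=
  have h : Evaluable fun c => c.size - 1 - c.var 0 := (Evaluable.size.sub (.const 1)).sub (.var 0)
  Executable.forLoop (Executable.store (Evaluable.size.cell h) (evaluableFun_nextVertex (· + 1) h))

/-- The label `i` is found to be the index of a zero of the extended binary. -/
def IsFoundZero (c : Ctx) (i : ℕ) : Prop :=
  i + 2 = c.size ∨ (c.size ≤ i + i + 1 ∧ i + 3 ≤ c.size ∧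
    VirtualEdge c (order c i) (order c (c.size - 1)))

theorem testablePred_isFoundZero : TestablePred IsFoundZero := fun f _ hA =>
  (Testable.eq (hA.add (.const 2)) .size).or
    ((Testable.le .size ((hA.add hA).add (.const 1))).and
      ((Testable.le (hA.add (.const 3)) .size).and
        (testableRel_virtualEdge f (evaluableFun_order f hA)
          (evaluableFun_order f (Evaluable.size.sub (.const 1))))))

/-- The labels make the virtual digraph a watermark. -/
def Succeeds (c : Ctx) : Prop :=
  (∀ w < c.size, ∃ j < c.size, order c j = w) ∧
  (∃ i < c.size, i + i + 1 = c.size ∧ IsFoundZero c i) ∧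
  ∀ u < c.size, ∀ v < c.size, VirtualEdge c (order c u) (order c v) ↔
    u = v + 1 ∨ (1 ≤ u ∧ u + 2 ≤ c.size ∧ IsParent c.size (IsFoundZero c) u v)

theorem testable_succeeds (f : ℕ → ℕ) : Testable fun c => Succeeds (c.rename f) := by
  refine Testable.and (Testable.all (φ := fun w c => ∃ j < c.size, order (c.rename f) j = w)
    (Testable.ex (φ := fun j c => order (c.rename (fun x => f x + 1)) j = c.var 0)
      (.eq (evaluableFun_order (fun x => f x + 2) (.var 0)) (.var 1)))) (Testable.and
    (Testable.ex (φ := fun i c => i + i + 1 = c.size ∧ IsFoundZero (c.rename f) i)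
      (.and (.eq (((Evaluable.var 0).add (.var 0)).add (.const 1)) .size)
        (testablePred_isFoundZero (fun x => f x + 1) (.var 0))))
    (Testable.all (φ := fun u c => ∀ v < c.size,
        VirtualEdge (c.rename f) (order (c.rename f) u) (order (c.rename f) v) ↔
          u = v + 1 ∨ (1 ≤ u ∧ u + 2 ≤ c.size ∧
            IsParent c.size (IsFoundZero (c.rename f)) u v))
      (Testable.all (φ := fun v c =>
          VirtualEdge (c.rename (fun x => f x + 1)) (order (c.rename (fun x => f x + 1)) (c.var 0))
            (order (c.rename (fun x => f x + 1)) v) ↔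
          c.var 0 = v + 1 ∨ (1 ≤ c.var 0 ∧ c.var 0 + 2 ≤ c.size ∧
            IsParent c.size (IsFoundZero (c.rename (fun x => f x + 1))) (c.var 0) v))
        ?_)))
  have h (x : ℕ) : Evaluable fun c => c.var x := .var x
  refine (testableRel_virtualEdge (fun x => f x + 2) (evaluableFun_order (fun x => f x + 2) (h 1))
    (evaluableFun_order (fun x => f x + 2) (h 0))).iff
    ((Testable.eq (h 1) ((h 0).add (.const 1))).or ((Testable.le (.const 1) (h 1)).and
      ((Testable.le ((h 1).add (.const 2)) .size).and
        (testablePred_isFoundZero.isParent (fun x => f x + 2) (h 1) (h 0)))))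

/-- The address of the entry `(u, v)` of the output, before it is moved to its place. -/
def outCell (m u v : ℕ) : ℕ := cell m m (m + cell m u v)

theorem Evaluable.outCell {A B : Ctx → ℕ} (hA : Evaluable A) (hB : Evaluable B) :
    Evaluable fun c => outCell c.size (A c) (B c) :=
  Evaluable.size.cell (Evaluable.size.add (hA.cell hB))

open Classical in
/-- Write the virtual digraph to the output. -/
noncomputable def writeOut : Ctx → ℕ → ℕ :=
  forLoop (forLoop fun c => Function.update c.mem (outCell c.size (c.var 1) (c.var 0))
    (if VirtualEdge (c.rename (· + 2)) (c.var 1) (c.var 0) then 1 else 0))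

theorem executable_writeOut : Executable writeOut :=
  .forLoop (.forLoop (.store (Evaluable.outCell (.var 1) (.var 0))
    (Testable.ite (testableRel_virtualEdge (· + 2) (.var 1) (.var 0)) (.const 1) (.const 0))))

/-- Move the output to its place. -/
def moveOut : Ctx → ℕ → ℕ :=
  forLoop (forLoop fun c => Function.update c.mem (cell c.size (c.var 1) (c.var 0))
    (if c.mem (outCell c.size (c.var 1) (c.var 0)) ≠ 0 then 1 else 0))

theorem executable_moveOut : Executable moveOut :=
  .forLoop (.forLoop (.store (Evaluable.cell (.var 1) (.var 0))
    (Testable.ite (.of_ne_zero (Evaluable.outCell (.var 1) (.var 0)).load) (.const 1) (.const 0))))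

open Classical in
/-- Write the virtual digraph to the output if it is found to be a watermark. -/
noncomputable def tryToggles (c : Ctx) : ℕ → ℕ :=
  if Succeeds (c.withMem (labelAll c)) then writeOut (c.withMem (labelAll c)) else labelAll c

open Classical in
theorem executable_tryToggles : Executable tryToggles :=
  executable_labelAll.seq (G := fun c => if Succeeds c then writeOut c else c.mem)
    (executable_writeOut.when (testable_succeeds id))

/-- Try all toggles, then move the output to its place. -/
noncomputable def recoverAll (c : Ctx) : ℕ → ℕ :=
  moveOut (c.withMem (forLoop (forLoop (forLoop (forLoop (forLoop tryToggles)))) c))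

theorem executable_recoverAll : Executable recoverAll :=
  (executable_tryToggles.forLoop.forLoop.forLoop.forLoop.forLoop).seq executable_moveOut

/-! ### Correctness of the test -/

theorem cell_eq {m u : ℕ} (hu : u ≤ m) (v : ℕ) : cell m u v = u * m + v := by
  unfold cell
  have h : (Finset.range m).filter (· < u) = Finset.range u := by
    ext i
    simp only [Finset.mem_filter, Finset.mem_range]
    omega
  rw [← Finset.sum_filter, h, Finset.sum_const, smul_eq_mul, Finset.card_range]

theorem cell_lt {m u v : ℕ} (hu : u < m) (hv : v < m) : cell m u v < m * m := by
  rw [cell_eq hu.le]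
  nlinarith

/-- The digraph that the virtual adjacency defines. -/
def virtualGraph (m : ℕ) (c : Ctx) : Digraph (Fin m) := ⟨fun u v => VirtualEdge c u v⟩

theorem virtualEdge_withMem {c : Ctx} {μ : ℕ → ℕ} (h : ∀ a < c.size * c.size, μ a = c.mem a)
    {u v : ℕ} (hu : u < c.size) (hv : v < c.size) :
    VirtualEdge (c.withMem μ) u v ↔ VirtualEdge c u v := by
  unfold VirtualEdge Ctx.withMem
  simp only [h _ (cell_lt hu hv)]

theorem Succeeds.isCanonicalRPG {n : ℕ} {c : Ctx} (hn : 0 < n) (hc : c.size = 2 * n + 3)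
    (h : Succeeds c) : IsCanonicalRPG n (virtualGraph (2 * n + 3) c) := by
  classical
  obtain ⟨h1, ⟨i, hi, hi2, hi3⟩, h3⟩ := h
  rw [hc] at h1 h3 hi hi2
  obtain rfl : i = n + 1 := by omega
  set ω := Nat.ofBits fun k : Fin n => decide (IsFoundZero c (2 * n - k)) with hω
  have hbit : ∀ k < n, (ω.testBit k = true ↔ IsFoundZero c (2 * n - k)) := by
    intro k hk
    rw [hω, Nat.testBit_ofBits_lt _ _ hk]
    simp
  have hlow : 2 ^ (n - 1) ≤ ω := by
    refine Nat.ge_two_pow_of_testBit ((hbit _ (by omega)).2 ?_)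
    rwa [show 2 * n - (n - 1) = n + 1 by omega]
  have h0 : 0 < ω := lt_of_lt_of_le (by positivity) hlow
  have hsize : ω.size = n := by
    have a1 : ω.size ≤ n := Nat.size_le.2 (Nat.ofBits_lt_two_pow _)
    have a2 : n - 1 < ω.size := Nat.lt_size.2 hlow
    omega
  have hZ : IsFoundZero c = IsZero n ω := by
    funext j
    apply propext
    constructor
    · intro hj
      rcases hj with hj | ⟨hj1, hj2, hj3⟩
      · left; omega
      · right
        refine ⟨by omega, by omega, (hbit _ (by omega)).2 ?_⟩
        rw [show 2 * n - (2 * n - j) = j by omega]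
        exact .inr ⟨hj1, hj2, hj3⟩
    · rintro (hj | ⟨hj1, hj2, hj3⟩)
      · left; omega
      · have := (hbit _ (by omega)).1 hj3
        rwa [show 2 * n - (2 * n - j) = j by omega] at this
  choose! pos hpos using h1
  let f : Fin (2 * n + 3) → Fin (2 * n + 3) := fun w => ⟨pos w, (hpos w w.2).1⟩
  have hf : Function.Injective f := by
    intro a b hab
    have : pos a = pos b := congrArg Fin.val hab
    ext
    rw [← (hpos a a.2).2, ← (hpos b b.2).2, this]
  refine ⟨ω, h0, hsize, ⟨⟨Equiv.ofBijective f (Finite.injective_iff_bijective.1 hf), ?_⟩⟩⟩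
  intro a b
  have key := h3 (pos a) (hpos a a.2).1 (pos b) (hpos b b.2).1
  rw [(hpos a a.2).2, (hpos b b.2).2, hZ] at key
  change _ ↔ VirtualEdge c a b
  rw [key]
  change (pos a = pos b + 1 ∨ (1 ≤ pos a ∧ pos a ≤ 2 * n + 1 ∧ pos b = treeParent n ω (pos a))) ↔ _
  refine or_congr Iff.rfl ⟨?_, ?_⟩
  · rintro ⟨a1, a2, a3⟩
    exact ⟨a1, by omega, (treeParent_eq_iff a1 a2).1 a3.symm⟩
  · rintro ⟨a1, a2, a3⟩
    exact ⟨a1, by omega, ((treeParent_eq_iff a1 (by omega)).2 a3).symm⟩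

/-- The vertices of the virtual digraph are labelled by `t`, with the inverse `s`, so that it
becomes the digraph of the path and the tree `q`. -/
structure IsLabelling (n : ℕ) (q : ℕ → ℕ) (c : Ctx) (t s : ℕ → ℕ) : Prop where
  t_lt : ∀ w < 2 * n + 3, t w < 2 * n + 3
  s_lt : ∀ j < 2 * n + 3, s j < 2 * n + 3
  s_t : ∀ w < 2 * n + 3, s (t w) = w
  t_s : ∀ j < 2 * n + 3, t (s j) = j
  edge_iff : ∀ u < 2 * n + 3, ∀ v < 2 * n + 3, VirtualEdge c u v ↔ Edge n q (t u) (t v)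

theorem exists_isLabelling {n ω : ℕ} {c : Ctx}
    (e : (virtualGraph (2 * n + 3) c).Adj ≃r (watermark n ω).Adj) :
    ∃ t s, IsLabelling n (treeParent n ω) c t s := by
  refine ⟨fun w => e (Fin.ofNat _ w), fun j => e.symm (Fin.ofNat _ j), fun w _ => Fin.is_lt _,
    fun w _ => Fin.is_lt _, ?_, ?_, ?_⟩
  · intro w hw
    simp [Nat.mod_eq_of_lt hw]
  · intro w hw
    simp [Nat.mod_eq_of_lt hw]
  · intro u hu v hv
    have := adj_iff_edge e (Fin.ofNat _ u) (Fin.ofNat _ v)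
    rw [← this]
    change _ ↔ VirtualEdge c _ _
    simp [Nat.mod_eq_of_lt hu, Nat.mod_eq_of_lt hv]

theorem IsLabelling.withMem {n : ℕ} {q : ℕ → ℕ} {c : Ctx} {t s : ℕ → ℕ}
    (h : IsLabelling n q c t s) (hc : c.size = 2 * n + 3) {μ : ℕ → ℕ}
    (hμ : ∀ a < c.size * c.size, μ a = c.mem a) : IsLabelling n q (c.withMem μ) t s where
  t_lt := h.t_lt
  s_lt := h.s_lt
  s_t := h.s_t
  t_s := h.t_s
  edge_iff u hu v hv := by
    rw [virtualEdge_withMem hμ (by omega) (by omega)]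
    exact h.edge_iff u hu v hv

theorem nextVertex_eq {c : Ctx} {j w₀ : ℕ} (h0 : w₀ < c.size)
    (h : ∀ w < c.size, IsNext c j w ↔ w = w₀) : nextVertex c j = w₀ := by
  classical
  unfold nextVertex
  rw [Finset.sum_eq_single w₀]
  · rw [if_pos ((h w₀ h0).2 rfl)]
  · intro w hw hne
    rw [if_neg fun hn => hne ((h w (Finset.mem_range.1 hw)).1 hn)]
  · intro hw
    exact absurd (Finset.mem_range.2 h0) hw

theorem IsLabelling.sum_edge {n : ℕ} {q : ℕ → ℕ} {c : Ctx} {t s : ℕ → ℕ}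
    (h : IsLabelling n q c t s) (hq : IsTree n q) {w : ℕ} (hw : w < 2 * n + 3)
    [∀ x, Decidable (VirtualEdge c w x)] :
    ∑ x ∈ Finset.range (2 * n + 3), (if VirtualEdge c w x then 1 else 0) =
      outDegree n (t w) := by
  classical
  have := h.t_lt w hw
  rw [← card_edge hq (by omega : t w ≤ 2 * n + 2), Finset.card_filter]
  refine Finset.sum_bij' (fun x _ => t x) (fun x _ => s x) ?_ ?_ ?_ ?_ ?_
  · intro x hx; simpa using h.t_lt x (by simpa using hx)
  · intro x hx; simpa using h.s_lt x (by simpa using hx)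
  · intro x hx; exact h.s_t x (by simpa using hx)
  · intro x hx; exact h.t_s x (by simpa using hx)
  · intro x hx
    simp only [h.edge_iff w hw x (by simpa using hx)]

theorem IsLabelling.isNext_iff {n ω : ℕ} {c : Ctx} {t s : ℕ → ℕ} (hω : ω.size = n) (h0 : 0 < ω)
    (h : IsLabelling n (treeParent n ω) c t s) (hc : c.size = 2 * n + 3) {j w : ℕ}
    (hj : j < 2 * n + 3) (hs : ∀ i < 2 * n + 3, j < i → order c i = s i) (hw : w < 2 * n + 3) :
    IsNext c j w ↔ w = s j := by
  classical
  have hw' : w = s j ↔ t w = j :=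
    ⟨fun e => e ▸ h.t_s j hj, fun e => e ▸ (h.s_t w hw).symm⟩
  have htw := h.t_lt w hw
  rw [hw']
  unfold IsNext
  rw [hc]
  constructor
  · rintro (⟨a1, a2⟩ | ⟨a1, a2, a3⟩)
    · have := h.sum_edge (isTree_treeParent hω h0) hw
      rw [a2] at this
      unfold outDegree at this
      split_ifs at this <;> omega
    · rw [hs _ a1 (by omega), h.edge_iff _ (h.s_lt _ a1) _ hw, h.t_s _ a1] at a2
      rcases a2 with a2 | ⟨b1, b2, b3⟩
      · omega
      · have := (treeData hω h0).lt_parent b1 b2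
        exact absurd (by rw [hs _ htw (by omega), h.s_t w hw]) (a3 (t w) htw (by omega))
  · intro e
    by_cases hj2 : j + 1 = 2 * n + 3
    · left
      refine ⟨hj2, ?_⟩
      rw [h.sum_edge (isTree_treeParent hω h0) hw, e]
      unfold outDegree
      rw [if_neg (by omega), if_pos (by omega)]
    · right
      refine ⟨by omega, ?_, ?_⟩
      · rw [hs _ (by omega) (by omega), h.edge_iff _ (h.s_lt _ (by omega)) _ hw,
          h.t_s _ (by omega)]
        left; omega
      · intro i hi hji e2
        rw [hs i hi hji] at e2
        have := h.t_s i hi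
        rw [e2] at this
        omega

theorem iterate_induction {F : ℕ → (ℕ → ℕ) → ℕ → ℕ} {m : ℕ} (Q : ℕ → (ℕ → ℕ) → Prop) {μ : ℕ → ℕ}
    (h0 : Q 0 μ) (hs : ∀ i < m, ∀ μ, Q i μ → Q (i + 1) (F i μ)) : Q m (iterate F μ m) := by
  have : ∀ k ≤ m, Q k (iterate F μ k) := by
    intro k
    induction k with
    | zero => exact fun _ => h0
    | succ k ih => exact fun hk => hs k hk _ (ih (by omega))
  exact this m le_rfl

theorem labelAll_of_lt (c : Ctx) : ∀ a < c.size * c.size, labelAll c a = c.mem a := by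
  refine iterate_induction (fun _ μ => ∀ a < c.size * c.size, μ a = c.mem a) (fun _ _ => rfl) ?_
  intro i _ μ h a ha
  change Function.update μ (cell c.size c.size (c.size - 1 - i)) _ a = c.mem a
  rw [cell_eq le_rfl, Function.update_of_ne (by omega), h a ha]

theorem IsLabelling.order_labelAll {n ω : ℕ} {c : Ctx} {t s : ℕ → ℕ} (hω : ω.size = n)
    (h0 : 0 < ω) (h : IsLabelling n (treeParent n ω) c t s) (hc : c.size = 2 * n + 3) :
    ∀ j < 2 * n + 3, order (c.withMem (labelAll c)) j = s j := by
  have key : (∀ a < c.size * c.size, labelAll c a = c.mem a) ∧ ∀ j < c.size, c.size ≤ j + c.size →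
      labelAll c (cell c.size c.size j) = s j := by
    refine iterate_induction (fun i μ => (∀ a < c.size * c.size, μ a = c.mem a) ∧
      ∀ j < c.size, c.size ≤ j + i → μ (cell c.size c.size j) = s j)
      ⟨fun _ _ => rfl, fun j hj hj2 => by omega⟩ ?_
    rintro i hi μ ⟨h1, h2⟩
    have hnext : nextVertex (c.withMem μ) (c.size - 1 - i) = s (c.size - 1 - i) := by
      refine nextVertex_eq ?_ ?_
      · have := h.s_lt (c.size - 1 - i) (by omega)
        change s (c.size - 1 - i) < c.size
        omega
      · intro w hw
        refine (h.withMem hc h1).isNext_iff hω h0 hc (by omega) ?_ (hc ▸ hw)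
        intro k hk hk2
        exact h2 k (by omega) (by omega)
    change (∀ a < c.size * c.size, Function.update μ (cell c.size c.size (c.size - 1 - i))
      (nextVertex (c.withMem μ) (c.size - 1 - i)) a = c.mem a) ∧ ∀ j < c.size, _ →
        Function.update μ (cell c.size c.size (c.size - 1 - i))
          (nextVertex (c.withMem μ) (c.size - 1 - i)) (cell c.size c.size j) = s j
    rw [hnext]
    refine ⟨fun a ha => ?_, fun j hj hj2 => ?_⟩
    · rw [cell_eq le_rfl, Function.update_of_ne (by omega), h1 a ha]
    · by_cases hji : j = c.size - 1 - i
      · rw [hji, Function.update_self]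
      · rw [Function.update_of_ne, h2 j hj (by omega)]
        rw [cell_eq le_rfl, cell_eq le_rfl]
        omega
  exact fun j hj => key.2 j (by omega) (by omega)

theorem succeeds_labelAll {n : ℕ} {c : Ctx} (hc : c.size = 2 * n + 3)
    (h : IsCanonicalRPG n (virtualGraph (2 * n + 3) c)) :
    Succeeds (c.withMem (labelAll c)) := by
  obtain ⟨ω, h0, hω, ⟨e⟩⟩ := h
  obtain ⟨t, s, h⟩ := exists_isLabelling e
  have ho := h.order_labelAll hω h0 hc
  replace h := h.withMem hc (labelAll_of_lt c)
  set c' := c.withMem (labelAll c)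
  replace hc : c'.size = 2 * n + 3 := hc
  have hZ : IsFoundZero c' = IsZero n ω := by
    funext i
    unfold IsFoundZero IsZero
    rw [hc]
    refine propext (or_congr (by omega) ?_)
    have key : n + 1 ≤ i → i ≤ 2 * n → (VirtualEdge c' (order c' i) (order c' (2 * n + 3 - 1)) ↔
        ω.testBit (2 * n - i) = true) := by
      intro h1 h2
      rw [ho _ (by omega), ho _ (by omega), h.edge_iff _ (h.s_lt _ (by omega)) _
        (h.s_lt _ (by omega)), h.t_s _ (by omega), h.t_s _ (by omega)]
      have := (treeData hω h0).zero_iff_parent (u := i) (by omega) (by omega)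
      unfold IsZero at this
      unfold Edge
      constructor
      · rintro (a | ⟨_, _, a⟩)
        · omega
        · rcases this.2 (by omega) with b | ⟨_, _, b⟩
          · omega
          · exact b
      · intro a
        have := this.1 (.inr ⟨h1, h2, a⟩)
        exact .inr ⟨by omega, by omega, by omega⟩
    constructor
    · rintro ⟨a1, a2, a3⟩
      exact ⟨by omega, by omega, (key (by omega) (by omega)).1 a3⟩
    · rintro ⟨a1, a2, a3⟩
      exact ⟨by omega, by omega, (key (by omega) (by omega)).2 a3⟩
  unfold Succeeds
  rw [hZ, hc]
  refine ⟨?_, ⟨n + 1, by omega, by omega, isZero_first hω h0⟩, ?_⟩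
  · exact fun w hw => ⟨t w, h.t_lt w hw, by rw [ho _ (h.t_lt w hw), h.s_t w hw]⟩
  · intro u hu v hv
    rw [ho u hu, ho v hv, h.edge_iff _ (h.s_lt _ hu) _ (h.s_lt _ hv), h.t_s u hu, h.t_s v hv]
    refine or_congr Iff.rfl ⟨?_, ?_⟩
    · rintro ⟨a1, a2, a3⟩
      exact ⟨a1, by omega, (treeParent_eq_iff a1 a2).1 a3.symm⟩
    · rintro ⟨a1, a2, a3⟩
      exact ⟨a1, by omega, ((treeParent_eq_iff a1 (by omega)).2 a3).symm⟩

theorem virtualGraph_withMem {m : ℕ} {c : Ctx} (hc : c.size = m) {μ : ℕ → ℕ}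
    (hμ : ∀ a < m * m, μ a = c.mem a) : virtualGraph m (c.withMem μ) = virtualGraph m c := by
  subst hc
  unfold virtualGraph
  congr 1
  funext u v
  exact propext (virtualEdge_withMem hμ u.2 v.2)

theorem succeeds_labelAll_iff {n : ℕ} {c : Ctx} (hn : 0 < n) (hc : c.size = 2 * n + 3) :
    Succeeds (c.withMem (labelAll c)) ↔ IsCanonicalRPG n (virtualGraph (2 * n + 3) c) := by
  refine ⟨fun h => ?_, succeeds_labelAll hc⟩
  have := Succeeds.isCanonicalRPG (c := c.withMem (labelAll c)) hn hc h
  rwa [virtualGraph_withMem hc (hc ▸ labelAll_of_lt c)] at this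

/-! ### Detection -/

/-- The initial configuration on input `G`. -/
noncomputable def inputConfig {m : ℕ} (G : Digraph (Fin m)) : Config where
  reg x := if x = 0 then m else 0
  mem a := if h : a < m * m then
      adjBit G ⟨a / m, Nat.div_lt_of_lt_mul h⟩
        ⟨a % m, Nat.mod_lt _ (Nat.pos_of_ne_zero fun h0 => by simp [h0] at h)⟩
    else 0

theorem inputConfig_mem {m : ℕ} (G : Digraph (Fin m)) (u v : Fin m) :
    (inputConfig G).mem (cell m u v) = adjBit G u v := by
  have h := cell_lt u.2 v.2
  have hm : 0 < m := u.pos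
  unfold inputConfig
  simp only [dif_pos h]
  congr 1
  · ext
    simp [cell_eq u.2.le, add_comm, Nat.add_mul_div_right _ _ hm, Nat.div_eq_of_lt v.2]
  · ext
    simp [cell_eq u.2.le, Nat.mod_eq_of_lt v.2]

theorem IsInput.eq_inputConfig {m : ℕ} {s : Config} {G : Digraph (Fin m)} (h : IsInput s G) :
    s = inputConfig G := by
  obtain ⟨h1, h2, h3, h4⟩ := h
  have hreg : s.reg = (inputConfig G).reg := by
    funext x
    by_cases hx : x = 0
    · subst hx
      exact h1
    · rw [h2 x hx]
      exact (if_neg hx).symm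
  have hmem : s.mem = (inputConfig G).mem := by
    funext a
    by_cases ha : a < m * m
    · have hm : 0 < m := Nat.pos_of_ne_zero fun h0 => by simp [h0] at ha
      have h5 := h3 ⟨a / m, Nat.div_lt_of_lt_mul ha⟩ ⟨a % m, Nat.mod_lt _ hm⟩
      have h6 := inputConfig_mem G ⟨a / m, Nat.div_lt_of_lt_mul ha⟩ ⟨a % m, Nat.mod_lt _ hm⟩
      rw [cell_eq (Nat.div_lt_of_lt_mul ha).le] at h6
      simp only [Nat.div_add_mod'] at h5 h6
      rw [h5, h6]
    · rw [h4 a (by rw [pow_two]; omega)]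
      unfold inputConfig
      simp only [dif_neg ha]
  cases s
  cases hreg
  cases hmem
  rfl

/-- The context in which the algorithms start on input `G`: all variables are `0`. -/
noncomputable def inputCtx {m : ℕ} (G : Digraph (Fin m)) : Ctx := (inputConfig G).ctx fun _ => 1

/-- The memory holds the adjacency matrix of `H`. -/
def Stores {m : ℕ} (H : Digraph (Fin m)) (μ : ℕ → ℕ) : Prop :=
  ∀ u v : Fin m, μ (cell m u v) = adjBit H u v

theorem stores_inputCtx {m : ℕ} (G : Digraph (Fin m)) : Stores G (inputCtx G).mem :=
  inputConfig_mem G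

theorem virtualEdge_iff {m : ℕ} {H : Digraph (Fin m)} {c : Ctx} (hc : c.size = m)
    (h : Stores H c.mem) (u v : Fin m) :
    VirtualEdge c u v ↔ ¬ (H.Adj u v ↔ c.var 4 ≠ 0 ∧
      ((u.1 = c.var 0 ∧ v.1 = c.var 1) ∨ (u.1 = c.var 2 ∧ v.1 = c.var 3))) := by
  unfold VirtualEdge
  rw [hc, h u v]
  unfold adjBit
  by_cases ha : H.Adj u v <;> simp [ha]

theorem virtualGraph_inputCtx {m : ℕ} (G : Digraph (Fin m)) :
    virtualGraph m (inputCtx G) = G := by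
  unfold virtualGraph
  cases G with
  | mk A =>
    congr 1
    funext u v
    have h := virtualEdge_iff (m := m) (c := inputCtx ⟨A⟩) rfl (stores_inputCtx ⟨A⟩) u v
    have h4 : (inputCtx ⟨A⟩).var 4 = 0 := rfl
    simpa [h4] using h

/-- The test that raises the alarm if the digraph is not found to be a watermark. -/
def alarm (m : ℕ) (G : Digraph (Fin m)) : Prop :=
  ¬ Succeeds ((inputCtx G).withMem (labelAll (inputCtx G)))

theorem polyTimeDecidable_alarm : PolyTimeDecidable alarm := by
  obtain ⟨P, p, hP⟩ := executable_labelAll (fun _ => 1) 2 (by omega) (by simp)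
  obtain ⟨Q, q, hQ⟩ := (testable_succeeds id).not (fun _ => 1) 2 (by omega) (by simp)
  refine ⟨.seq (.seq P Q) (.seq (.const 0 0) (.add 0 0 2)), p + q + 2, fun m G s hs => ?_⟩
  obtain rfl := hs.eq_inputConfig
  obtain ⟨t₁, s₁, r₁, c₁, v₁, e₁⟩ := hP (inputConfig G)
  obtain ⟨t₂, s₂, r₂, c₂, v₂, m₂, e₂⟩ := hQ s₁
  have hreg : (inputConfig G).reg 0 = m := rfl
  rw [Config.ctx_withMem (by omega) (by simp) e₁, v₁] at v₂
  rw [e₁ 0 (by omega), hreg] at c₂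
  rw [hreg] at c₁
  refine ⟨_, _, .seq (.seq r₁ r₂) (.seq (.const 0 0 s₂) (.add 0 0 2 _)), ?_, ?_, ?_⟩
  · simp only [Polynomial.eval_add, Polynomial.eval_ofNat]
    omega
  · intro h
    have : s₂.reg 2 = 1 := v₂.trans (if_pos h)
    simp [Function.update, this]
  · intro h
    have : s₂.reg 2 = 0 := v₂.trans (if_neg h)
    simp [Function.update, this]

theorem detectsUpTo_alarm : DetectsUpTo 5 alarm := by
  intro n hn G H hG hGH
  unfold alarm
  rw [succeeds_labelAll_iff (by omega) rfl, virtualGraph_inputCtx]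
  refine ⟨fun h e => h (e ▸ hG), fun h hH => ?_⟩
  have := six_le_numModifications hn hG hH (Ne.symm h)
  omega

/-! ### Recovery -/

theorem forLoop_forLoop_update {c : Ctx} {addr : ℕ → ℕ → ℕ → ℕ} {val : Ctx → ℕ} {W : ℕ → ℕ → ℕ}
    (hinj : ∀ u < c.size, ∀ v < c.size, ∀ u' < c.size, ∀ v' < c.size,
      addr c.size u v = addr c.size u' v' → u = u' ∧ v = v')
    (hval : ∀ u < c.size, ∀ v < c.size, ∀ μ : ℕ → ℕ,
      (∀ a, (∀ u' < c.size, ∀ v' < c.size, addr c.size u' v' ≠ a) → μ a = c.mem a) →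
        val (((c.withMem μ).cons u).cons v) = W u v) :
    (∀ u < c.size, ∀ v < c.size, forLoop (forLoop fun c => Function.update c.mem
      (addr c.size (c.var 1) (c.var 0)) (val c)) c (addr c.size u v) = W u v) ∧
    ∀ a, (∀ u < c.size, ∀ v < c.size, addr c.size u v ≠ a) → forLoop (forLoop fun c =>
      Function.update c.mem (addr c.size (c.var 1) (c.var 0)) (val c)) c a = c.mem a := by
  set Off : (ℕ → ℕ) → Prop := fun μ =>
    ∀ a, (∀ u < c.size, ∀ v < c.size, addr c.size u v ≠ a) → μ a = c.mem a with hOff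
  have key : (∀ u < c.size, ∀ v < c.size, u < c.size → forLoop (forLoop fun c =>
      Function.update c.mem (addr c.size (c.var 1) (c.var 0)) (val c)) c (addr c.size u v) =
        W u v) ∧ Off (forLoop (forLoop fun c => Function.update c.mem
          (addr c.size (c.var 1) (c.var 0)) (val c)) c) := by
    refine iterate_induction (fun i μ => (∀ u < c.size, ∀ v < c.size, u < i →
      μ (addr c.size u v) = W u v) ∧ Off μ) ⟨fun _ _ _ _ h => absurd h (by omega),
        fun _ _ => rfl⟩ ?_
    rintro i hi μ ⟨h1, h2⟩
    have key : (∀ u < c.size, ∀ v < c.size, (u < i ∨ u = i ∧ v < c.size) →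
        forLoop (fun c => Function.update c.mem (addr c.size (c.var 1) (c.var 0)) (val c))
          ((c.withMem μ).cons i) (addr c.size u v) = W u v) ∧
        Off (forLoop (fun c => Function.update c.mem (addr c.size (c.var 1) (c.var 0)) (val c))
          ((c.withMem μ).cons i)) := by
      refine iterate_induction (fun j μ => (∀ u < c.size, ∀ v < c.size, (u < i ∨ u = i ∧ v < j) →
        μ (addr c.size u v) = W u v) ∧ Off μ)
          ⟨fun u hu v hv h => h1 u hu v hv (by omega), h2⟩ ?_
      rintro j hj μ ⟨h3, h4⟩
      change j < c.size at hj
      change (∀ u < c.size, ∀ v < c.size, (u < i ∨ u = i ∧ v < j + 1) →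
        Function.update μ (addr c.size i j) (val (((c.withMem μ).cons i).cons j))
          (addr c.size u v) = W u v) ∧
        Off (Function.update μ (addr c.size i j) (val (((c.withMem μ).cons i).cons j)))
      rw [hval i hi j hj μ h4]
      refine ⟨fun u hu v hv h => ?_, fun a ha => ?_⟩
      · by_cases he : addr c.size u v = addr c.size i j
        · obtain ⟨rfl, rfl⟩ := hinj u hu v hv i hi j hj he
          rw [Function.update_self]
        · rw [Function.update_of_ne he]
          refine h3 u hu v hv ?_
          by_contra hne
          exact he (by rw [show u = i by omega, show v = j by omega])
      · rw [Function.update_of_ne (ha i hi j hj).symm]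
        exact h4 a ha
    exact ⟨fun u hu v hv h => key.1 u hu v hv (by omega), key.2⟩
  exact ⟨fun u hu v hv => key.1 u hu v hv hu, key.2⟩

theorem cell_inj {m u v u' v' : ℕ} (hu : u < m) (hv : v < m) (hu' : u' < m) (hv' : v' < m)
    (h : cell m u v = cell m u' v') : u = u' ∧ v = v' := by
  rw [cell_eq hu.le, cell_eq hu'.le] at h
  have h1 : u = u' := by
    rcases lt_trichotomy u u' with h2 | h2 | h2
    · nlinarith
    · exact h2
    · nlinarith
  subst h1
  exact ⟨rfl, by omega⟩

theorem outCell_eq (m u v : ℕ) : outCell m u v = m * m + (m + cell m u v) :=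
  cell_eq le_rfl _

open Classical in
theorem writeOut_spec (c : Ctx) :
    (∀ u < c.size, ∀ v < c.size, writeOut c (outCell c.size u v) =
      if VirtualEdge c u v then 1 else 0) ∧
    ∀ a, (∀ u < c.size, ∀ v < c.size, outCell c.size u v ≠ a) → writeOut c a = c.mem a := by
  refine forLoop_forLoop_update (addr := outCell) (val := fun c =>
    if VirtualEdge (c.rename (· + 2)) (c.var 1) (c.var 0) then 1 else 0) ?_ ?_
  · intro u hu v hv u' hu' v' hv' h
    rw [outCell_eq, outCell_eq] at h
    exact cell_inj hu hv hu' hv' (by omega)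
  · intro u hu v hv μ hμ
    have : VirtualEdge (c.withMem μ) u v ↔ VirtualEdge c u v :=
      virtualEdge_withMem (fun a ha => hμ a fun u' _ v' _ => by rw [outCell_eq]; omega) hu hv
    change (if VirtualEdge (c.withMem μ) u v then 1 else 0) = _
    simp only [this]

theorem moveOut_spec (c : Ctx) {u v : ℕ} (hu : u < c.size) (hv : v < c.size) :
    moveOut c (cell c.size u v) = if c.mem (outCell c.size u v) ≠ 0 then 1 else 0 := by
  refine (forLoop_forLoop_update (addr := cell) (val := fun c =>
    if c.mem (outCell c.size (c.var 1) (c.var 0)) ≠ 0 then 1 else 0)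
    (W := fun u v => if c.mem (outCell c.size u v) ≠ 0 then 1 else 0) ?_ ?_).1 u hu v hv
  · exact fun u hu v hv u' hu' v' hv' h => cell_inj hu hv hu' hv' h
  · intro u hu v hv μ hμ
    change (if μ (outCell c.size u v) ≠ 0 then 1 else 0) = _
    rw [hμ]
    intro u' hu' v' hv'
    have := cell_lt hu' hv'
    rw [outCell_eq]
    omega

theorem labelAll_outCell (c : Ctx) (u v : ℕ) :
    labelAll c (outCell c.size u v) = c.mem (outCell c.size u v) := by
  refine iterate_induction (fun _ μ => μ (outCell c.size u v) = c.mem (outCell c.size u v)) rfl ?_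
  intro i hi μ h
  change Function.update μ (cell c.size c.size (c.size - 1 - i)) _ (outCell c.size u v) = _
  rw [cell_eq le_rfl, outCell_eq, Function.update_of_ne (by omega), ← outCell_eq, h]

theorem Stores.congr {m : ℕ} {H : Digraph (Fin m)} {μ ν : ℕ → ℕ} (h : Stores H μ)
    (e : ∀ a < m * m, ν a = μ a) : Stores H ν :=
  fun u v => (e _ (cell_lt u.2 v.2)).trans (h u v)

/-- The output in the memory is the adjacency matrix of `G`. -/
def Outputs {m : ℕ} (G : Digraph (Fin m)) (μ : ℕ → ℕ) : Prop :=
  ∀ u v : Fin m, μ (outCell m u v) = adjBit G u v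

theorem stores_tryToggles {m : ℕ} {H : Digraph (Fin m)} {c : Ctx} (hc : c.size = m)
    (h : Stores H c.mem) : Stores H (tryToggles c) := by
  subst hc
  refine h.congr fun a ha => ?_
  unfold tryToggles
  split_ifs
  · rw [(writeOut_spec (c.withMem (labelAll c))).2 a fun u _ v _ => ?_]
    · exact labelAll_of_lt c a ha
    · rw [outCell_eq]
      change c.size * c.size + _ ≠ _
      omega
  · exact labelAll_of_lt c a ha

theorem outputs_tryToggles {n : ℕ} (hn : 0 < n) {c : Ctx} (hc : c.size = 2 * n + 3)
    (h : IsCanonicalRPG n (virtualGraph (2 * n + 3) c)) :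
    Outputs (virtualGraph (2 * n + 3) c) (tryToggles c) := by
  classical
  intro u v
  unfold tryToggles
  rw [if_pos ((succeeds_labelAll_iff hn hc).2 h)]
  have h1 := (writeOut_spec (c.withMem (labelAll c))).1 u (u.2.trans_eq hc.symm) v
    (v.2.trans_eq hc.symm)
  change writeOut _ (outCell c.size u v) = _ at h1
  rw [hc] at h1
  rw [h1]
  unfold adjBit
  have := virtualEdge_withMem (labelAll_of_lt c) (u.2.trans_eq hc.symm) (v.2.trans_eq hc.symm)
  simp only [this]
  rfl

theorem tryToggles_outCell {n : ℕ} (hn : 0 < n) {c : Ctx} (hc : c.size = 2 * n + 3)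
    (h : ¬ IsCanonicalRPG n (virtualGraph (2 * n + 3) c)) (u v : ℕ) :
    tryToggles c (outCell (2 * n + 3) u v) = c.mem (outCell (2 * n + 3) u v) := by
  unfold tryToggles
  rw [if_neg (fun h' => h ((succeeds_labelAll_iff hn hc).1 h')), ← hc, labelAll_outCell]

theorem numModifications_virtualGraph {m : ℕ} {H : Digraph (Fin m)} {c : Ctx} (hc : c.size = m)
    (h : Stores H c.mem) : numModifications H (virtualGraph m c) ≤ 2 := by
  have hsub : symmDiff (edgeSet H) (edgeSet (virtualGraph m c)) ⊆
      {e | e.1.1 = c.var 0 ∧ e.2.1 = c.var 1} ∪ {e | e.1.1 = c.var 2 ∧ e.2.1 = c.var 3} := by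
    rintro ⟨u, v⟩ he
    have h1 : (u, v) ∈ edgeSet (virtualGraph m c) ↔ _ := virtualEdge_iff hc h u v
    have h2 : (u, v) ∈ edgeSet H ↔ H.Adj u v := Iff.rfl
    rw [Set.mem_symmDiff, h1, h2] at he
    change (u.1 = c.var 0 ∧ v.1 = c.var 1) ∨ (u.1 = c.var 2 ∧ v.1 = c.var 3)
    tauto
  have hone : ∀ x y : ℕ, {e : Fin m × Fin m | e.1.1 = x ∧ e.2.1 = y}.ncard ≤ 1 := by
    intro x y
    rw [Set.ncard_le_one (Set.toFinite _)]
    rintro ⟨a, b⟩ ⟨h1, h2⟩ ⟨a', b'⟩ ⟨h3, h4⟩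
    simp only [Prod.mk.injEq, Fin.ext_iff]
    exact ⟨h1.trans h3.symm, h2.trans h4.symm⟩
  calc numModifications H (virtualGraph m c) ≤ _ := Set.ncard_le_ncard hsub (Set.toFinite _)
    _ ≤ _ := Set.ncard_union_le _ _
    _ ≤ 1 + 1 := Nat.add_le_add (hone _ _) (hone _ _)

/-- The command `B` keeps the invariant `I` of the memory, then keeps its property `O`, and
achieves `O` if the first `k` variables have the values `x 0, …, x (k - 1)`. -/
structure Finds (m : ℕ) (I O : (ℕ → ℕ) → Prop) (B : Ctx → ℕ → ℕ) (k : ℕ) (x : ℕ → ℕ) : Prop where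
  inv : ∀ c, c.size = m → I c.mem → I (B c)
  keep : ∀ c, c.size = m → I c.mem → O c.mem → O (B c)
  find : ∀ c, c.size = m → I c.mem → (∀ i < k, c.var i = x i) → O (B c)

theorem Finds.forLoop {m : ℕ} {I O : (ℕ → ℕ) → Prop} {B : Ctx → ℕ → ℕ} {k : ℕ} {x : ℕ → ℕ}
    (h : Finds m I O B (k + 1) x) (h0 : x 0 < m) :
    Finds m I O (forLoop B) k fun i => x (i + 1) where
  inv c hc hI := iterate_induction (fun _ => I) hI fun i _ μ hμ =>
    h.inv ((c.withMem μ).cons i) hc hμ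
  keep c hc hI hO := (iterate_induction (fun _ μ => I μ ∧ O μ) ⟨hI, hO⟩ fun i _ μ hμ =>
    ⟨h.inv ((c.withMem μ).cons i) hc hμ.1, h.keep ((c.withMem μ).cons i) hc hμ.1 hμ.2⟩).2
  find c hc hI hx := (iterate_induction (fun i μ => I μ ∧ (x 0 < i → O μ))
    ⟨hI, fun h => absurd h (by omega)⟩ fun i _ μ hμ =>
    ⟨h.inv ((c.withMem μ).cons i) hc hμ.1, fun hi => by
      by_cases hi0 : x 0 < i
      · exact h.keep ((c.withMem μ).cons i) hc hμ.1 (hμ.2 hi0)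
      · refine h.find ((c.withMem μ).cons i) hc hμ.1 fun j hj => ?_
        cases j with
        | zero =>
          change i = x 0
          omega
        | succ j => exact hx j (by omega)⟩).2 (hc ▸ h0)

theorem finds_tryToggles {n : ℕ} (hn : 2 < n) {G H : Digraph (Fin (2 * n + 3))}
    (hG : IsCanonicalRPG n G) (hGH : numModifications G H ≤ 2) {x : ℕ → ℕ}
    (hx : ∀ u v : Fin (2 * n + 3), G.Adj u v ↔ ¬ (H.Adj u v ↔ x 4 ≠ 0 ∧
      ((u.1 = x 0 ∧ v.1 = x 1) ∨ (u.1 = x 2 ∧ v.1 = x 3)))) :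
    Finds (2 * n + 3) (Stores H) (Outputs G) tryToggles 5 x where
  inv c hc hI := stores_tryToggles hc hI
  keep c hc hI hO := by
    by_cases hcan : IsCanonicalRPG n (virtualGraph (2 * n + 3) c)
    · have : G = virtualGraph (2 * n + 3) c := by
        by_contra hne
        have h1 := six_le_numModifications hn hG hcan hne
        have h2 := numModifications_triangle G H (virtualGraph (2 * n + 3) c)
        have h3 := numModifications_virtualGraph hc hI
        omega
      rw [this]
      exact outputs_tryToggles (by omega) hc hcan
    · intro u v
      rw [tryToggles_outCell (by omega) hc hcan]
      exact hO u v
  find c hc hI hv := by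
    have : virtualGraph (2 * n + 3) c = G := by
      cases G with
      | mk A =>
        unfold virtualGraph
        congr 1
        funext u v
        refine propext ?_
        rw [virtualEdge_iff hc hI, hv 0 (by omega), hv 1 (by omega), hv 2 (by omega),
          hv 3 (by omega), hv 4 (by omega), ← hx]
    rw [← this]
    exact outputs_tryToggles (by omega) hc (this ▸ hG)

theorem exists_toggles {m : ℕ} (hm : 1 < m) {G H : Digraph (Fin m)}
    (hGH : numModifications G H ≤ 2) : ∃ x : ℕ → ℕ, (∀ i, x i < m) ∧
      ∀ u v : Fin m, G.Adj u v ↔ ¬ (H.Adj u v ↔ x 4 ≠ 0 ∧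
        ((u.1 = x 0 ∧ v.1 = x 1) ∨ (u.1 = x 2 ∧ v.1 = x 3))) := by
  have key : ∀ u v : Fin m, (u, v) ∈ symmDiff (edgeSet G) (edgeSet H) ↔
      ¬ (G.Adj u v ↔ H.Adj u v) := by
    intro u v
    have h1 : (u, v) ∈ edgeSet G ↔ G.Adj u v := Iff.rfl
    have h2 : (u, v) ∈ edgeSet H ↔ H.Adj u v := Iff.rfl
    rw [Set.mem_symmDiff, h1, h2]
    tauto
  have two : (∃ p q : Fin m × Fin m, symmDiff (edgeSet G) (edgeSet H) = {p, q}) →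
      ∃ x : ℕ → ℕ, (∀ i, x i < m) ∧ ∀ u v : Fin m, G.Adj u v ↔ ¬ (H.Adj u v ↔ x 4 ≠ 0 ∧
        ((u.1 = x 0 ∧ v.1 = x 1) ∨ (u.1 = x 2 ∧ v.1 = x 3))) := by
    rintro ⟨⟨a, b⟩, ⟨a', b'⟩, h⟩
    refine ⟨fun i => if i = 0 then a else if i = 1 then b else if i = 2 then a' else
      if i = 3 then b' else 1, fun i => ?_, fun u v => ?_⟩
    · dsimp only
      split_ifs
      exacts [a.2, b.2, a'.2, b'.2, hm]
    · have h1 := key u v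
      rw [h, Set.mem_insert_iff, Set.mem_singleton_iff] at h1
      simp only [Prod.mk.injEq, Fin.ext_iff] at h1
      simp only [↓reduceIte, OfNat.ofNat_ne_zero, OfNat.ofNat_ne_one, ne_eq, one_ne_zero,
        not_false_eq_true, true_and, Nat.reduceEqDiff]
      tauto
  unfold numModifications at hGH
  interval_cases hk : (symmDiff (edgeSet G) (edgeSet H)).ncard
  · rw [Set.ncard_eq_zero (Set.toFinite _)] at hk
    refine ⟨fun _ => 0, fun _ => Nat.zero_lt_of_lt hm, fun u v => ?_⟩
    have h1 := key u v
    rw [hk] at h1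
    simp only [Set.mem_empty_iff_false, false_iff, not_not] at h1
    simp [h1]
  · obtain ⟨p, hp⟩ := Set.ncard_eq_one.1 hk
    exact two ⟨p, p, by rw [hp, Set.pair_eq_singleton]⟩
  · obtain ⟨p, q, -, hp⟩ := Set.ncard_eq_two.1 hk
    exact two ⟨p, q, hp⟩

/-- The digraph that is found by trying all toggles. -/
def recover (m : ℕ) (H : Digraph (Fin m)) : Digraph (Fin m) :=
  ⟨fun u v => recoverAll (inputCtx H) (cell m u v) ≠ 0⟩

theorem recoverAll_spec {c : Ctx} {u v : ℕ} (hu : u < c.size) (hv : v < c.size) :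
    recoverAll c (cell c.size u v) =
      if forLoop (forLoop (forLoop (forLoop (forLoop tryToggles)))) c (outCell c.size u v) ≠ 0
        then 1 else 0 :=
  moveOut_spec (c.withMem _) hu hv

theorem polyTimeComputable_recover : PolyTimeComputable recover := by
  obtain ⟨P, p, hP⟩ := executable_recoverAll (fun _ => 1) 2 (by omega) (by simp)
  refine ⟨P, p, fun m G s hs => ?_⟩
  obtain rfl := hs.eq_inputConfig
  obtain ⟨t, s', r, ht, hm, -⟩ := hP (inputConfig G)
  refine ⟨t, s', r, ht, fun u v => ?_⟩
  rw [hm, ← cell_eq u.2.le]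
  unfold adjBit recover
  have := recoverAll_spec (c := inputCtx G) u.2 v.2
  change recoverAll (inputCtx G) (cell m u v) = _
  change recoverAll (inputCtx G) (cell m u v) = _ at this
  rw [this]
  split_ifs <;> simp_all

theorem recoversUpTo_recover : RecoversUpTo 2 recover := by
  intro n hn G H hG hGH
  obtain ⟨x, hx, hx'⟩ := exists_toggles (by omega) hGH
  have h := ((((finds_tryToggles hn hG hGH hx').forLoop (hx _)).forLoop (hx _)).forLoop
    (hx _)).forLoop (hx _) |>.forLoop (hx _)
  have hout := h.find (inputCtx H) rfl (stores_inputCtx H) fun i hi => absurd hi (by omega)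
  cases G with
  | mk A =>
    unfold recover
    congr 1
    funext u v
    have := recoverAll_spec (c := inputCtx H) u.2 v.2
    change recoverAll (inputCtx H) (cell (2 * n + 3) u v) = _ at this
    refine propext ?_
    rw [this]
    have h1 := hout u v
    change forLoop _ (inputCtx H) (outCell (inputCtx H).size u v) = _ at h1
    rw [h1]
    unfold adjBit
    simp

/-! ### Two watermarks at distance three -/

instance (n ω : ℕ) : DecidableRel (watermark n ω).Adj := fun u v =>
  inferInstanceAs (Decidable ((u : ℕ) = v + 1 ∨
    (1 ≤ (u : ℕ) ∧ (u : ℕ) ≤ 2 * n + 1 ∧ (v : ℕ) = treeParent n ω u)))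

theorem isCanonicalRPG_watermark {n ω : ℕ} (h0 : 0 < ω) (hω : ω.size = n) :
    IsCanonicalRPG n (watermark n ω) := ⟨ω, h0, hω, ⟨RelIso.refl _⟩⟩

theorem isCanonicalRPG_eight : IsCanonicalRPG 4 (watermark 4 8) :=
  isCanonicalRPG_watermark (by norm_num) (by decide)

theorem isCanonicalRPG_nine : IsCanonicalRPG 4 (watermark 4 9) :=
  isCanonicalRPG_watermark (by norm_num) (by decide)

theorem card_out_eq {m : ℕ} {G H : Digraph (Fin m)} [DecidableRel G.Adj] [DecidableRel H.Adj]
    (e : G.Adj ≃r H.Adj) (v : Fin m) :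
    (Finset.univ.filter fun w => G.Adj v w).card =
      (Finset.univ.filter fun w => H.Adj (e v) w).card :=
  Finset.card_equiv e.toEquiv fun w => by simp [e.map_rel_iff]

theorem card_in_eq {m : ℕ} {G H : Digraph (Fin m)} [DecidableRel G.Adj] [DecidableRel H.Adj]
    (e : G.Adj ≃r H.Adj) (v : Fin m) :
    (Finset.univ.filter fun w => G.Adj w v).card =
      (Finset.univ.filter fun w => H.Adj w (e v)).card :=
  Finset.card_equiv e.toEquiv fun w => by simp [e.map_rel_iff]

theorem isEmpty_eight_nine : IsEmpty ((watermark 4 8).Adj ≃r (watermark 4 9).Adj) := by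
  refine ⟨fun e => ?_⟩
  have h1 := card_out_eq e 10
  have h2 := card_in_eq e 10
  have h3 : (Finset.univ.filter fun w => (watermark 4 8).Adj 10 w).card = 1 := by decide
  have h4 : (Finset.univ.filter fun w => (watermark 4 8).Adj w 10).card = 2 := by decide
  have h5 : ∀ v, (Finset.univ.filter fun w => (watermark 4 9).Adj v w).card = 1 →
      (Finset.univ.filter fun w => (watermark 4 9).Adj w v).card = 3 := by decide
  have h6 := h5 (e 10) (by omega)
  omega

theorem ncard_diff_eq_card {m : ℕ} (G H : Digraph (Fin m)) [DecidableRel G.Adj]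
    [DecidableRel H.Adj] : (edgeSet G \ edgeSet H).ncard =
      (Finset.univ.filter fun e : Fin m × Fin m => G.Adj e.1 e.2 ∧ ¬ H.Adj e.1 e.2).card := by
  rw [← Set.ncard_coe_finset]
  congr 1
  ext e
  simp [edgeSet]

theorem ncard_eight_diff_nine :
    (edgeSet (watermark 4 8) \ edgeSet (watermark 4 9)).ncard = 3 := by
  rw [ncard_diff_eq_card]
  decide

theorem ncard_nine_diff_eight :
    (edgeSet (watermark 4 9) \ edgeSet (watermark 4 8)).ncard = 3 := by
  rw [ncard_diff_eq_card]
  decide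

theorem eight_ne_nine : watermark 4 8 ≠ watermark 4 9 := fun h => by
  have := ncard_eight_diff_nine
  rw [h, Set.sdiff_self, Set.ncard_empty] at this
  omega

theorem not_detectsUpTo_six (A : ∀ m : ℕ, Digraph (Fin m) → Prop) : ¬ DetectsUpTo 6 A := by
  intro h
  have h1 := h 4 (by norm_num) (watermark 4 8) (watermark 4 9) isCanonicalRPG_eight (by
    rw [numModifications_eq, ncard_eight_diff_nine, ncard_nine_diff_eight])
  have h2 := h 4 (by norm_num) (watermark 4 9) (watermark 4 9) isCanonicalRPG_nine (by
    simp [numModifications])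
  exact h2.1 (h1.2 eight_ne_nine.symm) rfl

theorem not_recoversUpTo_three (R : ∀ m : ℕ, Digraph (Fin m) → Digraph (Fin m)) :
    ¬ RecoversUpTo 3 R := by
  intro h
  let H : Digraph (Fin (2 * 4 + 3)) :=
    ⟨fun u v => (watermark 4 8).Adj u v ∧ (watermark 4 9).Adj u v⟩
  have e : edgeSet H = edgeSet (watermark 4 8) ∩ edgeSet (watermark 4 9) := rfl
  have h1 := h 4 (by norm_num) (watermark 4 8) H isCanonicalRPG_eight (by
    rw [numModifications_eq, e, Set.sdiff_self_inter, ncard_eight_diff_nine,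
      Set.sdiff_eq_empty.2 Set.inter_subset_left, Set.ncard_empty])
  have h2 := h 4 (by norm_num) (watermark 4 9) H isCanonicalRPG_nine (by
    rw [numModifications_eq, e, Set.inter_comm, Set.sdiff_self_inter, ncard_nine_diff_eight,
      Set.sdiff_eq_empty.2 Set.inter_subset_left, Set.ncard_empty])
  exact eight_ne_nine (h1.symm.trans h2)

end Watermark

theorem mainTheorem4 :
    (∀ n : ℕ, 2 < n → ∀ G₁ G₂ : Digraph (Fin (2 * n + 3)),
      Watermark.IsCanonicalRPG n G₁ → Watermark.IsCanonicalRPG n G₂ → G₁ ≠ G₂ →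
        3 ≤ (Watermark.edgeSet G₁ \ Watermark.edgeSet G₂).ncard ∧
        (Watermark.edgeSet G₁ \ Watermark.edgeSet G₂).ncard =
          (Watermark.edgeSet G₂ \ Watermark.edgeSet G₁).ncard) ∧
    (∃ A : ∀ m : ℕ, Digraph (Fin m) → Prop,
      Watermark.PolyTimeDecidable A ∧ Watermark.DetectsUpTo 5 A) ∧
    (∃ R : ∀ m : ℕ, Digraph (Fin m) → Digraph (Fin m),
      Watermark.PolyTimeComputable R ∧ Watermark.RecoversUpTo 2 R) ∧
    (Watermark.IsCanonicalRPG 4 (Watermark.watermark 4 8) ∧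
      Watermark.IsCanonicalRPG 4 (Watermark.watermark 4 9) ∧
      IsEmpty ((Watermark.watermark 4 8).Adj ≃r (Watermark.watermark 4 9).Adj) ∧
      (Watermark.edgeSet (Watermark.watermark 4 8) \
        Watermark.edgeSet (Watermark.watermark 4 9)).ncard = 3 ∧
      (Watermark.edgeSet (Watermark.watermark 4 9) \
        Watermark.edgeSet (Watermark.watermark 4 8)).ncard = 3) ∧
    (¬ ∃ A : ∀ m : ℕ, Digraph (Fin m) → Prop, Watermark.DetectsUpTo 6 A) ∧
    (¬ ∃ R : ∀ m : ℕ, Digraph (Fin m) → Digraph (Fin m), Watermark.RecoversUpTo 3 R) :=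
  ⟨fun _ hn _ _ h₁ h₂ hne => ⟨Watermark.three_le_ncard_diff hn h₁ h₂ hne,
      Watermark.ncard_diff_eq hn h₁ h₂⟩,
    ⟨_, Watermark.polyTimeDecidable_alarm, Watermark.detectsUpTo_alarm⟩,
    ⟨_, Watermark.polyTimeComputable_recover, Watermark.recoversUpTo_recover⟩,
    ⟨Watermark.isCanonicalRPG_eight, Watermark.isCanonicalRPG_nine, Watermark.isEmpty_eight_nine,
      Watermark.ncard_eight_diff_nine, Watermark.ncard_nine_diff_eight⟩,
    fun ⟨A, hA⟩ => Watermark.not_detectsUpTo_six A hA,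
    fun ⟨R, hR⟩ => Watermark.not_recoversUpTo_three R hR⟩
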